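/- Definitions. A \emph{teleological category} is a symmetric monoidal category $\mathcal C$ with a wide symmetric monoidal subcategory $\mathcal C_d$ of dualisable morphisms, an involutive symmetric monoidal functor $(-)^*:\mathcal C_d^{\mathrm{op}}\to\mathcal C_d$ (with $X^{**}=X$, $I^*=I$, $(X\otimes Y)^*=X^*\otimes Y^*$), and morphisms $\epsilon_X:X\otimes X^*\to I$ in $\mathcal C$ (counits) such that (i) $\epsilon_Y\circ(f\otimes Y^*)=\epsilon_X\circ(X\otimes f^*)$ for every dualisable $f:X\to Y$ (extranaturality), (ii) $\epsilon_{X^*}=\epsilon_X\circ\sigma_{X^*,X}$, (iii) $\epsilon_{X\otimes Y}=(\epsilon_X\otimes\epsilon_Y)\circ(X\otimes\sigma_{Y,X^*}\otimes Y^*)$. A \emph{teleological signature} $\Sigma$ consists of a set of object symbols, a set of morphism symbols with a subset of dualisable ones, and for each morphism symbol $f$ two words $\mathrm{dom}(f),\mathrm{cod}(f)$ in the letters $x,x^*$ ($x$ an object symbol), where $x^{**}=x$. The dual of a word is obtained by dualising each letter, keeping the order. A \emph{teleological diagram} $A:X\to Y$ over $\Sigma$, for words $X,Y$, is a finite graph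 with oriented edges drawn in a strip $\mathbb R\times[a,b]$ (space $\times$ time); edges may cross. Edges are labelled by object symbols and internal nodes by morphism symbols. The edges at a node labelled $f$ match $\mathrm{dom}(f)$ on its earlier side and $\mathrm{cod}(f)$ on its later side, in spatial order, an edge being oriented backwards in time there exactly when its letter is starred; a node with dualisable label may alternatively be the mirror image in the time direction of this shape (parity $1$ instead of $0$). The external nodes on $\mathbb R\times\{a\}$ and $\mathbb R\times\{b\}$, each adjacent to exactly one edge, match $X$ and $Y$ in the same way. Edges are smooth regular curves $t\mapsto(x(t),y(t))$, $t\in[0,1]$, satisfying the teleological condition that no interior stationary point of $y$ is a minimum, and well behaved: $y$ is strictly increasing, or strictly decreasing, or strictly increasing up to a turning point and strictly decreasing after it. An isomorphism $A\cong_t B$ is a pair of label-preserving bijections of nodes and of edges that preserves the order of the external nodes, the orientation of the edges, and the place (letter of $\mathrm{dom}(f)$ or of $\mathrm{cod}(f)$) at which each edge is attached to each internal node; the parity of dualisable nodes may change. A diagram is \emph{progressive} if each edge meets each time slice at most once. Proposition. Let $\Sigma$ be a teleological signature. The following data are well defined and form a teleological category $\mathcal D_t(\Sigma)$. Objects are words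 in the letters $x,x^*$, and morphisms $X\to Y$ are $\cong_t$-classes of teleological diagrams $X\to Y$. The identity on a word consists of parallel edges; composition deletes the external nodes on the common boundary and links their adjacent edges. The tensor product is concatenation of words and juxtaposition of diagrams, with the empty word as unit (a strict monoidal structure), and the symmetries are the block crossings. A morphism is dualisable iff it is represented by a progressive diagram all of whose internal nodes are labelled by dualisable symbols. The dual of an object is the dual word, and the dual of the class of such a diagram is the class of its reflection in the time direction. The counit $\epsilon_X:X\otimes X^*\to I$ for a word $X$ of length $n$ is the class of the diagram of $n$ interleaved caps joining the $i$-th letter of $X$ to the $i$-th letter of $X^*$. -/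

import Mathlib

open CategoryTheory MonoidalCategory
open scoped ContDiff Topology

universe w v u

namespace Teleological

/-! # Teleological categories -/

/-- A teleological structure on a symmetric monoidal category `C`: a wide symmetric monoidal
subcategory of dualisable morphisms, an involutive (strict) symmetric monoidal functor `-^*` from
the opposite of that subcategory to itself, and an extranatural family of counits
`X ⊗ X^* ⟶ I` compatible with duals and with tensor products. The equalities of objects
`X^** = X`, `I^* = I`, `(X ⊗ Y)^* = X^* ⊗ Y^*` are strict, and are inserted by `eqToHom`. -/
class TeleologicalCategory (C : Type u) [Category.{v} C] [MonoidalCategory C]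
    [SymmetricCategory C] where
  /-- the dualisable morphisms -/
  dualisable : MorphismProperty C
  id_mem : ∀ X : C, dualisable (𝟙 X)
  comp_mem : ∀ {X Y Z : C} (f : X ⟶ Y) (g : Y ⟶ Z),
    dualisable f → dualisable g → dualisable (f ≫ g)
  tensor_mem : ∀ {X Y X' Y' : C} (f : X ⟶ Y) (g : X' ⟶ Y'),
    dualisable f → dualisable g → dualisable (f ⊗ₘ g)
  associator_hom_mem : ∀ X Y Z : C, dualisable (α_ X Y Z).hom
  associator_inv_mem : ∀ X Y Z : C, dualisable (α_ X Y Z).inv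
  leftUnitor_hom_mem : ∀ X : C, dualisable (λ_ X).hom
  leftUnitor_inv_mem : ∀ X : C, dualisable (λ_ X).inv
  rightUnitor_hom_mem : ∀ X : C, dualisable (ρ_ X).hom
  rightUnitor_inv_mem : ∀ X : C, dualisable (ρ_ X).inv
  braiding_mem : ∀ X Y : C, dualisable (β_ X Y).hom
  /-- the dual of an object -/
  dual : C → C
  /-- the dual of a dualisable morphism -/
  dualMap : ∀ {X Y : C} (f : X ⟶ Y), dualisable f → (dual Y ⟶ dual X)
  dualMap_mem : ∀ {X Y : C} (f : X ⟶ Y) (hf : dualisable f), dualisable (dualMap f hf)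
  dualMap_id : ∀ X : C, dualMap (𝟙 X) (id_mem X) = 𝟙 (dual X)
  dualMap_comp : ∀ {X Y Z : C} (f : X ⟶ Y) (g : Y ⟶ Z) (hf : dualisable f) (hg : dualisable g),
    dualMap (f ≫ g) (comp_mem f g hf hg) = dualMap g hg ≫ dualMap f hf
  dual_dual : ∀ X : C, dual (dual X) = X
  dualMap_dualMap : ∀ {X Y : C} (f : X ⟶ Y) (hf : dualisable f),
    dualMap (dualMap f hf) (dualMap_mem f hf) =
      eqToHom (dual_dual X) ≫ f ≫ eqToHom (dual_dual Y).symm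
  dual_unit : dual (𝟙_ C) = 𝟙_ C
  dual_tensor : ∀ X Y : C, dual (X ⊗ Y) = dual X ⊗ dual Y
  dualMap_tensor : ∀ {X Y X' Y' : C} (f : X ⟶ Y) (g : X' ⟶ Y')
    (hf : dualisable f) (hg : dualisable g),
    dualMap (f ⊗ₘ g) (tensor_mem f g hf hg) =
      eqToHom (dual_tensor Y Y') ≫ (dualMap f hf ⊗ₘ dualMap g hg) ≫
        eqToHom (dual_tensor X X').symm
  dualMap_associator : ∀ X Y Z : C,
    dualMap (α_ X Y Z).hom (associator_hom_mem X Y Z) =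
      eqToHom (by rw [dual_tensor, dual_tensor]) ≫ (α_ (dual X) (dual Y) (dual Z)).inv ≫
        eqToHom (by rw [dual_tensor, dual_tensor])
  dualMap_leftUnitor : ∀ X : C,
    dualMap (λ_ X).hom (leftUnitor_hom_mem X) =
      (λ_ (dual X)).inv ≫ eqToHom (by rw [dual_tensor, dual_unit])
  dualMap_rightUnitor : ∀ X : C,
    dualMap (ρ_ X).hom (rightUnitor_hom_mem X) =
      (ρ_ (dual X)).inv ≫ eqToHom (by rw [dual_tensor, dual_unit])
  dualMap_braiding : ∀ X Y : C,
    dualMap (β_ X Y).hom (braiding_mem X Y) =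
      eqToHom (dual_tensor Y X) ≫ (β_ (dual Y) (dual X)).hom ≫ eqToHom (dual_tensor X Y).symm
  /-- the counits -/
  counit : ∀ X : C, X ⊗ dual X ⟶ 𝟙_ C
  extranatural : ∀ {X Y : C} (f : X ⟶ Y) (hf : dualisable f),
    (f ▷ dual Y) ≫ counit Y = (X ◁ dualMap f hf) ≫ counit X
  counit_dual : ∀ X : C,
    counit (dual X) =
      eqToHom (by rw [dual_dual]) ≫ (β_ (dual X) X).hom ≫ counit X
  /-- `tensorμ X Y X^* Y^*` interchanges the two middle factors. -/
  counit_tensor : ∀ X Y : C,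
    counit (X ⊗ Y) =
      eqToHom (by rw [dual_tensor]) ≫ tensorμ X Y (dual X) (dual Y) ≫
        (counit X ⊗ₘ counit Y) ≫ (λ_ (𝟙_ C)).hom

/-! # Signatures and words -/

/-- An element of `O ∪ O^*`: a symbol `x`, or a formal symbol `x^*`. -/
structure Letter (O : Type u) where
  symbol : O
  starred : Bool

/-- `x ↦ x^*`, with `x^** = x`. -/
def Letter.dual {O : Type u} (l : Letter O) : Letter O := ⟨l.symbol, !l.starred⟩

structure TeleologicalSignature where
  Obj : Type u
  Mor : Type v
  dualisable : Set Mor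
  dom : Mor → List (Letter Obj)
  cod : Mor → List (Letter Obj)

abbrev Word (S : TeleologicalSignature.{v, u}) := List (Letter S.Obj)

/-- The dual of a word: every letter is dualised, the order is kept. -/
def Word.dual {S : TeleologicalSignature.{v, u}} (X : Word S) : Word S := X.map Letter.dual

/-! # Diagrams -/

/-- The places at which an edge of a diagram can end: at the `i`-th external node on the input
or output boundary, or at an internal node `α` labelled by `f`, in the place of the `i`-th letter
of `dom f` or of `cod f`. Positions are counted from `0`; those beyond the length of the word in
question carry no edge. -/
inductive Port (N : Type w) where
  | inp (i : ℕ)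
  | out (i : ℕ)
  | dom (α : N) (i : ℕ)
  | cod (α : N) (i : ℕ)

namespace Port

/-- Rename internal nodes by `f`, and shift the positions on the two boundaries. -/
def map {N N' : Type} (f : N → N') (m n : ℕ := 0) : Port N → Port N'
  | inp i => inp (m + i)
  | out i => out (n + i)
  | dom α i => dom (f α) i
  | cod α i => cod (f α) i

/-- Rename internal nodes by `f`, and interchange the two boundaries. -/
def reflect {N N' : Type} (f : N → N') : Port N → Port N'
  | inp i => out i
  | out i => inp i
  | dom α i => dom (f α) i
  | cod α i => cod (f α) i

end Port

/-- The letter prescribed at a port, read in the direction away from the node: it is unstarred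
if the edge at this port is oriented away from the node, and starred if that edge is oriented
towards the node; it is `none` if there is no such position. For instance an unstarred letter of
`dom f` is an edge pointing at the node, and it still is after a reflection of the node. -/
def Port.letter {S : TeleologicalSignature.{v, u}} (X Y : Word S) {N : Type} (label : N → S.Mor) :
    Port N → Option (Letter S.Obj)
  | inp i => X[i]?
  | out i => (Word.dual Y)[i]?
  | dom α i => (Word.dual (S.dom (label α)))[i]?
  | cod α i => (S.cod (label α))[i]?

/-- Whether an edge at this port lies on the later (`true`) or on the earlier (`false`) side of the
node in the time direction. A node of parity `false` labelled `f` has the edges of `dom f` on its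
earlier side and those of `cod f` on its later side; a node of parity `true` is reflected. -/
def Port.late {N : Type} (parity : N → Bool) : Port N → Bool
  | inp _ => true
  | out _ => false
  | dom α _ => parity α
  | cod α _ => !parity α

/-- The incidence structure of a diagram with boundary words `X` and `Y`: a finite graph with
oriented edges labelled by object symbols and internal nodes labelled by morphism symbols and
carrying a parity (`true` for a reflected node, only possible for dualisable symbols), in which
every edge ends at two ports and at every port there is exactly one edge, whose label and orientation
are the prescribed ones. -/
structure Graph (S : TeleologicalSignature.{v, u}) (X Y : Word S) where
  Node : Type
  Edge : Type
  finite_node : Finite Node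
  finite_edge : Finite Edge
  label : Node → S.Mor
  parity : Node → Bool
  parity_eq_false : ∀ α, label α ∉ S.dualisable → parity α = false
  edgeLabel : Edge → S.Obj
  source : Edge → Port Node
  target : Edge → Port Node
  source_letter : ∀ e, (source e).letter X Y label = some ⟨edgeLabel e, false⟩
  target_letter : ∀ e, (target e).letter X Y label = some ⟨edgeLabel e, true⟩
  existsUnique_source : ∀ p x, p.letter X Y label = some ⟨x, false⟩ → ∃! e, source e = p
  existsUnique_target : ∀ p x, p.letter X Y label = some ⟨x, true⟩ → ∃! e, target e = p

/-- A teleological diagram: a graph drawn in a strip `ℝ × [lower, upper]`, whose first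
coordinate is the space direction and whose second coordinate is the time direction. Edges are
smooth regular curves, oriented from source to target, and may cross each other. -/
structure Diagram (S : TeleologicalSignature.{v, u}) (X Y : Word S) extends Graph S X Y where
  lower : ℝ
  upper : ℝ
  lower_lt_upper : lower < upper
  /-- the internal nodes -/
  pos : Node → ℝ × ℝ
  pos_injective : Function.Injective pos
  pos_mem : ∀ α, (pos α).2 ∈ Set.Ioo lower upper
  /-- the external nodes on the two boundaries, in order (only the first `X.length`,
  respectively `Y.length`, values matter) -/
  inpPos : ℕ → ℝ
  outPos : ℕ → ℝ
  inpPos_strictMono : StrictMono inpPos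
  outPos_strictMono : StrictMono outPos
  /-- the parameterisations of the edges (only the values on `[0, 1]` matter) -/
  curve : Edge → ℝ → ℝ × ℝ
  smooth : ∀ e, ContDiff ℝ ∞ (curve e)
  regular : ∀ e, ∀ t ∈ Set.Icc (0 : ℝ) 1, deriv (curve e) t ≠ 0
  curve_mem : ∀ e, ∀ t ∈ Set.Ioo (0 : ℝ) 1, (curve e t).2 ∈ Set.Ioo lower upper
  curve_ne_pos : ∀ e, ∀ t ∈ Set.Ioo (0 : ℝ) 1, ∀ α, curve e t ≠ pos α
  curve_zero : ∀ e, curve e 0 = match source e with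
    | .inp i => (inpPos i, lower)
    | .out i => (outPos i, upper)
    | .dom α _ => pos α
    | .cod α _ => pos α
  curve_one : ∀ e, curve e 1 = match target e with
    | .inp i => (inpPos i, lower)
    | .out i => (outPos i, upper)
    | .dom α _ => pos α
    | .cod α _ => pos α
  /-- Each edge leaves its source on the side of the node where its port is. -/
  source_side : ∀ e, ∀ᶠ t in 𝓝[>] (0 : ℝ),
    if (source e).late parity = true then (curve e 0).2 < (curve e t).2
    else (curve e t).2 < (curve e 0).2
  /-- Each edge reaches its target on the side of the node where its port is. -/
  target_side : ∀ e, ∀ᶠ t in 𝓝[<] (1 : ℝ),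
    if (target e).late parity = true then (curve e 1).2 < (curve e t).2
    else (curve e t).2 < (curve e 1).2
  /-- The edges on the same side of an internal node are ordered by the space coordinate, near
  the node, in the order of the letters of `dom f`, respectively of `cod f`. -/
  ordered : ∀ (p q : Port Node),
    (∃ α i j, i < j ∧ ((p = .dom α i ∧ q = .dom α j) ∨ (p = .cod α i ∧ q = .cod α j))) →
    ∀ γ γ' : ℝ → ℝ × ℝ,
      (∃ e, (source e = p ∧ γ = curve e) ∨ (target e = p ∧ γ = fun t => curve e (1 - t))) →
      (∃ e, (source e = q ∧ γ' = curve e) ∨ (target e = q ∧ γ' = fun t => curve e (1 - t))) →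
      ∃ δ > 0, ∀ s ∈ Set.Ioo (0 : ℝ) δ, ∀ t ∈ Set.Ioo (0 : ℝ) δ,
        (γ s).2 = (γ' t).2 → (γ s).1 < (γ' t).1
  /-- The teleological condition: a stationary point of the time coordinate is not a minimum. -/
  teleological : ∀ e, ∀ t ∈ Set.Ioo (0 : ℝ) 1,
    deriv (fun s => (curve e s).2) t = 0 → deriv (deriv fun s => (curve e s).2) t ≤ 0
  /-- Diagrams are well behaved: the time coordinate is strictly increasing, or strictly
  decreasing, or strictly increasing up to a turning point and strictly decreasing from there. -/
  wellBehaved : ∀ e, ∃ τ ∈ Set.Icc (0 : ℝ) 1,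
    StrictMonoOn (fun t => (curve e t).2) (Set.Icc 0 τ) ∧
    StrictAntiOn (fun t => (curve e t).2) (Set.Icc τ 1)

section Operations

variable {S : TeleologicalSignature.{v, u}}

/-- An isomorphism `A ≅_t B`. The external nodes correspond by their positions. Ports of an internal
node refer to `dom f` and `cod f` whatever its parity is, so for a node with
`parity α = parity (node α)` the conditions on ports say that its inputs and outputs are carried
to inputs and outputs with the same orientations, and for a node with
`parity α ≠ parity (node α)` that its inputs are carried to outputs, and its outputs to inputs, with
the dual orientations. -/
structure Iso {X Y : Word S} (A B : Graph S X Y) where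
  node : A.Node ≃ B.Node
  edge : A.Edge ≃ B.Edge
  label_node : ∀ α, B.label (node α) = A.label α
  edgeLabel_edge : ∀ e, B.edgeLabel (edge e) = A.edgeLabel e
  source_edge : ∀ e, B.source (edge e) = (A.source e).map node
  target_edge : ∀ e, B.target (edge e) = (A.target e).map node

/-- `e` is the edge joining the ports `p` and `q`, in one of the two orientations. -/
def Joins {X Y : Word S} (A : Graph S X Y) (e : A.Edge) (p q : Port A.Node) : Prop :=
  (A.source e = p ∧ A.target e = q) ∨ (A.source e = q ∧ A.target e = p)

/-- An edge of `A` and an edge of `B` are linked if they are adjacent to external nodes at the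
same position of the common boundary. -/
def Linked {X Y Z : Word S} (A : Graph S X Y) (B : Graph S Y Z) (u v : A.Edge ⊕ B.Edge) : Prop :=
  ∃ (j : ℕ) (e : A.Edge) (e' : B.Edge), u = Sum.inl e ∧ v = Sum.inr e' ∧
    (A.source e = .out j ∨ A.target e = .out j) ∧ (B.source e' = .inp j ∨ B.target e' = .inp j)

/-- `C` is a composite of `A` and `B`: the external nodes on the common boundary are deleted and
their adjacent edges are linked into a single edge. -/
structure Composite {X Y Z : Word S} (A : Graph S X Y) (B : Graph S Y Z) (C : Graph S X Z) where
  node : A.Node ⊕ B.Node ≃ C.Node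
  /-- the edge of `C` that a given edge of `A` or `B` becomes a part of -/
  edge : A.Edge ⊕ B.Edge → C.Edge
  label_inl : ∀ α, C.label (node (.inl α)) = A.label α
  label_inr : ∀ β, C.label (node (.inr β)) = B.label β
  parity_inl : ∀ α, C.parity (node (.inl α)) = A.parity α
  parity_inr : ∀ β, C.parity (node (.inr β)) = B.parity β
  edge_surjective : Function.Surjective edge
  edge_eq_iff : ∀ u v, edge u = edge v ↔ Relation.EqvGen (Linked A B) u v
  edgeLabel_inl : ∀ e, C.edgeLabel (edge (.inl e)) = A.edgeLabel e
  edgeLabel_inr : ∀ e, C.edgeLabel (edge (.inr e)) = B.edgeLabel e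
  source_inl : ∀ e, (∀ j, A.source e ≠ .out j) →
    C.source (edge (.inl e)) = (A.source e).map fun α => node (.inl α)
  source_inr : ∀ e, (∀ j, B.source e ≠ .inp j) →
    C.source (edge (.inr e)) = (B.source e).map fun β => node (.inr β)
  target_inl : ∀ e, (∀ j, A.target e ≠ .out j) →
    C.target (edge (.inl e)) = (A.target e).map fun α => node (.inl α)
  target_inr : ∀ e, (∀ j, B.target e ≠ .inp j) →
    C.target (edge (.inr e)) = (B.target e).map fun β => node (.inr β)

/-- `C` is `A` and `B` put side by side. -/
structure SideBySide {X Y X' Y' : Word S} (A : Graph S X Y) (B : Graph S X' Y')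
    (C : Graph S (X ++ X') (Y ++ Y')) where
  node : A.Node ⊕ B.Node ≃ C.Node
  edge : A.Edge ⊕ B.Edge ≃ C.Edge
  label_inl : ∀ α, C.label (node (.inl α)) = A.label α
  label_inr : ∀ β, C.label (node (.inr β)) = B.label β
  parity_inl : ∀ α, C.parity (node (.inl α)) = A.parity α
  parity_inr : ∀ β, C.parity (node (.inr β)) = B.parity β
  edgeLabel_inl : ∀ e, C.edgeLabel (edge (.inl e)) = A.edgeLabel e
  edgeLabel_inr : ∀ e, C.edgeLabel (edge (.inr e)) = B.edgeLabel e
  source_inl : ∀ e, C.source (edge (.inl e)) = (A.source e).map fun α => node (.inl α)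
  source_inr : ∀ e, C.source (edge (.inr e)) =
    (B.source e).map (fun β => node (.inr β)) X.length Y.length
  target_inl : ∀ e, C.target (edge (.inl e)) = (A.target e).map fun α => node (.inl α)
  target_inr : ∀ e, C.target (edge (.inr e)) =
    (B.target e).map (fun β => node (.inr β)) X.length Y.length

/-- No internal nodes, and one edge from each input to the output at the same position. -/
structure IsIdentity {X : Word S} (A : Graph S X X) : Prop where
  isEmpty_node : IsEmpty A.Node
  joins : ∀ i < X.length, ∃ e, Joins A e (.inp i) (.out i)

/-- No internal nodes, and the block of edges `X` crosses the block of edges `Y`. -/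
structure IsSymmetry {X Y : Word S} (A : Graph S (X ++ Y) (Y ++ X)) : Prop where
  isEmpty_node : IsEmpty A.Node
  joins_left : ∀ i < X.length, ∃ e, Joins A e (.inp i) (.out (Y.length + i))
  joins_right : ∀ j < Y.length, ∃ e, Joins A e (.inp (X.length + j)) (.out j)

/-- No internal nodes, and `X.length` interleaved caps: the `i`-th letter of `X` is joined to the
`i`-th letter of `X^*`. -/
structure IsCaps {X : Word S} (A : Graph S (X ++ Word.dual X) []) : Prop where
  isEmpty_node : IsEmpty A.Node
  joins : ∀ i < X.length, ∃ e, Joins A e (.inp i) (.inp (X.length + i))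

/-- `B` is the mirror image of `A` in the time direction: the two boundaries are interchanged, each
internal node is reflected, and edges keep their source and their target. -/
structure Reflection {X Y : Word S} (A : Graph S X Y)
    (B : Graph S (Word.dual Y) (Word.dual X)) where
  node : A.Node ≃ B.Node
  edge : A.Edge ≃ B.Edge
  label_node : ∀ α, B.label (node α) = A.label α
  parity_node : ∀ α, B.parity (node α) = !A.parity α
  edgeLabel_edge : ∀ e, B.edgeLabel (edge e) = A.edgeLabel e
  source_edge : ∀ e, B.source (edge e) = (A.source e).reflect node
  target_edge : ∀ e, B.target (edge e) = (A.target e).reflect node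

/-- Each edge meets each time slice at most once. -/
def Diagram.Progressive {X Y : Word S} (A : Diagram S X Y) : Prop :=
  ∀ e, Set.InjOn (fun t => (A.curve e t).2) (Set.Icc 0 1)

/-- All internal nodes are labelled by dualisable symbols, and the diagram is progressive. -/
def Diagram.IsDualisable {X Y : Word S} (A : Diagram S X Y) : Prop :=
  (∀ α, A.label α ∈ S.dualisable) ∧ A.Progressive

end Operations

/-! # The category of diagrams -/

open TeleologicalCategory (dualisable dualMap counit)

/-- A teleological category with the words as objects is the category of teleological diagrams, via
`cls`, if its morphisms are the classes `cls A` of diagrams modulo `≅_t`, and all of its structure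
is given by the operations on diagrams. -/
structure IsDiagramCategory (S : TeleologicalSignature.{v, u}) [Category.{w} (Word S)]
    [MonoidalCategory (Word S)] [SymmetricCategory (Word S)] [TeleologicalCategory (Word S)]
    (cls : ∀ {X Y : Word S}, Diagram S X Y → (X ⟶ Y)) : Prop where
  /-- Morphisms are diagrams modulo `≅_t`. -/
  cls_surjective : ∀ {X Y : Word S} (f : X ⟶ Y), ∃ A : Diagram S X Y, cls A = f
  cls_eq_iff : ∀ {X Y : Word S} (A B : Diagram S X Y),
    cls A = cls B ↔ Nonempty (Iso A.toGraph B.toGraph)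
  /-- Identities and composition. -/
  exists_identity : ∀ X : Word S, ∃ A : Diagram S X X, IsIdentity A.toGraph
  cls_identity : ∀ {X : Word S} (A : Diagram S X X), IsIdentity A.toGraph → cls A = 𝟙 X
  exists_composite : ∀ {X Y Z : Word S} (A : Diagram S X Y) (B : Diagram S Y Z),
    ∃ C : Diagram S X Z, Nonempty (Composite A.toGraph B.toGraph C.toGraph)
  cls_composite : ∀ {X Y Z : Word S} (A : Diagram S X Y) (B : Diagram S Y Z) (C : Diagram S X Z),
    Composite A.toGraph B.toGraph C.toGraph → cls C = cls A ≫ cls B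
  /-- The monoidal structure: concatenation of words, diagrams side by side, strict. -/
  unit_eq : 𝟙_ (Word S) = []
  tensor_eq : ∀ X Y : Word S, X ⊗ Y = X ++ Y
  exists_tensor : ∀ {X Y X' Y' : Word S} (A : Diagram S X Y) (B : Diagram S X' Y'),
    ∃ C : Diagram S (X ++ X') (Y ++ Y'), Nonempty (SideBySide A.toGraph B.toGraph C.toGraph)
  cls_tensor : ∀ {X Y X' Y' : Word S} (A : Diagram S X Y) (B : Diagram S X' Y')
    (C : Diagram S (X ++ X') (Y ++ Y')), SideBySide A.toGraph B.toGraph C.toGraph →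
    cls A ⊗ₘ cls B = eqToHom (tensor_eq X X') ≫ cls C ≫ eqToHom (tensor_eq Y Y').symm
  associator_eq : ∀ X Y Z : Word S, (α_ X Y Z).hom = eqToHom (by simp [tensor_eq])
  leftUnitor_eq : ∀ X : Word S, (λ_ X).hom = eqToHom (by simp [tensor_eq, unit_eq])
  rightUnitor_eq : ∀ X : Word S, (ρ_ X).hom = eqToHom (by simp [tensor_eq, unit_eq])
  /-- The symmetries. -/
  exists_symmetry : ∀ X Y : Word S,
    ∃ A : Diagram S (X ++ Y) (Y ++ X), IsSymmetry (X := X) (Y := Y) A.toGraph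
  cls_symmetry : ∀ {X Y : Word S} (A : Diagram S (X ++ Y) (Y ++ X)),
    IsSymmetry (X := X) (Y := Y) A.toGraph →
    (β_ X Y).hom = eqToHom (tensor_eq X Y) ≫ cls A ≫ eqToHom (tensor_eq Y X).symm
  /-- The dualisable subcategory. -/
  dualisable_iff : ∀ {X Y : Word S} (f : X ⟶ Y),
    dualisable f ↔ ∃ A : Diagram S X Y, A.IsDualisable ∧ cls A = f
  /-- Duality is reflection. -/
  dual_eq : ∀ X : Word S, TeleologicalCategory.dual X = Word.dual X
  exists_reflection : ∀ {X Y : Word S} (A : Diagram S X Y), A.IsDualisable →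
    ∃ B : Diagram S (Word.dual Y) (Word.dual X),
      B.IsDualisable ∧ Nonempty (Reflection A.toGraph B.toGraph)
  cls_reflection : ∀ {X Y : Word S} (A : Diagram S X Y)
    (B : Diagram S (Word.dual Y) (Word.dual X)), A.IsDualisable →
    Reflection A.toGraph B.toGraph → ∀ h : dualisable (cls A),
    dualMap (cls A) h = eqToHom (dual_eq Y) ≫ cls B ≫ eqToHom (dual_eq X).symm
  /-- The counits are interleaved caps. -/
  exists_caps : ∀ X : Word S,
    ∃ A : Diagram S (X ++ Word.dual X) [], IsCaps (X := X) A.toGraph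
  cls_caps : ∀ {X : Word S} (A : Diagram S (X ++ Word.dual X) []),
    IsCaps (X := X) A.toGraph →
    counit X = eqToHom (by rw [tensor_eq, dual_eq]) ≫ cls A ≫ eqToHom unit_eq.symm

end Teleological

/-!
Forgetting the geometry, a diagram is a graph whose edges match the ports of its nodes: every port
that carries a letter is joined to exactly one other port, whose letter is the dual one. The letters
determine the orientation of the edges, so that graphs can be described by the symmetric relation
`Graph.Joined` on ports, and by `Iso.of_joined` a bijection of nodes is an isomorphism if it
respects labels and carries joined ports to joined ports.

The geometry leaves only one trace on the graph. A graph is the graph of a diagram if and only if it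
is realisable (`Graph.IsRealisable`): no edge has both its ends on the earlier side of a node, where
it would have a minimum, and the internal nodes have heights such that every edge between the later
side of one node and the earlier side of another goes up. In one direction (`Diagram.isRealisable`)
the heights are the time coordinates. In the other (`Graph.IsRealisable.exists_diagram`) the time
coordinate of an edge is affine or a parabola, and its space coordinate is a Hermite interpolation
whose slopes at the nodes arrange the edges in their prescribed order, perturbed by a generic
multiple of a bump so as to miss all nodes. In the same way the diagrams whose labels are dualisable
and that are progressive correspond to the graphs with dualisable labels and without caps
(`Graph.IsDualisable`).

Hence the category can be built from realisable graphs (`Net`) modulo isomorphism. As there are no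
cups, an edge of a composite passes through at most three pieces: an edge of the first factor, an
edge of the second, and, if that one is a cap on the common boundary, another edge of the first.
This gives the explicit description `CompJoined` of the composite, and with it associativity
(`CompJoined.assoc`), the interchange law (`TensorJoined.comp`), the functoriality of reflection
(`ReflectJoined.comp`) and the extranaturality of the caps (`CapsJoined.extranatural`) are finite
case distinctions. A graph without internal nodes is determined by a permutation of its inputs, or
by the pairs of inputs that it joins (`IsWire.ext`, `IsCap.ext`), which reduces the coherence laws
of the symmetric monoidal structure and the two laws for the counits of duals and of tensor products
to identities between permutations of positions.

Finally the explicit operations on nets are compared with the operations on diagrams, the main point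
being that the classes of linked edges in a composite correspond to the edges given by `CompJoined`
(`Composite.joined` and `Composite.of_joined`).
-/

namespace Teleological

variable {S : TeleologicalSignature.{v, u}}

/-! ### Letters and ports -/

@[simp] theorem Letter.dual_dual {O : Type u} (l : Letter O) : l.dual.dual = l := by
  cases l; simp [Letter.dual]

theorem Letter.dual_ne {O : Type u} (l : Letter O) : l.dual ≠ l := by
  cases l; simp [Letter.dual]

@[simp] theorem Word.dual_dual (X : Word S) : Word.dual (Word.dual X) = X := by
  simp [Word.dual, Function.comp_def]

@[simp] theorem Word.dual_append (X Y : Word S) :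
    Word.dual (S := S) (X ++ Y) = Word.dual X ++ Word.dual Y := by
  simp [Word.dual]

@[simp] theorem Word.getElem?_append_length_add (X Y : Word S) (i : ℕ) :
    (X ++ Y)[X.length + i]? = Y[i]? := by
  rw [List.getElem?_append_right (Nat.le_add_right _ _), Nat.add_sub_cancel_left]

@[simp] theorem Word.dual_nil : Word.dual (S := S) [] = [] := rfl

@[simp] theorem Word.length_dual (X : Word S) : (Word.dual X).length = X.length := by
  simp [Word.dual]

theorem Word.getElem?_dual (X : Word S) (i : ℕ) : (Word.dual X)[i]? = X[i]?.map Letter.dual := by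
  simp [Word.dual]

namespace Port

variable {N N' N'' : Type}

/-- Rename internal nodes by `f`, and positions on the two boundaries by `σ` and `τ`. -/
def relabel (f : N → N') (σ τ : ℕ → ℕ) : Port N → Port N'
  | inp i => inp (σ i)
  | out i => out (τ i)
  | dom α i => dom (f α) i
  | cod α i => cod (f α) i

@[simp] theorem map_inp (f : N → N') (m n i : ℕ) : (inp i).map f m n = inp (m + i) := rfl
@[simp] theorem map_out (f : N → N') (m n i : ℕ) : (out i).map f m n = out (n + i) := rfl
@[simp] theorem map_dom (f : N → N') (m n i : ℕ) (α : N) :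
    (dom α i).map f m n = dom (f α) i := rfl
@[simp] theorem map_cod (f : N → N') (m n i : ℕ) (α : N) :
    (cod α i).map f m n = cod (f α) i := rfl
@[simp] theorem relabel_inp (f : N → N') (σ τ : ℕ → ℕ) (i : ℕ) :
    (inp i).relabel f σ τ = inp (σ i) := rfl
@[simp] theorem relabel_out (f : N → N') (σ τ : ℕ → ℕ) (i : ℕ) :
    (out i).relabel f σ τ = out (τ i) := rfl
@[simp] theorem relabel_dom (f : N → N') (σ τ : ℕ → ℕ) (i : ℕ) (α : N) :
    (dom α i).relabel f σ τ = dom (f α) i := rfl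
@[simp] theorem relabel_cod (f : N → N') (σ τ : ℕ → ℕ) (i : ℕ) (α : N) :
    (cod α i).relabel f σ τ = cod (f α) i := rfl
@[simp] theorem reflect_inp (f : N → N') (i : ℕ) : (inp i).reflect f = out i := rfl
@[simp] theorem reflect_out (f : N → N') (i : ℕ) : (out i).reflect f = inp i := rfl
@[simp] theorem reflect_dom (f : N → N') (i : ℕ) (α : N) : (dom α i).reflect f = dom (f α) i := rfl
@[simp] theorem reflect_cod (f : N → N') (i : ℕ) (α : N) : (cod α i).reflect f = cod (f α) i := rfl

theorem map_map (f : N → N') (g : N' → N'') (m n m' n' : ℕ) (p : Port N) :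
    (p.map f m n).map g m' n' = p.map (g ∘ f) (m' + m) (n' + n) := by
  cases p <;> simp [Nat.add_assoc]

theorem map_id (p : Port N) : p.map id = p := by cases p <;> simp

theorem reflect_reflect (p : Port N) : (p.reflect id).reflect id = p := by cases p <;> simp

theorem map_injective {f : N → N'} (hf : Function.Injective f) (m n : ℕ) :
    Function.Injective (fun p : Port N => p.map f m n) := by
  intro p q h
  cases p <;> cases q <;> simp_all [hf.eq_iff]

variable {X Y : Word S}

@[simp] theorem letter_inp (l : N → S.Mor) (i : ℕ) : (inp i).letter X Y l = X[i]? := rfl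
@[simp] theorem letter_out (l : N → S.Mor) (i : ℕ) :
    (out i).letter X Y l = (Word.dual Y)[i]? := rfl
@[simp] theorem letter_dom (l : N → S.Mor) (i : ℕ) (α : N) :
    (dom α i).letter X Y l = (Word.dual (S.dom (l α)))[i]? := rfl
@[simp] theorem letter_cod (l : N → S.Mor) (i : ℕ) (α : N) :
    (cod α i).letter X Y l = (S.cod (l α))[i]? := rfl

theorem letter_map {l : N → S.Mor} {l' : N' → S.Mor} {f : N → N'} (h : ∀ α, l' (f α) = l α)
    (p : Port N) : (p.map f).letter X Y l' = p.letter X Y l := by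
  cases p <;> simp [h]

theorem letter_reflect {l : N → S.Mor} {l' : N' → S.Mor} {f : N → N'} (h : ∀ α, l' (f α) = l α)
    (p : Port N) : (p.reflect f).letter (Word.dual Y) (Word.dual X) l' = p.letter X Y l := by
  cases p <;> simp [h]

/-- Only finitely many ports carry an edge. -/
theorem finite_letter [Finite N] (l : N → S.Mor) :
    {p : Port N | p.letter X Y l ≠ none}.Finite := by
  refine Set.Finite.subset
    (s := inp '' Set.Iio X.length ∪ out '' Set.Iio Y.length ∪
      ((⋃ α, dom α '' Set.Iio (S.dom (l α)).length) ∪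
        ⋃ α, cod α '' Set.Iio (S.cod (l α)).length)) ?_ ?_
  · exact (((Set.finite_Iio _).image _).union ((Set.finite_Iio _).image _)).union
      ((Set.finite_iUnion fun _ => (Set.finite_Iio _).image _).union
        (Set.finite_iUnion fun _ => (Set.finite_Iio _).image _))
  · intro p hp
    cases p <;> simp_all

end Port

/-! ### Graphs as matchings of ports -/

/-- The ports `p` and `q` are the two ends of an edge. -/
def Graph.Joined {X Y : Word S} (A : Graph S X Y) (p q : Port A.Node) : Prop :=
  ∃ e, Joins A e p q

namespace Graph

attribute [instance] Graph.finite_node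

variable {X Y X' Y' : Word S} {A : Graph S X Y}

theorem joined_source_target (e : A.Edge) : A.Joined (A.source e) (A.target e) :=
  ⟨e, .inl ⟨rfl, rfl⟩⟩

theorem Joined.symm {p q : Port A.Node} (h : A.Joined p q) : A.Joined q p := by
  obtain ⟨e, h | h⟩ := h
  exacts [⟨e, .inr h⟩, ⟨e, .inl h⟩]

theorem Joined.letter {p q : Port A.Node} (h : A.Joined p q) :
    ∃ l, p.letter X Y A.label = some l ∧ q.letter X Y A.label = some l.dual := by
  obtain ⟨e, ⟨rfl, rfl⟩ | ⟨rfl, rfl⟩⟩ := h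
  · exact ⟨_, A.source_letter e, A.target_letter e⟩
  · exact ⟨_, A.target_letter e, A.source_letter e⟩

theorem exists_joined {p : Port A.Node} {l : Letter S.Obj} (h : p.letter X Y A.label = some l) :
    ∃ q, A.Joined p q := by
  obtain ⟨x, _ | _⟩ := l
  · obtain ⟨e, rfl, -⟩ := A.existsUnique_source p x h
    exact ⟨_, e, .inl ⟨rfl, rfl⟩⟩
  · obtain ⟨e, rfl, -⟩ := A.existsUnique_target p x h
    exact ⟨_, e, .inr ⟨rfl, rfl⟩⟩

theorem source_injective : Function.Injective A.source := fun _ _ h =>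
  (A.existsUnique_source _ _ (A.source_letter _)).unique h rfl

theorem target_injective : Function.Injective A.target := fun _ _ h =>
  (A.existsUnique_target _ _ (A.target_letter _)).unique h rfl

theorem source_ne_target (e e' : A.Edge) : A.source e ≠ A.target e' := by
  intro h
  have h1 := A.source_letter e
  rw [h, A.target_letter e'] at h1
  simp at h1

theorem Joined.unique {p q q' : Port A.Node} (h : A.Joined p q) (h' : A.Joined p q') : q = q' := by
  obtain ⟨e, ⟨rfl, rfl⟩ | ⟨rfl, rfl⟩⟩ := h <;> obtain ⟨e', ⟨h1, rfl⟩ | ⟨rfl, h1⟩⟩ := h'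
  · rw [source_injective h1]
  · exact absurd h1.symm (source_ne_target _ _)
  · exact absurd h1 (source_ne_target _ _)
  · rw [target_injective h1]

/-- An unstarred port is the source of its edge. -/
theorem Joined.exists_edge {p q : Port A.Node} (h : A.Joined p q) {x : S.Obj}
    (hp : p.letter X Y A.label = some ⟨x, false⟩) : ∃ e, A.source e = p ∧ A.target e = q := by
  obtain ⟨e, h | ⟨-, rfl⟩⟩ := h
  · exact ⟨e, h⟩
  · rw [A.target_letter] at hp
    simp at hp

/-- The graph determined by a matching of its ports; each edge is represented by its unstarred
port. -/
noncomputable def ofJoined {N : Type} [Finite N] (label : N → S.Mor) (parity : N → Bool)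
    (parity_eq_false : ∀ α, label α ∉ S.dualisable → parity α = false)
    (J : Port N → Port N → Prop) (symm : ∀ p q, J p q → J q p)
    (letter : ∀ p q, J p q → ∃ l, p.letter X Y label = some l ∧ q.letter X Y label = some l.dual)
    (total : ∀ p l, p.letter X Y label = some l → ∃ q, J p q)
    (unique : ∀ p q q', J p q → J p q' → q = q') : Graph S X Y where
  Node := N
  Edge := {p : Port N // ∃ x, p.letter X Y label = some ⟨x, false⟩}
  finite_node := inferInstance
  finite_edge := ((Port.finite_letter (X := X) (Y := Y) label).subset
    (by rintro p ⟨x, hx⟩; simp [hx])).to_subtype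
  label := label
  parity := parity
  parity_eq_false := parity_eq_false
  edgeLabel e := e.2.choose
  source e := e.1
  target e := (total _ _ e.2.choose_spec).choose
  source_letter e := e.2.choose_spec
  target_letter e := by
    obtain ⟨l, h1, h2⟩ := letter _ _ (total _ _ e.2.choose_spec).choose_spec
    rw [e.2.choose_spec] at h1
    rw [h2, ← Option.some.inj h1]
    rfl
  existsUnique_source p x h := ⟨⟨p, x, h⟩, rfl, fun e he => Subtype.ext he⟩
  existsUnique_target p x h := by
    obtain ⟨q, hq⟩ := total p _ h
    obtain ⟨l, h1, h2⟩ := letter _ _ hq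
    obtain rfl : ⟨x, true⟩ = l := Option.some.inj (h.symm.trans h1)
    refine ⟨⟨q, x, h2⟩, unique q _ _ (Exists.choose_spec _) (symm _ _ hq), fun e he => ?_⟩
    have he' := (total _ _ e.2.choose_spec).choose_spec
    rw [he] at he'
    exact Subtype.ext (unique _ _ _ (symm _ _ he') hq)

theorem ofJoined_joined {N : Type} [Finite N] {label : N → S.Mor} {parity : N → Bool}
    {parity_eq_false : ∀ α, label α ∉ S.dualisable → parity α = false}
    {J : Port N → Port N → Prop} {symm : ∀ p q, J p q → J q p}
    {letter : ∀ p q, J p q → ∃ l, p.letter X Y label = some l ∧ q.letter X Y label = some l.dual}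
    {total : ∀ p l, p.letter X Y label = some l → ∃ q, J p q}
    {unique : ∀ p q q', J p q → J p q' → q = q'} (p q : Port N) :
    (ofJoined label parity parity_eq_false J symm letter total unique).Joined p q ↔ J p q := by
  constructor
  · rintro ⟨e, ⟨rfl, rfl⟩ | ⟨rfl, rfl⟩⟩
    · exact (total _ _ e.2.choose_spec).choose_spec
    · exact symm _ _ (total _ _ e.2.choose_spec).choose_spec
  · intro h
    obtain ⟨⟨x, _ | _⟩, h1, h2⟩ := letter _ _ h
    · exact ⟨⟨p, x, h1⟩, .inl ⟨rfl, unique _ _ _ (Exists.choose_spec _) h⟩⟩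
    · exact ⟨⟨q, x, h2⟩, .inr ⟨rfl, unique _ _ _ (Exists.choose_spec _) (symm _ _ h)⟩⟩

end Graph

/-! ### Isomorphisms -/

namespace Iso

variable {X Y : Word S} {A B C : Graph S X Y}

theorem joined (i : Iso A B) {p q : Port A.Node} (h : A.Joined p q) :
    B.Joined (p.map i.node) (q.map i.node) := by
  obtain ⟨e, ⟨rfl, rfl⟩ | ⟨rfl, rfl⟩⟩ := h
  · exact ⟨i.edge e, .inl ⟨i.source_edge e, i.target_edge e⟩⟩
  · exact ⟨i.edge e, .inr ⟨i.source_edge e, i.target_edge e⟩⟩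

/-- Since a matching is determined by any matching that contains it, a bijection of nodes that
carries edges to edges is an isomorphism. -/
theorem of_joined (φ : A.Node ≃ B.Node) (hl : ∀ α, B.label (φ α) = A.label α)
    (hJ : ∀ p q, A.Joined p q → B.Joined (p.map φ) (q.map φ)) : Nonempty (Iso A B) := by
  have key (e : A.Edge) :
      ∃ e', B.source e' = (A.source e).map φ ∧ B.target e' = (A.target e).map φ := by
    refine (hJ _ _ (Graph.joined_source_target e)).exists_edge (x := A.edgeLabel e) ?_
    rw [Port.letter_map hl, A.source_letter]
  choose f hs ht using key
  have hf : Function.Bijective f := by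
    constructor
    · intro e e' h
      have := hs e
      rw [h, hs] at this
      exact Graph.source_injective (Port.map_injective φ.injective 0 0 this.symm)
    · intro e'
      have h := B.source_letter e'
      have hp : ((B.source e').map φ.symm).map φ = B.source e' := by
        rw [Port.map_map, Equiv.self_comp_symm, Port.map_id]
      rw [← hp, Port.letter_map hl] at h
      obtain ⟨e, he, -⟩ := A.existsUnique_source _ _ h
      exact ⟨e, Graph.source_injective (by rw [hs, he, hp])⟩
  refine ⟨⟨φ, Equiv.ofBijective f hf, hl, fun e => ?_, hs, ht⟩⟩
  have h1 := B.source_letter (f e)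
  rw [hs, Port.letter_map hl, A.source_letter] at h1
  simpa using h1.symm

theorem nonempty_refl (A : Graph S X Y) : Nonempty (Iso A A) :=
  of_joined (Equiv.refl _) (fun _ => rfl) fun p q h => by
    simpa only [Equiv.coe_refl, Port.map_id] using h

theorem nonempty_symm (i : Iso A B) : Nonempty (Iso B A) :=
  ⟨⟨i.node.symm, i.edge.symm, fun α => by rw [← i.label_node, Equiv.apply_symm_apply],
    fun e => by rw [← i.edgeLabel_edge, Equiv.apply_symm_apply],
    fun e => by
      rw [← i.edge.apply_symm_apply e, i.source_edge, Port.map_map, Equiv.symm_comp_self,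
        Port.map_id, Equiv.apply_symm_apply],
    fun e => by
      rw [← i.edge.apply_symm_apply e, i.target_edge, Port.map_map, Equiv.symm_comp_self,
        Port.map_id, Equiv.apply_symm_apply]⟩⟩

theorem nonempty_trans (i : Iso A B) (j : Iso B C) : Nonempty (Iso A C) :=
  of_joined (i.node.trans j.node) (fun α => by simp [i.label_node, j.label_node])
    fun p q h => by
      have := j.joined (i.joined h)
      rwa [Port.map_map, Port.map_map] at this

end Iso

/-! ### Realisable graphs -/

/-- The time coordinate of the node of a port, when the internal nodes are at the heights `h`. The
value at the output boundary only has to exceed those at all other nodes; it leaves room for the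
caps above the internal nodes, which are placed between `0` and `1`. -/
def Port.height {N : Type} (h : N → ℝ) : Port N → ℝ
  | inp _ => 0
  | out _ => 2
  | dom α _ => h α
  | cod α _ => h α

/-- No edge has both ends on the earlier side of a node (it would have a minimum), and the internal
nodes can be placed in time so that every edge going from the later side of a node to the earlier
side of a node goes up. -/
def Graph.IsRealisable {X Y : Word S} (A : Graph S X Y) : Prop :=
  ∃ h : A.Node → ℝ, (∀ α, h α ∈ Set.Ioo 0 1) ∧ ∀ p q, A.Joined p q →
    (p.late A.parity = true ∨ q.late A.parity = true) ∧
    (p.late A.parity = true → q.late A.parity = false → p.height h < q.height h)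

/-- All nodes have dualisable labels, and no edge turns. -/
def Graph.IsDualisable {X Y : Word S} (A : Graph S X Y) : Prop :=
  (∀ α, A.label α ∈ S.dualisable) ∧
    ∀ p q, A.Joined p q → p.late A.parity ≠ q.late A.parity

/-! ### Drawing a single edge -/

theorem eventually_pos_of_hasDerivAt {g : ℝ → ℝ} {w : ℝ} (hg : HasDerivAt g w 0) (hw : 0 < w)
    (h0 : g 0 = 0) : ∀ᶠ s in 𝓝[>] (0 : ℝ), 0 < g s := by
  have h := eventually_nhdsWithin_sign_eq_of_deriv_pos (f := g) (x₀ := 0)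
    (by rw [hg.deriv]; exact hw) h0
  filter_upwards [nhdsWithin_le_nhds h, self_mem_nhdsWithin] with s hs hs0
  rw [sub_zero, sign_pos (Set.mem_Ioi.1 hs0)] at hs
  exact sign_eq_one_iff.1 hs

/-- Near its start, the curve `γ` runs on the later (`true`) or earlier (`false`) side, in a narrow
cone around the direction with horizontal slope `k`. -/
def Leaves (γ : ℝ → ℝ × ℝ) (late : Bool) (k : ℕ) : Prop :=
  ∃ δ > 0, ∀ s ∈ Set.Ioo (0 : ℝ) δ,
    0 < (if late then 1 else -1) * ((γ s).2 - (γ 0).2) ∧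
    |(γ s).1 - (γ 0).1 - k * ((if late then 1 else -1) * ((γ s).2 - (γ 0).2))| <
      (if late then 1 else -1) * ((γ s).2 - (γ 0).2) / 2

/-- The cone condition holds near the start if the direction there has slope `k`. -/
theorem leaves_of_hasDerivAt {x y : ℝ → ℝ} {m v : ℝ} {late : Bool} {k : ℕ}
    (hx : HasDerivAt x m 0) (hy : HasDerivAt y v 0) (hl : late = true → 0 < v)
    (he : late = false → v < 0) (hm : m = k * |v|) :
    Leaves (fun t => (x t, y t)) late k := by
  set σ : ℝ := if late then 1 else -1 with hσ
  have hσv : σ * v = |v| ∧ 0 < |v| := by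
    cases late
    · have := he rfl
      simp [hσ, abs_of_neg this, this]
    · have := hl rfl
      simp [hσ, abs_of_pos this, this]
  have hd : HasDerivAt (fun t => σ * (y t - y 0)) |v| 0 := by
    rw [← hσv.1]; exact (hy.sub_const _).const_mul σ
  have hr : HasDerivAt (fun t => x t - x 0 - k * (σ * (y t - y 0))) 0 0 :=
    ((hx.sub_const (x 0)).sub (hd.const_mul (k : ℝ))).congr_deriv (by rw [hm]; ring)
  have h1 := eventually_pos_of_hasDerivAt hd hσv.2 (by simp)
  have h2 := eventually_pos_of_hasDerivAt ((hd.div_const 2).sub hr)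
    (by simpa using hσv.2) (by simp)
  have h3 := eventually_pos_of_hasDerivAt ((hd.div_const 2).add hr)
    (by simpa using hσv.2) (by simp)
  obtain ⟨δ, hδ, h⟩ := mem_nhdsGT_iff_exists_Ioo_subset.1 (h1.and (h2.and h3))
  refine ⟨δ, hδ, fun s hs => ⟨(h hs).1, abs_lt.2 ⟨?_, ?_⟩⟩⟩
  · have := (h hs).2.2
    simp only [Pi.add_apply] at this
    linarith
  · have := (h hs).2.1
    simp only [Pi.sub_apply] at this
    linarith

/-- The time coordinate of an edge: a segment for `k = 0`, a parabolic cap for `k = 1`. -/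
def timeCurve (a b k t : ℝ) : ℝ := a + (b - a) * t + k * (t * (1 - t))

theorem hasDerivAt_timeCurve (a b k t : ℝ) :
    HasDerivAt (timeCurve a b k) (b - a + k * (1 - 2 * t)) t := by
  have h := (((hasDerivAt_id t).const_mul (b - a)).const_add a).add
    (((hasDerivAt_id t).mul ((hasDerivAt_id t).const_sub 1)).const_mul k)
  refine h.congr_deriv ?_
  simp only [id]
  ring

theorem timeCurve_sub (a b k s t : ℝ) : timeCurve a b k s - timeCurve a b k t =
    (s - t) * (b - a + k * (1 - s - t)) := by
  simp only [timeCurve]; ring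

theorem contDiff_timeCurve (a b k : ℝ) : ContDiff ℝ ∞ (timeCurve a b k) := by
  unfold timeCurve; fun_prop

theorem finite_timeCurve_eq {a b k : ℝ} (hk : (k = 0 ∧ a ≠ b) ∨ k = 1) (y : ℝ) :
    {t | timeCurve a b k t = y}.Finite := by
  by_cases h : ∃ t₁, timeCurve a b k t₁ = y
  · obtain ⟨t₁, rfl⟩ := h
    refine (Set.toFinite {t₁, b - a + 1 - t₁}).subset fun t ht => ?_
    have h := timeCurve_sub a b k t t₁
    rw [show timeCurve a b k t = _ from ht, sub_self, eq_comm, mul_eq_zero] at h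
    rcases h with h | h
    · left; linarith
    · rcases hk with ⟨rfl, hk⟩ | rfl
      · exact absurd (by linarith) hk
      · right; rw [Set.mem_singleton_iff]; linarith
  · convert Set.finite_empty
    ext t
    simpa using fun ht => h ⟨t, ht⟩

open Polynomial in
/-- The space coordinate of an edge can be chosen with prescribed values and derivatives at both
ends, so as to avoid finitely many points of the strip and to be regular at the turning point of
the time coordinate: a Hermite interpolation plus a generic multiple of a bump has these
properties. -/
theorem exists_spaceCurve {a b k : ℝ} (hk : (k = 0 ∧ a ≠ b) ∨ k = 1) (x₀ x₁ m₀ m₁ : ℝ)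
    {F : Set (ℝ × ℝ)} (hF : F.Finite) :
    ∃ f : ℝ → ℝ, ContDiff ℝ ∞ f ∧ f 0 = x₀ ∧ f 1 = x₁ ∧ HasDerivAt f m₀ 0 ∧ HasDerivAt f m₁ 1 ∧
      (∀ t ∈ Set.Ioo (0 : ℝ) 1, (f t, timeCurve a b k t) ∉ F) ∧
      ∀ t ∈ Set.Icc (0 : ℝ) 1, b - a + k * (1 - 2 * t) = 0 →
        deriv f t ≠ 0 ∨ t = 0 ∨ t = 1 := by
  set τ : ℝ := (b - a + 1) / 2 with hτ
  let H : ℝ[X] := C x₀ * ((1 - X) ^ 2 * (1 + 2 * X)) + C x₁ * (X ^ 2 * (3 - 2 * X)) +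
    C m₀ * (X * (1 - X) ^ 2) + C m₁ * (X ^ 2 * (X - 1))
  -- The derivative of the bump must not vanish at the turning point, which rules out the
  -- symmetric bump `r = 0` when `τ = 1 / 2`.
  let B (r : ℝ) : ℝ[X] := X ^ 2 * (1 - X) ^ 2 * (1 + C r * X)
  have hB' (r t : ℝ) : eval t (derivative (B r)) =
      2 * t * (1 - t) * (1 - 2 * t) * (1 + r * t) + t ^ 2 * (1 - t) ^ 2 * r := by
    simp [B, derivative_mul, derivative_pow, -mul_eq_mul_left_iff, -mul_eq_mul_right_iff]
    ring
  obtain ⟨r, hr0, hr⟩ : ∃ r : ℝ, 0 ≤ r ∧ (0 < τ → τ < 1 → eval τ (derivative (B r)) ≠ 0) := by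
    by_cases h : τ = 1 / 2
    · refine ⟨1, zero_le_one, fun _ _ => ?_⟩
      rw [hB', h]; norm_num
    · refine ⟨0, le_rfl, fun h0 h1 => ?_⟩
      rw [hB']
      have h2 : 1 - 2 * τ ≠ 0 := fun h' => h (by linarith)
      have h3 : 1 - τ ≠ 0 := by linarith
      simp [h2, h3, h0.ne']
  have hBpos {t : ℝ} (ht : t ∈ Set.Ioo (0 : ℝ) 1) : eval t (B r) ≠ 0 := by
    have h1 : 0 < t := ht.1
    have h2 : 0 < 1 - t := by linarith [ht.2]
    have : 0 < t ^ 2 * (1 - t) ^ 2 * (1 + r * t) := by positivity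
    simpa [B] using this.ne'
  have hfin : ((fun p : ℝ × (ℝ × ℝ) => (p.2.1 - eval p.1 H) / eval p.1 (B r)) ''
      ((⋃ z ∈ F, {t | timeCurve a b k t = z.2}) ×ˢ F) ∪
      {-eval τ (derivative H) / eval τ (derivative (B r))}).Finite :=
    (((hF.biUnion fun z _ => finite_timeCurve_eq hk z.2).prod hF).image _).union
      (Set.finite_singleton _)
  obtain ⟨c, hc⟩ := hfin.infinite_compl.nonempty
  let P : ℝ[X] := H + C c * B r
  have hP (t : ℝ) : HasDerivAt (fun t => eval t P)
      (eval t (derivative H) + c * eval t (derivative (B r))) t := by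
    simpa [P] using P.hasDerivAt t
  refine ⟨fun t => eval t P, by simpa using P.contDiff_aeval (𝕜 := ℝ) ∞, by simp [P, H, B],
    by simp [P, H, B]; norm_num,
    (hP 0).congr_deriv ?_, (hP 1).congr_deriv ?_, fun t ht hmem => hc (.inl ?_), ?_⟩
  · rw [hB']; simp [H, derivative_mul, derivative_pow]
  · rw [hB']
    simp [H, derivative_mul, derivative_pow]
    norm_num
  · refine ⟨(t, _), ⟨Set.mem_biUnion hmem rfl, hmem⟩, ?_⟩
    rw [div_eq_iff (hBpos ht)]
    simp [P]
  · intro t ht h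
    by_contra! hne
    rcases hk with ⟨rfl, hk⟩ | rfl
    · exact hk (by linarith)
    · obtain rfl : t = τ := by linarith
      rw [(hP _).deriv] at hne
      have h0 := hr (ht.1.lt_of_ne' hne.2.1) (ht.2.lt_of_ne hne.2.2)
      refine hc (.inr ?_)
      rw [Set.mem_singleton_iff, eq_div_iff h0]
      linarith [hne.1]

/-- An edge can be drawn between two points with prescribed sides and slopes, where `k = 0` for an
edge that is monotone in time and `k = 1` for a cap. -/
theorem exists_curve {a b k x₀ x₁ : ℝ} {l₀ l₁ : Bool} (j₀ j₁ : ℕ)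
    (hk : (k = 0 ∧ l₀ ≠ l₁) ∨ (k = 1))
    (hl₀ : l₀ = true → 0 < b - a + k) (he₀ : l₀ = false → b - a + k < 0)
    (hl₁ : l₁ = true → b - a - k < 0) (he₁ : l₁ = false → 0 < b - a - k)
    {F : Set (ℝ × ℝ)} (hF : F.Finite) :
    ∃ γ : ℝ → ℝ × ℝ, ContDiff ℝ ∞ γ ∧ (∀ t ∈ Set.Icc (0 : ℝ) 1, deriv γ t ≠ 0) ∧
      (∀ t ∈ Set.Ioo (0 : ℝ) 1, γ t ∉ F) ∧ γ 0 = (x₀, a) ∧ γ 1 = (x₁, b) ∧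
      Leaves γ l₀ j₀ ∧ Leaves (fun t => γ (1 - t)) l₁ j₁ ∧
      ∀ t, (γ t).2 = timeCurve a b k t := by
  have hk' : (k = 0 ∧ a ≠ b) ∨ k = 1 := by
    refine hk.imp_left fun h => ⟨h.1, ?_⟩
    rintro rfl
    cases l₀
    · have := he₀ rfl; simp [h.1] at this
    · have := hl₀ rfl; simp [h.1] at this
  obtain ⟨f, hf, hf0, hf1, hd0, hd1, hF, hreg⟩ := exists_spaceCurve hk' x₀ x₁
    (j₀ * |b - a + k|) (-(j₁ * |b - a - k|)) hF
  have hT (t : ℝ) := hasDerivAt_timeCurve a b k t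
  refine ⟨fun t => (f t, timeCurve a b k t), hf.prodMk (contDiff_timeCurve a b k), ?_, hF,
    by simp [hf0, timeCurve], by simp [hf1, timeCurve], ?_, ?_, fun t => rfl⟩
  · intro t ht h0
    have hft : HasDerivAt f (deriv f t) t :=
      ((hf.differentiable (by simp)) t).hasDerivAt
    rw [(hft.prodMk (hT t)).deriv, Prod.mk_eq_zero] at h0
    rcases hreg t ht h0.2 with h | rfl | rfl
    · exact h h0.1
    · cases l₀
      · have := he₀ rfl; linarith [h0.2]
      · have := hl₀ rfl; linarith [h0.2]
    · cases l₁
      · have := he₁ rfl; linarith [h0.2]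
      · have := hl₁ rfl; linarith [h0.2]
  · exact leaves_of_hasDerivAt hd0 (hT 0) (fun h => by linarith [hl₀ h])
      (fun h => by linarith [he₀ h]) (by ring_nf)
  · have hrev : HasDerivAt (fun t : ℝ => 1 - t) (-1) 0 := by
      simpa using (hasDerivAt_id (0 : ℝ)).const_sub 1
    have h1 : HasDerivAt (fun t => f (1 - t)) (-(j₁ * |b - a - k|) * -1) 0 :=
      HasDerivAt.comp (0 : ℝ) (h₂ := f) (by simpa using hd1) hrev
    have h2 : HasDerivAt (fun t => timeCurve a b k (1 - t)) ((b - a - k) * -1) 0 :=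
      HasDerivAt.comp (0 : ℝ) (h₂ := timeCurve a b k)
        ((by simpa using hT 1 : HasDerivAt _ _ _).congr_deriv (by ring)) hrev
    refine leaves_of_hasDerivAt h1 h2 (fun h => by linarith [hl₁ h])
      (fun h => by linarith [he₁ h]) ?_
    rw [mul_neg_one, mul_neg_one, neg_neg, abs_neg]

theorem Leaves.eventually {γ : ℝ → ℝ × ℝ} {late : Bool} {k : ℕ} (h : Leaves γ late k) :
    ∀ᶠ t in 𝓝[>] (0 : ℝ), if late = true then (γ 0).2 < (γ t).2 else (γ t).2 < (γ 0).2 := by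
  obtain ⟨δ, hδ, h⟩ := h
  filter_upwards [Ioo_mem_nhdsGT hδ] with t ht
  have := (h t ht).1
  cases late <;> simp at this ⊢ <;> linarith

/-- Curves that leave a point in distinct slopes are in the order of these slopes. -/
theorem Leaves.ordered {γ γ' : ℝ → ℝ × ℝ} {late : Bool} {i j : ℕ} (h : Leaves γ late i)
    (h' : Leaves γ' late j) (h0 : γ 0 = γ' 0) (hij : i < j) :
    ∃ δ > 0, ∀ s ∈ Set.Ioo (0 : ℝ) δ, ∀ t ∈ Set.Ioo (0 : ℝ) δ,
      (γ s).2 = (γ' t).2 → (γ s).1 < (γ' t).1 := by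
  obtain ⟨δ, hδ, h⟩ := h
  obtain ⟨δ', hδ', h'⟩ := h'
  refine ⟨min δ δ', lt_min hδ hδ', fun s hs t ht hst => ?_⟩
  obtain ⟨h1, h2⟩ := h s ⟨hs.1, hs.2.trans_le (min_le_left _ _)⟩
  obtain ⟨h3, h4⟩ := h' t ⟨ht.1, ht.2.trans_le (min_le_right _ _)⟩
  rw [← hst, ← h0] at h3 h4
  have hij' : (i : ℝ) + 1 ≤ j := by exact_mod_cast hij
  set d := (if late = true then (1 : ℝ) else -1) * ((γ s).2 - (γ 0).2)
  have := mul_le_mul_of_nonneg_right hij' h1.le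
  linarith [(abs_lt.1 h2).2, (abs_lt.1 h4).1]

/-! ### Realisable graphs are the graphs of diagrams -/

namespace Port

/-- The index of a port among the ports of its node. -/
def slot {N : Type} : Port N → ℕ
  | inp i => i
  | out i => i
  | dom _ i => i
  | cod _ i => i

/-- The position of the node of a port, when the internal nodes are at the points `pos`. -/
def point {N : Type} (pos : N → ℝ × ℝ) : Port N → ℝ × ℝ
  | inp i => (i, 0)
  | out i => (i, 2)
  | dom α _ => pos α
  | cod α _ => pos α

theorem point_snd {N : Type} (pos : N → ℝ × ℝ) (p : Port N) :
    (p.point pos).2 = p.height fun α => (pos α).2 := by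
  cases p <;> rfl

theorem height_nonneg {N : Type} {h : N → ℝ} (hh : ∀ α, h α ∈ Set.Ioo 0 1) (p : Port N) :
    0 ≤ p.height h := by
  cases p
  · exact le_rfl
  · exact zero_le_two
  · exact (hh _).1.le
  · exact (hh _).1.le

theorem height_le {N : Type} {h : N → ℝ} (hh : ∀ α, h α ∈ Set.Ioo 0 1) (p : Port N) :
    p.height h ≤ 2 := by
  cases p
  · exact zero_le_two
  · exact le_rfl
  · exact (hh _).2.le.trans one_le_two
  · exact (hh _).2.le.trans one_le_two

theorem height_lt_one {N : Type} {h : N → ℝ} (hh : ∀ α, h α ∈ Set.Ioo 0 1) {p : Port N}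
    {parity : N → Bool} (hp : p.late parity = true) : p.height h < 1 := by
  cases p
  · exact one_pos
  · simp [late] at hp
  · exact (hh _).2
  · exact (hh _).2

end Port

/-- An edge of a realisable graph can be drawn. -/
theorem exists_edge_curve {N : Type} [Finite N] {parity : N → Bool} {pos : N → ℝ × ℝ}
    (hpos : ∀ α, (pos α).2 ∈ Set.Ioo (0 : ℝ) 1) {p q : Port N}
    (h1 : p.late parity = true ∨ q.late parity = true)
    (h2 : p.late parity = true → q.late parity = false →
      p.height (fun α => (pos α).2) < q.height fun α => (pos α).2)
    (h3 : q.late parity = true → p.late parity = false →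
      q.height (fun α => (pos α).2) < p.height fun α => (pos α).2) :
    ∃ γ : ℝ → ℝ × ℝ, ContDiff ℝ ∞ γ ∧ (∀ t ∈ Set.Icc (0 : ℝ) 1, deriv γ t ≠ 0) ∧
      (∀ t ∈ Set.Ioo (0 : ℝ) 1, (γ t).2 ∈ Set.Ioo (0 : ℝ) 2) ∧
      (∀ t ∈ Set.Ioo (0 : ℝ) 1, ∀ α, γ t ≠ pos α) ∧ γ 0 = p.point pos ∧ γ 1 = q.point pos ∧
      Leaves γ (p.late parity) p.slot ∧ Leaves (fun t => γ (1 - t)) (q.late parity) q.slot ∧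
      (∀ t, deriv (deriv fun s => (γ s).2) t ≤ 0) ∧
      (∃ τ ∈ Set.Icc (0 : ℝ) 1, StrictMonoOn (fun t => (γ t).2) (Set.Icc 0 τ) ∧
        StrictAntiOn (fun t => (γ t).2) (Set.Icc τ 1)) ∧
      (p.late parity ≠ q.late parity → Set.InjOn (fun t => (γ t).2) (Set.Icc 0 1)) := by
  set h : N → ℝ := fun α => (pos α).2
  set a := p.height h with ha
  set b := q.height h with hb
  obtain ⟨k, hk, hl₀, he₀, hl₁, he₁⟩ : ∃ k : ℝ,
      ((k = 0 ∧ p.late parity ≠ q.late parity) ∨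
        (k = 1 ∧ p.late parity = true ∧ q.late parity = true)) ∧
      (p.late parity = true → 0 < b - a + k) ∧ (p.late parity = false → b - a + k < 0) ∧
      (q.late parity = true → b - a - k < 0) ∧ (q.late parity = false → 0 < b - a - k) := by
    rcases hp : p.late parity <;> rcases hq : q.late parity
    · simp [hp, hq] at h1
    · have := h3 hq hp
      exact ⟨0, by simp, by simp, by simpa, by simpa, by simp⟩
    · have := h2 hp hq
      exact ⟨0, by simp, by simpa, by simp, by simp, by simpa⟩
    · have := Port.height_lt_one hpos hp
      have := Port.height_lt_one hpos hq
      have := Port.height_nonneg hpos p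
      have := Port.height_nonneg hpos q
      refine ⟨1, by simp, fun _ => ?_, by simp, fun _ => ?_, by simp⟩ <;> linarith
  obtain ⟨γ, hs, hr, hF, h0, h1', hL, hL', hy⟩ := exists_curve (x₀ := (p.point pos).1)
    (x₁ := (q.point pos).1) p.slot q.slot (hk.imp_right And.left) hl₀ he₀ hl₁ he₁
    (Set.finite_range pos)
  have hyf : (fun t => (γ t).2) = timeCurve a b k := funext hy
  have hk01 : 0 ≤ k ∧ k ≤ 1 := by rcases hk with h | h <;> simp [h.1]
  have ha0 := Port.height_nonneg hpos p
  have hb0 := Port.height_nonneg hpos q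
  refine ⟨γ, hs, hr, ?_, fun t ht α h => hF t ht ⟨α, h.symm⟩, ?_, ?_, hL, hL', ?_, ?_, ?_⟩
  · intro t ht
    rw [hy]
    have t0 := ht.1
    have t1 := ht.2
    rcases hk with ⟨rfl, hne⟩ | ⟨rfl, hp, hq⟩
    · have ha2 := Port.height_le hpos p
      have hb2 := Port.height_le hpos q
      have hab : a ≠ b := by
        rcases hp : p.late parity <;> rcases hq : q.late parity
        · simp [hp, hq] at hne
        · linarith [he₀ hp]
        · linarith [hl₀ hp]
        · simp [hp, hq] at hne
      have h1t : 0 < 1 - t := by linarith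
      simp only [timeCurve, zero_mul, add_zero]
      rcases hab.lt_or_gt with hab | hab
      · constructor
        · nlinarith [mul_pos t0 (sub_pos.2 hab)]
        · nlinarith [mul_pos h1t (sub_pos.2 hab)]
      · constructor
        · nlinarith [mul_pos h1t (sub_pos.2 hab)]
        · nlinarith [mul_pos t0 (sub_pos.2 hab)]
    · have ha1 := Port.height_lt_one hpos hp
      have hb1 := Port.height_lt_one hpos hq
      have h1t : 0 < 1 - t := by linarith
      have htt := mul_pos t0 h1t
      have hA := mul_nonneg ha0 h1t.le
      have hB := mul_nonneg hb0 t0.le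
      simp only [timeCurve]
      constructor
      · nlinarith
      · nlinarith [mul_pos h1t (sub_pos.2 ha1), mul_pos t0 (sub_pos.2 hb1), sq_nonneg (t - 1 / 2)]
  · rw [h0]; exact Prod.ext rfl (Port.point_snd pos p).symm
  · rw [h1']; exact Prod.ext rfl (Port.point_snd pos q).symm
  · intro t
    rw [hyf, show deriv (timeCurve a b k) = fun t => b - a + k * (1 - 2 * t) from
      funext fun t => (hasDerivAt_timeCurve a b k t).deriv]
    have : HasDerivAt (fun t => b - a + k * (1 - 2 * t)) (k * -(2 * 1)) t :=
      ((((hasDerivAt_id t).const_mul 2).const_sub 1).const_mul k).const_add _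
    rw [this.deriv]
    linarith [hk01.1]
  · rw [hyf]
    have key {s t : ℝ} (h : 0 < (t - s) * (b - a + k * (1 - t - s))) :
        timeCurve a b k s < timeCurve a b k t := by
      have := timeCurve_sub a b k t s
      linarith
    rcases hk with ⟨rfl, hne⟩ | ⟨rfl, hp, hq⟩
    · rcases hp : p.late parity
      · refine ⟨0, by simp, by simp, fun s _ t _ hst => key ?_⟩
        nlinarith [he₀ hp]
      · refine ⟨1, by simp, fun s _ t _ hst => key ?_, by simp⟩
        nlinarith [hl₀ hp]
    · have h0 := hl₀ hp
      have h1 := hl₁ hq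
      refine ⟨(b - a + 1) / 2, ⟨by linarith, by linarith⟩, fun s hs t ht hst => key ?_,
        fun s hs t ht hst => key ?_⟩
      · exact mul_pos (by linarith) (by linarith [ht.2])
      · exact mul_pos_of_neg_of_neg (by linarith) (by linarith [hs.1])
  · intro hne s _ t _ hst
    simp only [hy] at hst
    have h := timeCurve_sub a b k s t
    rw [hst, sub_self, eq_comm, mul_eq_zero] at h
    rcases h with h | h
    · linarith
    · exfalso
      rcases hk with ⟨rfl, -⟩ | ⟨-, hp, hq⟩
      · rcases hp : p.late parity
        · linarith [he₀ hp]
        · linarith [hl₀ hp]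
      · exact hne (hp.trans hq.symm)

/-- Internal nodes are placed at the given heights, with distinct space coordinates. The edges at a
node leave it with slopes increasing along the word of the node, which puts them in the right
spatial order. -/
theorem Graph.IsRealisable.exists_diagram {X Y : Word S} {A : Graph S X Y} (hA : A.IsRealisable) :
    ∃ D : Diagram S X Y, D.toGraph = A ∧
      ((∀ p q, A.Joined p q → p.late A.parity ≠ q.late A.parity) → D.Progressive) := by
  obtain ⟨h, hh, hJ⟩ := hA
  obtain ⟨idx, hidx⟩ : ∃ idx : A.Node → ℝ, Function.Injective idx := by
    obtain ⟨n, ⟨e⟩⟩ := Finite.exists_equiv_fin A.Node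
    exact ⟨fun α => ((e α : ℕ) : ℝ),
      Nat.cast_injective.comp (Fin.val_injective.comp e.injective)⟩
  let pos : A.Node → ℝ × ℝ := fun α => (idx α, h α)
  have hc (e : A.Edge) := exists_edge_curve (parity := A.parity) (pos := pos) hh
    (hJ _ _ (A.joined_source_target e)).1 (hJ _ _ (A.joined_source_target e)).2
    (hJ _ _ (A.joined_source_target e).symm).2
  choose γ smooth regular mem ne h0 h1 hL hL' htel hwell hinj using hc
  refine ⟨{ A with
    lower := 0
    upper := 2
    lower_lt_upper := zero_lt_two
    pos := pos
    pos_injective := fun α β h => hidx (congrArg Prod.fst h)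
    pos_mem := fun α => ⟨(hh α).1, (hh α).2.trans one_lt_two⟩
    inpPos := fun i => i
    outPos := fun i => i
    inpPos_strictMono := Nat.strictMono_cast
    outPos_strictMono := Nat.strictMono_cast
    curve := γ
    smooth := smooth
    regular := regular
    curve_mem := mem
    curve_ne_pos := ne
    curve_zero := fun e => by rw [h0]; cases A.source e <;> rfl
    curve_one := fun e => by rw [h1]; cases A.target e <;> rfl
    source_side := fun e => (hL e).eventually
    target_side := fun e => ?_
    ordered := ?_
    teleological := fun e t _ _ => htel e t
    wellBehaved := hwell }, rfl, fun hp e => hinj e (hp _ _ (A.joined_source_target e))⟩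
  · have hrev : Filter.Tendsto (fun t : ℝ => 1 - t) (𝓝[<] 1) (𝓝[>] 0) := by
      refine tendsto_nhdsWithin_iff.2 ⟨?_, ?_⟩
      · have : Filter.Tendsto (fun t : ℝ => 1 - t) (𝓝 1) (𝓝 (1 - 1)) :=
          (continuous_const.sub continuous_id).tendsto 1
        rw [sub_self] at this
        exact this.mono_left nhdsWithin_le_nhds
      · filter_upwards [self_mem_nhdsWithin] with t ht
        exact sub_pos.2 (Set.mem_Iio.1 ht)
    have := hrev.eventually (hL' e).eventually
    simpa using this
  · have hleaves {p : Port A.Node} {γ' : ℝ → ℝ × ℝ}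
        (h : ∃ e, (A.source e = p ∧ γ' = γ e) ∨ (A.target e = p ∧ γ' = fun t => γ e (1 - t))) :
        Leaves γ' (p.late A.parity) p.slot ∧ γ' 0 = p.point pos := by
      obtain ⟨e, ⟨rfl, rfl⟩ | ⟨rfl, rfl⟩⟩ := h
      · exact ⟨hL e, h0 e⟩
      · exact ⟨hL' e, by simpa using h1 e⟩
    rintro p q ⟨α, i, j, hij, ⟨rfl, rfl⟩ | ⟨rfl, rfl⟩⟩ γ₁ γ₂ hγ₁ hγ₂
    all_goals
      exact (hleaves hγ₁).1.ordered (hleaves hγ₂).1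
        ((hleaves hγ₁).2.trans (hleaves hγ₂).2.symm) hij

namespace Diagram

variable {X Y : Word S} (D : Diagram S X Y)

/-- At its source, an edge goes up exactly if the turning point is not there; dually at its
target. -/
theorem exists_turningPoint (e : D.Edge) : ∃ τ ∈ Set.Icc (0 : ℝ) 1,
    StrictMonoOn (fun t => (D.curve e t).2) (Set.Icc 0 τ) ∧
    StrictAntiOn (fun t => (D.curve e t).2) (Set.Icc τ 1) ∧
    ((D.source e).late D.parity = true ↔ τ ≠ 0) ∧ ((D.target e).late D.parity = true ↔ τ ≠ 1) := by
  obtain ⟨τ, hτ, hm, ha⟩ := D.wellBehaved e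
  refine ⟨τ, hτ, hm, ha, ⟨fun h hτ0 => ?_, fun hτ0 => ?_⟩, ⟨fun h hτ1 => ?_, fun hτ1 => ?_⟩⟩
  · subst hτ0
    have h1 := D.source_side e
    simp only [if_pos h] at h1
    obtain ⟨t, h1, h2⟩ := (h1.and (Ioo_mem_nhdsGT one_pos)).exists
    exact lt_asymm h1 (ha (by simp) ⟨h2.1.le, h2.2.le⟩ h2.1)
  · by_contra h
    have h1 := D.source_side e
    simp only [if_neg h] at h1
    have hpos : 0 < τ := hτ.1.lt_of_ne' hτ0
    obtain ⟨t, h1, h2⟩ := (h1.and (Ioo_mem_nhdsGT hpos)).exists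
    exact lt_asymm h1 (hm ⟨le_rfl, hτ.1⟩ ⟨h2.1.le, h2.2.le⟩ h2.1)
  · subst hτ1
    have h1 := D.target_side e
    simp only [if_pos h] at h1
    obtain ⟨t, h1, h2⟩ := (h1.and (Ioo_mem_nhdsLT one_pos)).exists
    exact lt_asymm h1 (hm ⟨h2.1.le, h2.2.le⟩ (by simp) h2.2)
  · by_contra h
    have h1 := D.target_side e
    simp only [if_neg h] at h1
    have hpos : τ < 1 := hτ.2.lt_of_ne hτ1
    obtain ⟨t, h1, h2⟩ := (h1.and (Ioo_mem_nhdsLT hpos)).exists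
    exact lt_asymm h1 (ha ⟨h2.1.le, h2.2.le⟩ ⟨hτ.2, le_rfl⟩ h2.2)

/-- The heights are the time coordinates, rescaled to the unit interval. -/
theorem isRealisable : D.toGraph.IsRealisable := by
  have hpos : 0 < D.upper - D.lower := sub_pos.2 D.lower_lt_upper
  set h : D.Node → ℝ := fun α => ((D.pos α).2 - D.lower) / (D.upper - D.lower) with hh
  have hmem (α : D.Node) : h α ∈ Set.Ioo 0 1 := by
    have := D.pos_mem α
    exact ⟨div_pos (by linarith [this.1]) hpos, (div_lt_one hpos).2 (by linarith [this.2])⟩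
  have hlu := D.lower_lt_upper
  let y : Port D.Node → ℝ
    | .inp _ => D.lower
    | .out _ => D.upper
    | .dom α _ => (D.pos α).2
    | .cod α _ => (D.pos α).2
  have hy0 (e : D.Edge) : (D.curve e 0).2 = y (D.source e) := by
    rw [D.curve_zero]; cases D.source e <;> rfl
  have hy1 (e : D.Edge) : (D.curve e 1).2 = y (D.target e) := by
    rw [D.curve_one]; cases D.target e <;> rfl
  have hlt (p q : Port D.Node) (hpq : y p < y q) : p.height h < q.height h := by
    have hn (α : D.Node) := D.pos_mem α
    simp only [Set.mem_Ioo] at hn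
    cases p <;> cases q <;> simp only [y] at hpq <;> simp only [Port.height]
    all_goals first
      | exact zero_lt_two
      | exact (hmem _).1
      | exact (hmem _).2.trans one_lt_two
      | exact (div_lt_div_iff_of_pos_right hpos).2 (by linarith)
      | (exfalso; grind)
  have key (e : D.Edge) : ((D.source e).late D.parity = true ∨ (D.target e).late D.parity = true) ∧
      ((D.source e).late D.parity = true → (D.target e).late D.parity = false →
        (D.source e).height h < (D.target e).height h) ∧
      ((D.target e).late D.parity = true → (D.source e).late D.parity = false →
        (D.target e).height h < (D.source e).height h) := by
    obtain ⟨τ, -, hm, ha, hs, ht⟩ := D.exists_turningPoint e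
    refine ⟨?_, fun _ h => hlt _ _ ?_, fun _ h => hlt _ _ ?_⟩
    · rw [hs, ht]
      by_contra! h
      linarith [h.1, h.2]
    · rw [← Bool.not_eq_true, ht, not_ne_iff] at h
      subst h
      rw [← hy0, ← hy1]
      exact hm (by simp) (by simp) one_pos
    · rw [← Bool.not_eq_true, hs, not_ne_iff] at h
      subst h
      rw [← hy0, ← hy1]
      exact ha (by simp) (by simp) one_pos
  refine ⟨h, hmem, ?_⟩
  rintro p q ⟨e, ⟨rfl, rfl⟩ | ⟨rfl, rfl⟩⟩
  · exact ⟨(key e).1, (key e).2.1⟩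
  · exact ⟨(key e).1.symm, (key e).2.2⟩

/-- An edge with a proper turning point meets some time slice twice. -/
theorem IsDualisable.isDualisable_toGraph {D : Diagram S X Y} (hD : D.IsDualisable) :
    D.toGraph.IsDualisable := by
  refine ⟨hD.1, ?_⟩
  have key (e : D.Edge) : (D.source e).late D.parity ≠ (D.target e).late D.parity := by
    intro heq
    obtain ⟨τ, hτ, hm, ha, hs, ht⟩ := D.exists_turningPoint e
    rw [heq, ht] at hs
    have h0 : τ ≠ 0 := fun h0 => by
      subst h0; simp at hs
    have h1 := hs.2 h0
    have hτ0 : 0 < τ := hτ.1.lt_of_ne' h0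
    have hτ1 : τ < 1 := hτ.2.lt_of_ne h1
    have hcont : Continuous fun t => (D.curve e t).2 := (D.smooth e).continuous.snd
    have hm' := hm ⟨le_rfl, hτ.1⟩ ⟨hτ.1, le_rfl⟩ hτ0
    have ha' := ha ⟨le_rfl, hτ.2⟩ ⟨hτ.2, le_rfl⟩ hτ1
    simp only at hm' ha'
    obtain ⟨c, hc1, hc2⟩ := exists_between (max_lt hm' ha')
    obtain ⟨s, hs, hsc⟩ := intermediate_value_Ioo hτ0.le hcont.continuousOn
      ⟨(le_max_left _ _).trans_lt hc1, hc2⟩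
    obtain ⟨t, ht, htc⟩ := intermediate_value_Ioo' hτ1.le hcont.continuousOn
      ⟨(le_max_right _ _).trans_lt hc1, hc2⟩
    have := hD.2 e ⟨hs.1.le, hs.2.le.trans hτ.2⟩ ⟨hτ.1.trans ht.1.le, ht.2.le⟩ (hsc.trans htc.symm)
    linarith [hs.2, ht.1]
  rintro p q ⟨e, ⟨rfl, rfl⟩ | ⟨rfl, rfl⟩⟩
  exacts [key e, (key e).symm]

end Diagram

theorem Graph.IsDualisable.exists_diagram {X Y : Word S} {A : Graph S X Y} (hA : A.IsRealisable)
    (hA' : A.IsDualisable) : ∃ D : Diagram S X Y, D.toGraph = A ∧ D.IsDualisable := by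
  obtain ⟨D, rfl, hD⟩ := hA.exists_diagram
  exact ⟨D, rfl, hA'.1, hD hA'.2⟩

/-! ### Operations on realisable graphs -/

/-- A realisable graph. Nets modulo isomorphism are diagrams modulo `≅_t`, without the geometry. -/
structure Net (S : TeleologicalSignature.{v, u}) (X Y : Word S) extends Graph S X Y where
  isRealisable : toGraph.IsRealisable

namespace Port

variable {N N' : Type}

theorem map_ne_out {f : N → N'} {m n : ℕ} {p : Port N} (h : ∀ j, p ≠ out j) (j : ℕ) :
    p.map f m n ≠ out j := by
  cases p <;> simp_all

theorem map_ne_inp {f : N → N'} {m n : ℕ} {p : Port N} (h : ∀ j, p ≠ inp j) (j : ℕ) :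
    p.map f m n ≠ inp j := by
  cases p <;> simp_all

theorem map_inl_ne_map_inr {p : Port N} {q : Port N'} (hp : ∀ j, p ≠ out j)
    (hq : ∀ j, q ≠ inp j) : (p.map Sum.inl : Port (N ⊕ N')) ≠ q.map Sum.inr := by
  cases p <;> cases q <;> simp_all

/-- A port of a composite is a port of one of the two factors, off the common boundary. -/
theorem eq_map_inl_or_eq_map_inr (P : Port (N ⊕ N')) :
    (∃ p : Port N, (∀ j, p ≠ out j) ∧ P = p.map Sum.inl) ∨
      ∃ q : Port N', (∀ j, q ≠ inp j) ∧ P = q.map Sum.inr := by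
  rcases P with i | i | ⟨α | α, i⟩ | ⟨α | α, i⟩
  · exact .inl ⟨inp i, by simp, by simp⟩
  · exact .inr ⟨out i, by simp, by simp⟩
  · exact .inl ⟨dom α i, by simp, by simp⟩
  · exact .inr ⟨dom α i, by simp, by simp⟩
  · exact .inl ⟨cod α i, by simp, by simp⟩
  · exact .inr ⟨cod α i, by simp, by simp⟩

variable {X Y Z X' Y' : Word S} {l : N → S.Mor} {l' : N' → S.Mor}

theorem letter_map_inl {p : Port N} (hp : ∀ j, p ≠ out j) :
    (p.map Sum.inl).letter X Z (Sum.elim l l') = p.letter X Y l := by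
  cases p <;> simp_all

theorem letter_map_inr {p : Port N'} (hp : ∀ j, p ≠ inp j) :
    (p.map Sum.inr).letter X Z (Sum.elim l l') = p.letter Y Z l' := by
  cases p <;> simp_all

theorem letter_out_eq_some {i : ℕ} {a : Letter S.Obj} :
    (out i : Port N).letter X Y l = some a ↔
      (inp i : Port N').letter Y Z l' = some a.dual := by
  simp only [letter_out, letter_inp, Word.getElem?_dual, Option.map_eq_some_iff]
  constructor
  · rintro ⟨b, hb, rfl⟩
    simpa using hb
  · intro h
    exact ⟨_, h, by simp⟩

theorem letter_map_inl_append {p : Port N} {a : Letter S.Obj} (h : p.letter X Y l = some a) :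
    (p.map Sum.inl).letter (X ++ X') (Y ++ Y') (Sum.elim l l') = some a := by
  cases p with
  | inp i => simpa [List.getElem?_append_left (List.getElem?_eq_some_iff.1 h).1] using h
  | out i =>
    have hi : i < (Word.dual Y).length := (List.getElem?_eq_some_iff.1 h).1
    rw [Port.map_out, zero_add, letter_out, Word.dual_append, List.getElem?_append_left hi]
    exact h
  | dom α i => simpa using h
  | cod α i => simpa using h

theorem letter_map_inr_append (p : Port N') :
    (p.map Sum.inr X.length Y.length).letter (X ++ X') (Y ++ Y') (Sum.elim l l') =
      p.letter X' Y' l' := by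
  cases p with
  | inp i => simp
  | out i =>
    rw [Port.map_out, letter_out, letter_out, Word.dual_append, ← Word.length_dual Y,
      Word.getElem?_append_length_add]
  | dom α i => simp
  | cod α i => simp

theorem letter_append {P : Port (N ⊕ N')} {a : Letter S.Obj}
    (h : P.letter (X ++ X') (Y ++ Y') (Sum.elim l l') = some a) :
    (∃ p : Port N, p.letter X Y l = some a ∧ P = p.map Sum.inl) ∨
      ∃ q : Port N', q.letter X' Y' l' = some a ∧ P = q.map Sum.inr X.length Y.length := by
  rcases P with i | i | ⟨α | α, i⟩ | ⟨α | α, i⟩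
  · by_cases hi : i < X.length
    · exact .inl ⟨inp i, by simpa [List.getElem?_append_left hi] using h, by simp⟩
    · obtain ⟨k, rfl⟩ := Nat.exists_eq_add_of_le (not_lt.1 hi)
      exact .inr ⟨inp k, by simpa using h, by simp⟩
  · by_cases hi : i < Y.length
    · refine .inl ⟨out i, ?_, by simp⟩
      rw [letter_out, Word.dual_append, List.getElem?_append_left (by simpa using hi)] at h
      exact h
    · obtain ⟨k, rfl⟩ := Nat.exists_eq_add_of_le (not_lt.1 hi)
      refine .inr ⟨out k, ?_, by simp⟩
      rw [letter_out, Word.dual_append, List.getElem?_append_right (by simp)] at h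
      simpa using h
  · exact .inl ⟨dom α i, h, by simp⟩
  · exact .inr ⟨dom α i, h, by simp⟩
  · exact .inl ⟨cod α i, h, by simp⟩
  · exact .inr ⟨cod α i, h, by simp⟩

/-- A port whose position, if it is on the boundary, is among the `m` inputs or the `n` outputs. -/
def Within (m n : ℕ) : Port N → Prop
  | inp i => i < m
  | out i => i < n
  | dom _ _ => True
  | cod _ _ => True

theorem within_of_letter {p : Port N} {a : Letter S.Obj} (h : p.letter X Y l = some a) :
    p.Within X.length Y.length := by
  cases p
  · exact (List.getElem?_eq_some_iff.1 h).1
  · have := (List.getElem?_eq_some_iff.1 h).1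
    rwa [Word.length_dual] at this
  · trivial
  · trivial

theorem late_map {f : N → N'} {parity : N → Bool} {parity' : N' → Bool}
    (h : ∀ α, parity' (f α) = parity α) (m n : ℕ) (p : Port N) :
    (p.map f m n).late parity' = p.late parity := by
  cases p <;> simp [late, h]

theorem late_map_inl {parity : N → Bool} {parity' : N' → Bool} (m n : ℕ) (p : Port N) :
    (p.map Sum.inl m n).late (Sum.elim parity parity') = p.late parity :=
  late_map (fun _ => rfl) m n p

theorem late_map_inr {parity : N → Bool} {parity' : N' → Bool} (m n : ℕ) (p : Port N') :
    (p.map Sum.inr m n).late (Sum.elim parity parity') = p.late parity' :=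
  late_map (fun _ => rfl) m n p

theorem late_reflect (parity : N → Bool) (p : Port N) :
    (p.reflect id).late parity = !p.late fun α => !parity α := by
  cases p <;> simp [late]

theorem height_map {f : N → N'} {h : N → ℝ} {h' : N' → ℝ} (hf : ∀ α, h' (f α) = h α) (m n : ℕ)
    (p : Port N) : (p.map f m n).height h' = p.height h := by
  cases p <;> simp [height, hf]

end Port

/-- There are no edges with both ends on the earlier side of a node. -/
theorem Graph.IsRealisable.late_of_joined {X Y : Word S} {A : Graph S X Y} (hA : A.IsRealisable)
    {p q : Port A.Node} (h : A.Joined p q) (hq : q.late A.parity = false) :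
    p.late A.parity = true := by
  obtain ⟨_, _, hJ⟩ := hA
  simpa [hq] using (hJ _ _ h).1

theorem Graph.Joined.within {X Y : Word S} {A : Graph S X Y} {p q : Port A.Node}
    (h : A.Joined p q) : p.Within X.length Y.length := by
  obtain ⟨l, hl, -⟩ := h.letter
  exact Port.within_of_letter hl

/-- There are no cups, so no edge joins two outputs. -/
theorem Net.ne_out_of_joined {X Y : Word S} (A : Net S X Y) {p : Port A.Node} {i : ℕ}
    (h : A.Joined p (.out i)) (j : ℕ) : p ≠ .out j := by
  rintro rfl
  have := A.isRealisable.late_of_joined h rfl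
  simp [Port.late] at this

section Comp

variable {X Y Z : Word S}

/-- The edges of a composite. As there are no cups, an edge of the composite contains at most two
edges of the first factor and, if so, they are linked by an edge of the second. -/
inductive CompJoined {N N' : Type} (J : Port N → Port N → Prop) (K : Port N' → Port N' → Prop) :
    Port (N ⊕ N') → Port (N ⊕ N') → Prop
  | left {p q : Port N} (h : J p q) (hp : ∀ j, p ≠ .out j) (hq : ∀ j, q ≠ .out j) :
      CompJoined J K (p.map Sum.inl) (q.map Sum.inl)
  | up {p : Port N} {j : ℕ} {q : Port N'} (h : J p (.out j))
      (h' : K (.inp j) q) (hp : ∀ j, p ≠ .out j) (hq : ∀ j, q ≠ .inp j) :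
      CompJoined J K (p.map Sum.inl) (q.map Sum.inr)
  | down {q : Port N'} {j : ℕ} {p : Port N} (h : J p (.out j))
      (h' : K (.inp j) q) (hp : ∀ j, p ≠ .out j) (hq : ∀ j, q ≠ .inp j) :
      CompJoined J K (q.map Sum.inr) (p.map Sum.inl)
  | cap {p : Port N} {j k : ℕ} {q : Port N} (h : J p (.out j))
      (h' : K (.inp j) (.inp k)) (h'' : J q (.out k))
      (hp : ∀ j, p ≠ .out j) (hq : ∀ j, q ≠ .out j) :
      CompJoined J K (p.map Sum.inl) (q.map Sum.inl)
  | right {p q : Port N'} (h : K p q) (hp : ∀ j, p ≠ .inp j) (hq : ∀ j, q ≠ .inp j) :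
      CompJoined J K (p.map Sum.inr) (q.map Sum.inr)

namespace CompJoined

theorem mono {N N' : Type} {J J' : Port N → Port N → Prop} {K K' : Port N' → Port N' → Prop}
    (hJ : ∀ p q, J p q → J' p q) (hK : ∀ p q, K p q → K' p q) {p q : Port (N ⊕ N')}
    (h : CompJoined J K p q) : CompJoined J' K' p q := by
  cases h with
  | left h hp hq => exact .left (hJ _ _ h) hp hq
  | up h h' hp hq => exact .up (hJ _ _ h) (hK _ _ h') hp hq
  | down h h' hp hq => exact .down (hJ _ _ h) (hK _ _ h') hp hq
  | cap h h' h'' hp hq => exact .cap (hJ _ _ h) (hK _ _ h') (hJ _ _ h'') hp hq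
  | right h hp hq => exact .right (hK _ _ h) hp hq

theorem symm {N N' : Type} {J : Port N → Port N → Prop} {K : Port N' → Port N' → Prop}
    (hJ : ∀ p q, J p q → J q p) (hK : ∀ p q, K p q → K q p) {p q : Port (N ⊕ N')}
    (h : CompJoined J K p q) : CompJoined J K q p := by
  cases h with
  | left h hp hq => exact .left (hJ _ _ h) hq hp
  | up h h' hp hq => exact .down h h' hp hq
  | down h h' hp hq => exact .up h h' hp hq
  | cap h h' h'' hp hq => exact .cap h'' (hK _ _ h') h hq hp
  | right h hp hq => exact .right (hK _ _ h) hq hp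

variable {A : Graph S X Y} {B : Graph S Y Z}

theorem letter {p q : Port (A.Node ⊕ B.Node)} (h : CompJoined A.Joined B.Joined p q) :
    ∃ l, p.letter X Z (Sum.elim A.label B.label) = some l ∧
      q.letter X Z (Sum.elim A.label B.label) = some l.dual := by
  cases h with
  | left h hp hq =>
    rw [Port.letter_map_inl (Y := Y) hp, Port.letter_map_inl (Y := Y) hq]
    exact h.letter
  | up h h' hp hq =>
    rw [Port.letter_map_inl (Y := Y) hp, Port.letter_map_inr (Y := Y) hq]
    obtain ⟨l, h1, h2⟩ := h.letter
    obtain ⟨l', h3, h4⟩ := h'.letter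
    rw [Port.letter_out_eq_some (Z := Z) (l' := B.label), h3, Letter.dual_dual] at h2
    cases h2
    exact ⟨_, h1, h4⟩
  | down h h' hp hq =>
    rw [Port.letter_map_inl (Y := Y) hp, Port.letter_map_inr (Y := Y) hq]
    obtain ⟨l, h1, h2⟩ := h.letter
    obtain ⟨l', h3, h4⟩ := h'.letter
    rw [Port.letter_out_eq_some (Z := Z) (l' := B.label), h3, Letter.dual_dual] at h2
    cases h2
    exact ⟨_, h4, by simpa using h1⟩
  | cap h h' h'' hp hq =>
    rw [Port.letter_map_inl (Y := Y) hp, Port.letter_map_inl (Y := Y) hq]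
    obtain ⟨l, h1, h2⟩ := h.letter
    obtain ⟨l', h3, h4⟩ := h'.letter
    obtain ⟨l'', h5, h6⟩ := h''.letter
    rw [Port.letter_out_eq_some (Z := Z) (l' := B.label), h3, Letter.dual_dual] at h2
    rw [Port.letter_out_eq_some (Z := Z) (l' := B.label), h4, Letter.dual_dual] at h6
    cases h2
    cases h6
    exact ⟨_, h1, h5⟩
  | right h hp hq =>
    rw [Port.letter_map_inr (Y := Y) hp, Port.letter_map_inr (Y := Y) hq]
    exact h.letter

theorem of_map_inl {p : Port A.Node} {P Q : Port (A.Node ⊕ B.Node)} (hp : ∀ j, p ≠ .out j)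
    (h : CompJoined A.Joined B.Joined P Q) (hP : P = p.map Sum.inl) :
    (∃ q, A.Joined p q ∧ (∀ j, q ≠ .out j) ∧ Q = q.map Sum.inl) ∨
    (∃ j q, A.Joined p (.out j) ∧ B.Joined (.inp j) q ∧ (∀ j, q ≠ .inp j) ∧ Q = q.map Sum.inr) ∨
    ∃ j k q, A.Joined p (.out j) ∧ B.Joined (.inp j) (.inp k) ∧ A.Joined q (.out k) ∧
      (∀ j, q ≠ .out j) ∧ Q = q.map Sum.inl := by
  cases h with
  | left h _ hq =>
    obtain rfl := Port.map_injective Sum.inl_injective _ _ hP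
    exact .inl ⟨_, h, hq, rfl⟩
  | up h h' _ hq =>
    obtain rfl := Port.map_injective Sum.inl_injective _ _ hP
    exact .inr (.inl ⟨_, _, h, h', hq, rfl⟩)
  | down _ _ _ hq => exact absurd hP.symm (Port.map_inl_ne_map_inr hp hq)
  | cap h h' h'' _ hq =>
    obtain rfl := Port.map_injective Sum.inl_injective _ _ hP
    exact .inr (.inr ⟨_, _, _, h, h', h'', hq, rfl⟩)
  | right _ hq _ => exact absurd hP.symm (Port.map_inl_ne_map_inr hp hq)

theorem of_map_inr {p : Port B.Node} {P Q : Port (A.Node ⊕ B.Node)} (hp : ∀ j, p ≠ .inp j)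
    (h : CompJoined A.Joined B.Joined P Q) (hP : P = p.map Sum.inr) :
    (∃ q, B.Joined p q ∧ (∀ j, q ≠ .inp j) ∧ Q = q.map Sum.inr) ∨
    ∃ j q, B.Joined (.inp j) p ∧ A.Joined q (.out j) ∧ (∀ j, q ≠ .out j) ∧ Q = q.map Sum.inl := by
  cases h with
  | left _ hq _ => exact absurd hP (Port.map_inl_ne_map_inr hq hp)
  | up _ _ hq _ => exact absurd hP (Port.map_inl_ne_map_inr hq hp)
  | down h h' hq _ =>
    obtain rfl := Port.map_injective Sum.inr_injective _ _ hP
    exact .inr ⟨_, _, h', h, hq, rfl⟩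
  | cap _ _ _ hq _ => exact absurd hP (Port.map_inl_ne_map_inr hq hp)
  | right h _ hq =>
    obtain rfl := Port.map_injective Sum.inr_injective _ _ hP
    exact .inl ⟨_, h, hq, rfl⟩

/-- Two ways of following an edge across the common boundary agree. -/
theorem crossing_unique {p : Port A.Node} {j j' : ℕ} {q q' : Port B.Node}
    (h : A.Joined p (.out j)) (h' : A.Joined p (.out j')) (hB : B.Joined (.inp j) q)
    (hB' : B.Joined (.inp j') q') : q = q' := by
  obtain rfl := Port.out.inj (h.unique h')
  exact hB.unique hB'

/-- At most one edge ends at each port of a composite. -/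
theorem unique {p q q' : Port (A.Node ⊕ B.Node)} (h : CompJoined A.Joined B.Joined p q)
    (h' : CompJoined A.Joined B.Joined p q') : q = q' := by
  obtain ⟨p, hp, rfl⟩ | ⟨p, hp, rfl⟩ := Port.eq_map_inl_or_eq_map_inr p
  · obtain ⟨q, h1, hq, rfl⟩ | ⟨j, q, h1, h2, hq, rfl⟩ | ⟨j, k, q, h1, h2, h3, hq, rfl⟩ :=
      h.of_map_inl hp rfl <;>
    obtain ⟨q', h1', hq', rfl⟩ | ⟨j', q', h1', h2', hq', rfl⟩ |
        ⟨j', k', q', h1', h2', h3', hq', rfl⟩ :=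
      h'.of_map_inl hp rfl
    · rw [h1.unique h1']
    · exact absurd (h1.unique h1') (hq _)
    · exact absurd (h1.unique h1') (hq _)
    · exact absurd (h1'.unique h1) (hq' _)
    · rw [crossing_unique h1 h1' h2 h2']
    · exact absurd (crossing_unique h1 h1' h2 h2') (hq _)
    · exact absurd (h1'.unique h1) (hq' _)
    · exact absurd (crossing_unique h1' h1 h2' h2) (hq' _)
    · obtain rfl := Port.inp.inj (crossing_unique h1 h1' h2 h2')
      rw [h3.symm.unique h3'.symm]
  · obtain ⟨q, h1, hq, rfl⟩ | ⟨j, q, h1, h2, hq, rfl⟩ := h.of_map_inr hp rfl <;>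
    obtain ⟨q', h1', hq', rfl⟩ | ⟨j', q', h1', h2', hq', rfl⟩ := h'.of_map_inr hp rfl
    · rw [h1.unique h1']
    · exact absurd (h1.unique h1'.symm) (hq _)
    · exact absurd (h1'.unique h1.symm) (hq' _)
    · obtain rfl := Port.inp.inj (h1.symm.unique h1'.symm)
      rw [h2.symm.unique h2'.symm]

end CompJoined

/-- Each edge ending on the common boundary continues in the other factor. -/
theorem Graph.exists_joined_inp {A : Graph S X Y} (B : Graph S Y Z) {p : Port A.Node} {j : ℕ}
    (h : A.Joined p (.out j)) : ∃ q, B.Joined (.inp j) q := by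
  obtain ⟨l, -, hl⟩ := h.letter
  exact Graph.exists_joined ((Port.letter_out_eq_some (l' := B.label)).1 hl)

theorem Graph.exists_joined_out (A : Graph S X Y) {B : Graph S Y Z} {q : Port B.Node} {j : ℕ}
    (h : B.Joined q (.inp j)) : ∃ p, A.Joined p (.out j) := by
  obtain ⟨l, -, hl⟩ := h.letter
  obtain ⟨p, hp⟩ := Graph.exists_joined (A := A) (p := .out j) (l := l)
    ((Port.letter_out_eq_some (l' := B.label)).2 hl)
  exact ⟨p, hp.symm⟩

/-- Each port of a composite carries an edge. -/
theorem Net.exists_compJoined (A : Net S X Y) (B : Net S Y Z) (p : Port (A.Node ⊕ B.Node))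
    (l : Letter S.Obj) (hl : p.letter X Z (Sum.elim A.label B.label) = some l) :
    ∃ q, CompJoined A.Joined B.Joined p q := by
  obtain ⟨p, hp, rfl⟩ | ⟨p, hp, rfl⟩ := Port.eq_map_inl_or_eq_map_inr p
  · rw [Port.letter_map_inl (Y := Y) hp] at hl
    obtain ⟨q, hq⟩ := Graph.exists_joined hl
    by_cases h : ∀ j, q ≠ .out j
    · exact ⟨_, .left hq hp h⟩
    · push Not at h
      obtain ⟨j, rfl⟩ := h
      obtain ⟨r, hr⟩ := Graph.exists_joined_inp B.toGraph hq
      by_cases h : ∀ j, r ≠ .inp j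
      · exact ⟨_, .up hq hr hp h⟩
      · push Not at h
        obtain ⟨k, rfl⟩ := h
        obtain ⟨s, hs⟩ := Graph.exists_joined_out A.toGraph hr
        exact ⟨_, .cap hq hr hs hp (A.ne_out_of_joined hs)⟩
  · rw [Port.letter_map_inr (Y := Y) hp] at hl
    obtain ⟨q, hq⟩ := Graph.exists_joined hl
    by_cases h : ∀ j, q ≠ .inp j
    · exact ⟨_, .right hq hp h⟩
    · push Not at h
      obtain ⟨j, rfl⟩ := h
      obtain ⟨s, hs⟩ := Graph.exists_joined_out A.toGraph hq
      exact ⟨_, .down hs hq.symm (A.ne_out_of_joined hs) hp⟩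

/-- The composite of two graphs, as a matching of ports. -/
noncomputable def Net.compGraph (A : Net S X Y) (B : Net S Y Z) : Graph S X Z :=
  Graph.ofJoined (Sum.elim A.label B.label) (Sum.elim A.parity B.parity)
    (by rintro (α | α) h; exacts [A.parity_eq_false α h, B.parity_eq_false α h])
    (CompJoined A.Joined B.Joined)
    (fun _ _ h => h.symm (fun _ _ h => h.symm) fun _ _ h => h.symm) (fun _ _ h => h.letter)
    (A.exists_compJoined B) (fun _ _ _ h h' => h.unique h')

theorem Net.compGraph_joined {A : Net S X Y} {B : Net S Y Z} {p q : Port (A.Node ⊕ B.Node)} :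
    (A.compGraph B).Joined p q ↔ CompJoined A.Joined B.Joined p q := by
  exact Graph.ofJoined_joined p q

/-- The composite of two realisable graphs; for its realisability, `A` is moved to the lower half
of the strip, and `B` to the upper half. -/
noncomputable def Net.comp (A : Net S X Y) (B : Net S Y Z) : Net S X Z where
  toGraph := A.compGraph B
  isRealisable := by
    obtain ⟨f, hf, hA⟩ := A.isRealisable
    obtain ⟨g, hg, hB⟩ := B.isRealisable
    have h1 {p : Port A.Node} (hp : ∀ j, p ≠ .out j) : (p.map Sum.inl).height
        (Sum.elim (fun α => f α / 2) fun β => (1 + g β) / 2) = p.height f / 2 := by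
      cases p <;> simp_all [Port.height]
    have h1' {p : Port A.Node} (hp : ∀ j, p ≠ .out j) : p.height f < 1 := by
      cases p
      · exact one_pos
      · simp at hp
      · exact (hf _).2
      · exact (hf _).2
    have h2 {q : Port B.Node} (hq : ∀ j, q ≠ .inp j) : 1 / 2 < (q.map Sum.inr).height
        (Sum.elim (fun α => f α / 2) fun β => (1 + g β) / 2) := by
      cases q
      · simp at hq
      · norm_num [Port.height]
      · simpa [Port.height] using div_lt_div_of_pos_right (lt_add_of_pos_right 1 (hg _).1) two_pos
      · simpa [Port.height] using div_lt_div_of_pos_right (lt_add_of_pos_right 1 (hg _).1) two_pos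
    have h3 {p q : Port B.Node} (hp : ∀ j, p ≠ .inp j) (hq : ∀ j, q ≠ .inp j)
        (hl : p.late B.parity = true) (h : p.height g < q.height g) :
        (p.map Sum.inr).height (Sum.elim (fun α => f α / 2) fun β => (1 + g β) / 2) <
          (q.map Sum.inr).height (Sum.elim (fun α => f α / 2) fun β => (1 + g β) / 2) := by
      have hg' := fun α => (hg α).2
      cases p <;> cases q <;> simp_all [Port.height, Port.late]
      all_goals linarith [hg' ‹_›]
    have key (p q : Port (A.Node ⊕ B.Node)) (h : CompJoined A.Joined B.Joined p q) :
        (p.late (Sum.elim A.parity B.parity) = true ∨ q.late (Sum.elim A.parity B.parity) = true) ∧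
        (p.late (Sum.elim A.parity B.parity) = true → q.late (Sum.elim A.parity B.parity) = false →
          p.height (Sum.elim (fun α => f α / 2) fun β => (1 + g β) / 2) <
            q.height (Sum.elim (fun α => f α / 2) fun β => (1 + g β) / 2)) := by
      cases h with
      | left h hp hq =>
        rw [Port.late_map_inl, Port.late_map_inl, h1 hp, h1 hq]
        exact ⟨(hA _ _ h).1, fun hp hq => by linarith [(hA _ _ h).2 hp hq]⟩
      | up h h' hp hq =>
        rw [Port.late_map_inl, Port.late_map_inr, h1 hp]
        exact ⟨.inl (A.isRealisable.late_of_joined h rfl),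
          fun _ _ => by linarith [h1' hp, h2 hq]⟩
      | down h h' hp hq =>
        rw [Port.late_map_inl, Port.late_map_inr]
        have := A.isRealisable.late_of_joined h rfl
        exact ⟨.inr this, fun _ h => by simp [this] at h⟩
      | cap h h' h'' hp hq =>
        rw [Port.late_map_inl, Port.late_map_inl]
        have := A.isRealisable.late_of_joined h'' rfl
        exact ⟨.inr this, fun _ h => by simp [this] at h⟩
      | right h hp hq =>
        rw [Port.late_map_inr, Port.late_map_inr]
        exact ⟨(hB _ _ h).1, fun hl' hq' => h3 hp hq hl' ((hB _ _ h).2 hl' hq')⟩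
    refine ⟨Sum.elim (fun α => f α / 2) (fun β => (1 + g β) / 2), ?_,
      fun p q h => key p q (Net.compGraph_joined.1 h)⟩
    rintro (α | α)
    · have := hf α
      constructor <;> simp only [Sum.elim_inl] <;> linarith [this.1, this.2]
    · have := hg α
      constructor <;> simp only [Sum.elim_inr] <;> linarith [this.1, this.2]

theorem Net.comp_joined {A : Net S X Y} {B : Net S Y Z} {p q : Port (A.Node ⊕ B.Node)} :
    (A.comp B).Joined p q ↔ CompJoined A.Joined B.Joined p q :=
  Net.compGraph_joined

theorem Net.isDualisable_comp {A : Net S X Y} {B : Net S Y Z} (hA : A.IsDualisable)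
    (hB : B.IsDualisable) : (A.comp B).IsDualisable := by
  have key (p q : Port (A.Node ⊕ B.Node)) (h : CompJoined A.Joined B.Joined p q) :
      p.late (Sum.elim A.parity B.parity) ≠ q.late (Sum.elim A.parity B.parity) := by
    cases h with
    | left h hp hq => rw [Port.late_map_inl, Port.late_map_inl]; exact hA.2 _ _ h
    | up h h' hp hq =>
      have h1 := hA.2 _ _ h
      have h2 := hB.2 _ _ h'
      rw [Port.late_map_inl, Port.late_map_inr]
      simp_all [Port.late]
    | down h h' hp hq =>
      have h1 := hA.2 _ _ h
      have h2 := hB.2 _ _ h'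
      rw [Port.late_map_inl, Port.late_map_inr]
      simp_all [Port.late]
    | cap h h' h'' hp hq => exact absurd (rfl : true = true) (hB.2 _ _ h')
    | right h hp hq => rw [Port.late_map_inr, Port.late_map_inr]; exact hB.2 _ _ h
  exact ⟨by rintro (α | α); exacts [hA.1 α, hB.1 α], fun p q h => key p q (comp_joined.1 h)⟩

end Comp

section Tensor

variable {X Y X' Y' : Word S}

/-- The edges of two graphs put side by side, the first of which has `m` inputs and `n` outputs. -/
inductive TensorJoined {N N' : Type} (m n : ℕ) (J : Port N → Port N → Prop)
    (K : Port N' → Port N' → Prop) : Port (N ⊕ N') → Port (N ⊕ N') → Prop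
  | left {p q : Port N} (h : J p q) : TensorJoined m n J K (p.map Sum.inl) (q.map Sum.inl)
  | right {p q : Port N'} (h : K p q) :
      TensorJoined m n J K (p.map Sum.inr m n) (q.map Sum.inr m n)

theorem TensorJoined.mono {N N' : Type} {m n : ℕ} {J J' : Port N → Port N → Prop}
    {K K' : Port N' → Port N' → Prop} (hJ : ∀ p q, J p q → J' p q) (hK : ∀ p q, K p q → K' p q)
    {p q : Port (N ⊕ N')} (h : TensorJoined m n J K p q) : TensorJoined m n J' K' p q := by
  cases h with
  | left h => exact .left (hJ _ _ h)
  | right h => exact .right (hK _ _ h)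

theorem TensorJoined.symm {N N' : Type} {m n : ℕ} {J : Port N → Port N → Prop}
    {K : Port N' → Port N' → Prop} (hJ : ∀ p q, J p q → J q p) (hK : ∀ p q, K p q → K q p)
    {p q : Port (N ⊕ N')} (h : TensorJoined m n J K p q) : TensorJoined m n J K q p := by
  cases h with
  | left h => exact .left (hJ _ _ h)
  | right h => exact .right (hK _ _ h)

theorem Port.map_inl_ne_map_inr_of_letter {N N' : Type} {p : Port N} {q : Port N'}
    {l : N → S.Mor} {a : Letter S.Obj} (hp : p.letter X Y l = some a) :
    (p.map Sum.inl : Port (N ⊕ N')) ≠ q.map Sum.inr X.length Y.length := by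
  have hi := fun i (h : X[i]? = some a) => (List.getElem?_eq_some_iff.1 h).1
  have ho := fun i (h : (Word.dual Y)[i]? = some a) => (List.getElem?_eq_some_iff.1 h).1
  cases p <;> cases q <;> simp
  · have := hi _ hp; omega
  · have := ho _ hp; simp at this; omega

/-- Two graphs side by side. -/
noncomputable def Graph.tensor (A : Graph S X Y) (B : Graph S X' Y') :
    Graph S (X ++ X') (Y ++ Y') :=
  Graph.ofJoined (Sum.elim A.label B.label) (Sum.elim A.parity B.parity)
    (by rintro (α | α) h; exacts [A.parity_eq_false α h, B.parity_eq_false α h])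
    (TensorJoined X.length Y.length A.Joined B.Joined)
    (fun _ _ h => h.symm (fun _ _ h => h.symm) fun _ _ h => h.symm)
    (by
      rintro _ _ (h | h)
      · obtain ⟨l, h1, h2⟩ := h.letter
        exact ⟨l, Port.letter_map_inl_append h1, Port.letter_map_inl_append h2⟩
      · obtain ⟨l, h1, h2⟩ := h.letter
        exact ⟨l, by rw [Port.letter_map_inr_append, h1], by rw [Port.letter_map_inr_append, h2]⟩)
    (by
      intro P l hP
      obtain ⟨p, h, rfl⟩ | ⟨p, h, rfl⟩ := Port.letter_append hP
      · obtain ⟨q, hq⟩ := Graph.exists_joined (A := A) h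
        exact ⟨_, .left hq⟩
      · obtain ⟨q, hq⟩ := Graph.exists_joined (A := B) h
        exact ⟨_, .right hq⟩)
    (by
      intro P q q' h h'
      cases h with
      | @left p q h =>
        generalize hP : p.map Sum.inl = P at h'
        cases h' with
        | left h' =>
          obtain rfl := Port.map_injective Sum.inl_injective _ _ hP
          rw [h.unique h']
        | right h' =>
          obtain ⟨l, hl, -⟩ := h.letter
          exact absurd hP (Port.map_inl_ne_map_inr_of_letter hl)
      | @right p q h =>
        generalize hP : p.map Sum.inr X.length Y.length = P at h'
        cases h' with
        | left h' =>
          obtain ⟨l, hl, -⟩ := h'.letter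
          exact absurd hP.symm (Port.map_inl_ne_map_inr_of_letter hl)
        | right h' =>
          obtain rfl := Port.map_injective Sum.inr_injective _ _ hP
          rw [h.unique h'])

theorem Graph.tensor_joined {A : Graph S X Y} {B : Graph S X' Y'}
    {p q : Port (A.Node ⊕ B.Node)} :
    (A.tensor B).Joined p q ↔ TensorJoined X.length Y.length A.Joined B.Joined p q := by
  exact Graph.ofJoined_joined p q

/-- Two realisable graphs side by side. -/
noncomputable def Net.tensor (A : Net S X Y) (B : Net S X' Y') : Net S (X ++ X') (Y ++ Y') where
  toGraph := A.toGraph.tensor B.toGraph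
  isRealisable := by
    obtain ⟨f, hf, hA⟩ := A.isRealisable
    obtain ⟨g, hg, hB⟩ := B.isRealisable
    have key (p q : Port (A.Node ⊕ B.Node))
        (h : TensorJoined X.length Y.length A.Joined B.Joined p q) :
        (p.late (Sum.elim A.parity B.parity) = true ∨ q.late (Sum.elim A.parity B.parity) = true) ∧
        (p.late (Sum.elim A.parity B.parity) = true → q.late (Sum.elim A.parity B.parity) = false →
          p.height (Sum.elim f g) < q.height (Sum.elim f g)) := by
      cases h with
      | left h =>
        rw [Port.late_map_inl, Port.late_map_inl,
          Port.height_map (f := Sum.inl) (h := f) (fun _ => rfl),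
          Port.height_map (f := Sum.inl) (h := f) (fun _ => rfl)]
        exact hA _ _ h
      | right h =>
        rw [Port.late_map_inr, Port.late_map_inr,
          Port.height_map (f := Sum.inr) (h := g) (fun _ => rfl),
          Port.height_map (f := Sum.inr) (h := g) (fun _ => rfl)]
        exact hB _ _ h
    exact ⟨Sum.elim f g, by rintro (α | α); exacts [hf α, hg α],
      fun p q h => key p q (Graph.tensor_joined.1 h)⟩

theorem Net.tensor_joined {A : Net S X Y} {B : Net S X' Y'} {p q : Port (A.Node ⊕ B.Node)} :
    (A.tensor B).Joined p q ↔ TensorJoined X.length Y.length A.Joined B.Joined p q :=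
  Graph.tensor_joined

theorem Net.isDualisable_tensor {A : Net S X Y} {B : Net S X' Y'} (hA : A.IsDualisable)
    (hB : B.IsDualisable) : (A.tensor B).IsDualisable := by
  have key (p q : Port (A.Node ⊕ B.Node))
      (h : TensorJoined X.length Y.length A.Joined B.Joined p q) :
      p.late (Sum.elim A.parity B.parity) ≠ q.late (Sum.elim A.parity B.parity) := by
    cases h with
    | left h => rw [Port.late_map_inl, Port.late_map_inl]; exact hA.2 _ _ h
    | right h => rw [Port.late_map_inr, Port.late_map_inr]; exact hB.2 _ _ h
  exact ⟨by rintro (α | α); exacts [hA.1 α, hB.1 α], fun p q h => key p q (tensor_joined.1 h)⟩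

end Tensor

section Reflect

variable {X Y : Word S}

/-- The mirror image in the time direction of a graph with dualisable labels. -/
def Graph.reflect (A : Graph S X Y) (hA : A.IsDualisable) :
    Graph S (Word.dual Y) (Word.dual X) where
  Node := A.Node
  Edge := A.Edge
  finite_node := A.finite_node
  finite_edge := A.finite_edge
  label := A.label
  parity α := !A.parity α
  parity_eq_false α h := absurd (hA.1 α) h
  edgeLabel := A.edgeLabel
  source e := (A.source e).reflect id
  target e := (A.target e).reflect id
  source_letter e := by
    rw [Port.letter_reflect (X := X) (Y := Y) (f := id) (l := A.label) (fun _ => rfl),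
      A.source_letter]
  target_letter e := by
    rw [Port.letter_reflect (X := X) (Y := Y) (f := id) (l := A.label) (fun _ => rfl),
      A.target_letter]
  existsUnique_source p x h := by
    rw [← p.reflect_reflect, Port.letter_reflect (f := id) (l := A.label) (fun _ => rfl)] at h
    obtain ⟨e, he, hu⟩ := A.existsUnique_source _ x h
    exact ⟨e, (congrArg _ he).trans (Port.reflect_reflect _), fun e' he' => hu e' (by
      rw [← he', Port.reflect_reflect])⟩
  existsUnique_target p x h := by
    rw [← p.reflect_reflect, Port.letter_reflect (f := id) (l := A.label) (fun _ => rfl)] at h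
    obtain ⟨e, he, hu⟩ := A.existsUnique_target _ x h
    exact ⟨e, (congrArg _ he).trans (Port.reflect_reflect _), fun e' he' => hu e' (by
      rw [← he', Port.reflect_reflect])⟩

theorem Graph.reflect_joined {A : Graph S X Y} {hA : A.IsDualisable} {p q : Port A.Node} :
    (A.reflect hA).Joined p q ↔ A.Joined (p.reflect id) (q.reflect id) := by
  constructor
  · rintro ⟨e, ⟨rfl, rfl⟩ | ⟨rfl, rfl⟩⟩
    · exact ⟨e, .inl ⟨(Port.reflect_reflect _).symm, (Port.reflect_reflect _).symm⟩⟩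
    · exact ⟨e, .inr ⟨(Port.reflect_reflect _).symm, (Port.reflect_reflect _).symm⟩⟩
  · rintro ⟨e, ⟨h, h'⟩ | ⟨h, h'⟩⟩
    · exact ⟨e, .inl ⟨(congrArg _ h).trans (Port.reflect_reflect _),
        (congrArg _ h').trans (Port.reflect_reflect _)⟩⟩
    · exact ⟨e, .inr ⟨(congrArg _ h).trans (Port.reflect_reflect _),
        (congrArg _ h').trans (Port.reflect_reflect _)⟩⟩

theorem Graph.isDualisable_reflect {A : Graph S X Y} (hA : A.IsDualisable) :
    (A.reflect hA).IsDualisable := by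
  have key (p q : Port A.Node) (h : A.Joined (p.reflect id) (q.reflect id)) :
      (p.late fun α => !A.parity α) ≠ q.late fun α => !A.parity α := by
    have h1 := hA.2 _ _ h
    rw [Port.late_reflect, Port.late_reflect] at h1
    exact fun h2 => h1 (congrArg _ h2)
  exact ⟨hA.1, fun p q h => key p q (reflect_joined.1 h)⟩

/-- The mirror image in the time direction of a realisable graph without caps. -/
def Net.reflect (A : Net S X Y) (hA : A.IsDualisable) : Net S (Word.dual Y) (Word.dual X) where
  toGraph := A.toGraph.reflect hA
  isRealisable := by
    obtain ⟨f, hf, hJ⟩ := A.isRealisable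
    have key (p q : Port A.Node) (h : A.Joined (p.reflect id) (q.reflect id)) :
        ((p.late fun α => !A.parity α) = true ∨ (q.late fun α => !A.parity α) = true) ∧
        ((p.late fun α => !A.parity α) = true → (q.late fun α => !A.parity α) = false →
          (p.height fun α => 1 - f α) < q.height fun α => 1 - f α) := by
      have h1 := hA.2 _ _ h
      have h2 := (hJ _ _ h.symm).2
      simp only [Port.late_reflect] at h1 h2
      refine ⟨by revert h1; cases p.late _ <;> cases q.late _ <;> simp, fun hp hq => ?_⟩
      have h3 := h2 (by rw [hq]; rfl) (by rw [hp]; rfl)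
      have hf1 := fun α => (hf α).1
      have hf2 := fun α => (hf α).2
      clear h2 h1 h hJ
      cases p <;> cases q <;> simp_all [Port.height, Port.late]
      all_goals linarith [hf1 ‹_›, hf2 ‹_›]
    refine ⟨fun α => 1 - f α, fun α => ?_, fun p q h => key p q (Graph.reflect_joined.1 h)⟩
    have := hf α
    constructor <;> linarith [this.1, this.2]

end Reflect

section Wire

variable {X Y : Word S}

/-- The edges of a graph without internal nodes that joins the `i`-th input to the `σ i`-th
output. -/
inductive WireJoined (X : Word S) (σ : ℕ → ℕ) : Port Empty → Port Empty → Prop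
  | up {i : ℕ} (hi : i < X.length) : WireJoined X σ (.inp i) (.out (σ i))
  | down {i : ℕ} (hi : i < X.length) : WireJoined X σ (.out (σ i)) (.inp i)

theorem WireJoined.symm {X : Word S} {σ : ℕ → ℕ} {p q : Port Empty} (h : WireJoined X σ p q) :
    WireJoined X σ q p := by
  cases h with
  | up hi => exact .down hi
  | down hi => exact .up hi

/-- The graph without internal nodes that permutes the letters of a word by `σ`. -/
noncomputable def Graph.wire (σ : Equiv.Perm ℕ) (h : ∀ i, Y[σ i]? = X[i]?) : Graph S X Y :=
  Graph.ofJoined (N := Empty) Empty.elim Empty.elim (fun α => α.elim) (WireJoined X σ)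
    (fun _ _ h => h.symm)
    (by
      rintro _ _ (@⟨i, hi⟩ | @⟨i, hi⟩)
      · exact ⟨X[i], by simp [hi], by simp [Word.getElem?_dual, h, hi]⟩
      · exact ⟨(X[i]).dual, by simp [Word.getElem?_dual, h, hi], by simp [hi]⟩)
    (by
      rintro (i | i | ⟨⟨⟩, _⟩ | ⟨⟨⟩, _⟩) l hl
      · exact ⟨_, .up (List.getElem?_eq_some_iff.1 hl).1⟩
      · obtain ⟨k, rfl⟩ := σ.surjective i
        rw [Port.letter_out, Word.getElem?_dual, h, Option.map_eq_some_iff] at hl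
        obtain ⟨a, ha, -⟩ := hl
        exact ⟨_, .down (List.getElem?_eq_some_iff.1 ha).1⟩)
    (by
      intro p q q' h1 h2
      cases h1 with
      | up => cases h2; rfl
      | @down i =>
        generalize hj : σ i = j at h2
        cases h2
        rw [σ.injective hj])

theorem Graph.wire_joined {σ : Equiv.Perm ℕ} {h : ∀ i, Y[σ i]? = X[i]?} {p q : Port Empty} :
    (Graph.wire σ h).Joined p q ↔ WireJoined X σ p q := by
  unfold Graph.wire
  exact Graph.ofJoined_joined p q

/-- The net without internal nodes that permutes the letters of a word by `σ`. -/
noncomputable def Net.wire (σ : Equiv.Perm ℕ) (h : ∀ i, Y[σ i]? = X[i]?) : Net S X Y where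
  toGraph := Graph.wire σ h
  isRealisable := by
    refine ⟨fun α => α.elim, fun α => α.elim, fun p q hJ => ?_⟩
    obtain hi | hi := (Graph.wire_joined (h := h)).1 hJ <;> simp [Port.late, Port.height]

/-- The edges of interleaved caps. -/
inductive CapsJoined (X : Word S) : Port Empty → Port Empty → Prop
  | left {i : ℕ} (hi : i < X.length) : CapsJoined X (.inp i) (.inp (X.length + i))
  | right {i : ℕ} (hi : i < X.length) : CapsJoined X (.inp (X.length + i)) (.inp i)

theorem CapsJoined.symm {X : Word S} {p q : Port Empty} (h : CapsJoined X p q) :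
    CapsJoined X q p := by
  cases h with
  | left hi => exact .right hi
  | right hi => exact .left hi

/-- The graph of interleaved caps. -/
noncomputable def Graph.caps (X : Word S) : Graph S (X ++ Word.dual X) [] :=
  Graph.ofJoined (N := Empty) Empty.elim Empty.elim (fun α => α.elim) (CapsJoined X)
    (fun _ _ h => h.symm)
    (by
      rintro _ _ (@⟨i, hi⟩ | @⟨i, hi⟩)
      · exact ⟨X[i], by simp [List.getElem?_append_left hi, hi],
          by rw [Port.letter_inp, Word.getElem?_append_length_add, Word.getElem?_dual,
            List.getElem?_eq_getElem hi, Option.map_some]⟩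
      · exact ⟨(X[i]).dual,
          by rw [Port.letter_inp, Word.getElem?_append_length_add, Word.getElem?_dual,
            List.getElem?_eq_getElem hi, Option.map_some],
          by simp [List.getElem?_append_left hi, hi]⟩)
    (by
      rintro (i | i | ⟨⟨⟩, _⟩ | ⟨⟨⟩, _⟩) l hl
      · have hi := (List.getElem?_eq_some_iff.1 hl).1
        simp only [List.length_append, Word.length_dual] at hi
        by_cases h : i < X.length
        · exact ⟨_, .left h⟩
        · obtain ⟨k, rfl⟩ := Nat.exists_eq_add_of_le (not_lt.1 h)
          exact ⟨_, .right (by omega)⟩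
      · simp at hl)
    (by
      intro p q q' h1 h2
      cases h1 with
      | @left i hi =>
        generalize hj : i = j at h2
        cases h2
        · rfl
        · omega
      | @right i hi =>
        generalize hj : X.length + i = j at h2
        cases h2
        · omega
        · rw [Nat.add_left_cancel hj])

theorem Graph.caps_joined {X : Word S} {p q : Port Empty} :
    (Graph.caps X).Joined p q ↔ CapsJoined X p q := by
  unfold Graph.caps
  exact Graph.ofJoined_joined p q

/-- The net of interleaved caps. -/
noncomputable def Net.caps (X : Word S) : Net S (X ++ Word.dual X) [] where
  toGraph := Graph.caps X
  isRealisable := by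
    refine ⟨fun α => α.elim, fun α => α.elim, fun p q hJ => ?_⟩
    obtain hi | hi := Graph.caps_joined.1 hJ <;> simp [Port.late]

end Wire

/-! ### Identities between the operations -/

/-- The permutation exchanging a block of length `m` with the following block of length `n`. -/
def blockSwap (m n : ℕ) : Equiv.Perm ℕ where
  toFun i := if i < m then n + i else if i < m + n then i - m else i
  invFun i := if i < n then m + i else if i < n + m then i - n else i
  left_inv i := by
    by_cases h1 : i < m
    · simp only [if_pos h1]; split_ifs <;> omega
    · by_cases h2 : i < m + n
      · simp only [if_neg h1, if_pos h2]; split_ifs <;> omega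
      · simp only [if_neg h1, if_neg h2]; split_ifs <;> omega
  right_inv i := by
    by_cases h1 : i < n
    · simp only [if_pos h1]; split_ifs <;> omega
    · by_cases h2 : i < n + m
      · simp only [if_neg h1, if_pos h2]; split_ifs <;> omega
      · simp only [if_neg h1, if_neg h2]; split_ifs <;> omega

theorem blockSwap_apply (m n i : ℕ) :
    blockSwap m n i = if i < m then n + i else if i < m + n then i - m else i := rfl

theorem blockSwap_of_lt {m i : ℕ} (n : ℕ) (h : i < m) : blockSwap m n i = n + i := by
  rw [blockSwap_apply, if_pos h]

theorem blockSwap_add {n i : ℕ} (m : ℕ) (h : i < n) : blockSwap m n (m + i) = i := by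
  rw [blockSwap_apply, if_neg (by omega), if_pos (by omega), Nat.add_sub_cancel_left]

@[simp] theorem blockSwap_blockSwap (m n i : ℕ) : blockSwap n m (blockSwap m n i) = i :=
  (blockSwap m n).left_inv i

theorem getElem?_blockSwap (X Y : Word S) (i : ℕ) :
    (Y ++ X)[blockSwap X.length Y.length i]? = (X ++ Y)[i]? := by
  rw [blockSwap_apply]
  by_cases h1 : i < X.length
  · rw [if_pos h1, Word.getElem?_append_length_add, List.getElem?_append_left h1]
  · obtain ⟨k, rfl⟩ := Nat.exists_eq_add_of_le (not_lt.1 h1)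
    rw [if_neg h1, Word.getElem?_append_length_add]
    split_ifs with h2
    · rw [Nat.add_sub_cancel_left, List.getElem?_append_left (by omega)]
    · rw [List.getElem?_eq_none (by simp; omega), List.getElem?_eq_none (by omega)]

namespace Port

variable {N N' N'' : Type}

theorem map_eq_relabel (f : N → N') (p : Port N) : p.map f = p.relabel f id id := by
  cases p <;> simp

theorem relabel_of_ne_out {f : N → N'} {σ τ : ℕ → ℕ} {p : Port N} (h : ∀ j, p ≠ out j) :
    p.relabel f σ τ = p.relabel f σ id := by
  cases p <;> simp_all

end Port

namespace CompJoined

variable {N N' N'' : Type} {J : Port N → Port N → Prop} {K : Port N' → Port N' → Prop}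
  {L : Port N'' → Port N'' → Prop}

theorem of_out {p : Port (N ⊕ N')} {j : ℕ} (h : CompJoined J K p (.out j)) :
    (∃ q k, J q (.out k) ∧ K (.inp k) (.out j) ∧ (∀ j, q ≠ .out j) ∧ p = q.map Sum.inl) ∨
      ∃ q, K q (.out j) ∧ (∀ j, q ≠ .inp j) ∧ p = q.map Sum.inr := by
  generalize hP : Port.out j = P at h
  cases h with
  | left h hp hq => exact absurd hP.symm (Port.map_ne_out hq _)
  | @up p k q h h' hp hq =>
    obtain rfl : .out j = q := Port.map_injective (N' := N ⊕ N') Sum.inr_injective 0 0 (by simpa)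
    exact .inl ⟨_, _, h, h', hp, rfl⟩
  | down h h' hp hq => exact absurd hP.symm (Port.map_ne_out hp _)
  | cap h h' h'' hp hq => exact absurd hP.symm (Port.map_ne_out hq _)
  | @right p q h hp hq =>
    obtain rfl : .out j = q := Port.map_injective (N' := N ⊕ N') Sum.inr_injective 0 0 (by simpa)
    exact .inr ⟨_, h, hp, rfl⟩

theorem map_assoc_inl (p : Port N) : ((p.map Sum.inl : Port (N ⊕ N')).map Sum.inl).map
    (Equiv.sumAssoc N N' N'') = p.map Sum.inl := by
  cases p <;> simp

theorem map_assoc_inr (p : Port N') : ((p.map Sum.inr : Port (N ⊕ N')).map Sum.inl).map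
    (Equiv.sumAssoc N N' N'') = (p.map Sum.inl).map Sum.inr := by
  cases p <;> simp

theorem map_assoc_right (p : Port N'') : (p.map Sum.inr).map
    (Equiv.sumAssoc N N' N'') = (p.map Sum.inr).map Sum.inr := by
  cases p <;> simp

/-- Composition is associative. -/
theorem assoc (hL : ∀ p q, L p q → L q p) {p q : Port ((N ⊕ N') ⊕ N'')}
    (h : CompJoined (CompJoined J K) L p q) :
    CompJoined J (CompJoined K L) (p.map (Equiv.sumAssoc N N' N''))
      (q.map (Equiv.sumAssoc N N' N'')) := by
  have hi (j k : ℕ) : (.inp j : Port N') ≠ .out k := by simp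
  have ho (j k : ℕ) : (.out j : Port N'') ≠ .inp k := by simp
  have hinl {p : Port N'} (hp : ∀ j, p ≠ .inp j) (j) : (p.map Sum.inl : Port (N' ⊕ N'')) ≠ .inp j :=
    Port.map_ne_inp hp j
  have hinr {p : Port N''} (hp : ∀ j, p ≠ .inp j) (j) :
      (p.map Sum.inr : Port (N' ⊕ N'')) ≠ .inp j :=
    Port.map_ne_inp hp j
  have hc {j : ℕ} {q : Port (N' ⊕ N'')} (h : CompJoined K L ((Port.inp j).map Sum.inl) q) :
      CompJoined K L (.inp j) q := by
    rwa [Port.map_inp, zero_add] at h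
  have hcc {j k : ℕ}
      (h : CompJoined K L ((Port.inp j).map Sum.inl) ((Port.inp k).map Sum.inl)) :
      CompJoined K L (.inp j) (.inp k) := by
    rwa [Port.map_inp, Port.map_inp, zero_add, zero_add] at h
  cases h with
  | left h hp hq =>
    cases h with
    | left h hp' hq' =>
      rw [map_assoc_inl, map_assoc_inl]
      exact .left h hp' hq'
    | up h h' hp' hq' =>
      rw [map_assoc_inl, map_assoc_inr]
      exact .up h (hc (.left h' (hi _) fun j hj => hq j (by rw [hj]; simp))) hp' (hinl hq')
    | down h h' hp' hq' =>
      rw [map_assoc_inl, map_assoc_inr]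
      exact .down h (hc (.left h' (hi _) fun j hj => hp j (by rw [hj]; simp))) hp' (hinl hq')
    | cap h h' h'' hp' hq' =>
      rw [map_assoc_inl, map_assoc_inl]
      exact .cap h (hcc (.left h' (hi _) (hi _))) h'' hp' hq'
    | right h hp' hq' =>
      rw [map_assoc_inr, map_assoc_inr]
      exact .right (.left h (fun j hj => hp j (by rw [hj]; simp))
        fun j hj => hq j (by rw [hj]; simp)) (hinl hp') (hinl hq')
  | up h h' hp hq =>
    obtain ⟨p, k, h1, h2, hp', rfl⟩ | ⟨p, h1, hp', rfl⟩ := h.of_out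
    · rw [map_assoc_inl, map_assoc_right]
      exact .up h1 (hc (.up h2 h' (hi _) hq)) hp' (hinr hq)
    · rw [map_assoc_inr, map_assoc_right]
      exact .right (.up h1 h' (fun j hj => hp j (by rw [hj]; simp)) hq) (hinl hp') (hinr hq)
  | down h h' hp hq =>
    obtain ⟨p, k, h1, h2, hp', rfl⟩ | ⟨p, h1, hp', rfl⟩ := h.of_out
    · rw [map_assoc_inl, map_assoc_right]
      exact .down h1 (hc (.up h2 h' (hi _) hq)) hp' (hinr hq)
    · rw [map_assoc_inr, map_assoc_right]
      exact .right (.down h1 h' (fun j hj => hp j (by rw [hj]; simp)) hq) (hinr hq) (hinl hp')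
  | cap h h' h'' hp hq =>
    obtain ⟨p, k, h1, h2, hp', rfl⟩ | ⟨p, h1, hp', rfl⟩ := h.of_out <;>
    obtain ⟨q, l, h3, h4, hq', rfl⟩ | ⟨q, h3, hq', rfl⟩ := h''.of_out
    · rw [map_assoc_inl, map_assoc_inl]
      exact .cap h1 (hcc (.cap h2 h' h4 (hi _) (hi _))) h3 hp' hq'
    · rw [map_assoc_inl, map_assoc_inr]
      exact .up h1 (hc (.cap h2 h' h3 (hi _) fun j hj => hq j (by rw [hj]; simp))) hp' (hinl hq')
    · rw [map_assoc_inl, map_assoc_inr]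
      exact .down h3 (hc (.cap h4 (hL _ _ h') h1 (hi _) fun j hj => hp j (by rw [hj]; simp)))
        hq' (hinl hp')
    · rw [map_assoc_inr, map_assoc_inr]
      exact .right (.cap h1 h' h3 (fun j hj => hp j (by rw [hj]; simp))
        fun j hj => hq j (by rw [hj]; simp)) (hinl hp') (hinl hq')
  | right h hp hq =>
    rw [map_assoc_right, map_assoc_right]
    exact .right (.right h hp hq) (hinr hp) (hinr hq)

end CompJoined

namespace WireJoined

variable {N : Type} {J : Port N → Port N → Prop} {X Y : Word S} {σ : ℕ → ℕ}

theorem of_out {p : Port Empty} {j : ℕ} (h : WireJoined X σ p (.out j)) :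
    ∃ i, i < X.length ∧ p = .inp i ∧ j = σ i := by
  cases h with
  | up hi => exact ⟨_, hi, rfl, rfl⟩

/-- Composing with a permutation relabels the inputs. -/
theorem comp (hJ : ∀ p q, J p q → J q p) {p q : Port (Empty ⊕ N)}
    (h : CompJoined (WireJoined X σ) J p q) :
    J (p.relabel (Equiv.emptySum Empty N) σ id) (q.relabel (Equiv.emptySum Empty N) σ id) := by
  have hr {p : Port N} (hp : ∀ j, p ≠ .inp j) :
      (p.map Sum.inr).relabel (Equiv.emptySum Empty N) σ id = p := by
    cases p <;> simp_all
  cases h with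
  | left h hp hq =>
    cases h with
    | up => exact absurd rfl (hq _)
    | down => exact absurd rfl (hp _)
  | up h h' hp hq =>
    obtain ⟨i, hi, rfl, rfl⟩ := h.of_out
    rw [hr hq]
    simpa using h'
  | down h h' hp hq =>
    obtain ⟨i, hi, rfl, rfl⟩ := h.of_out
    rw [hr hq]
    simpa using hJ _ _ h'
  | cap h h' h'' hp hq =>
    obtain ⟨i, hi, rfl, rfl⟩ := h.of_out
    obtain ⟨i', hi', rfl, rfl⟩ := h''.of_out
    simpa using h'
  | right h hp hq =>
    rw [hr hp, hr hq]
    exact h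

/-- Composing with a permutation relabels the outputs. -/
theorem comp_right (hJ : ∀ p q, J p q → J q p) {m : ℕ}
    (hw : ∀ p q, J p q → p.Within m Y.length) (ho : ∀ i j, ¬ J (.out i) (.out j)) {p q : Port N}
    (h : J p q) : CompJoined J (WireJoined Y σ) (p.relabel Sum.inl id σ)
      (q.relabel Sum.inl id σ) := by
  have hout {p : Port N} (hp : ¬ ∀ j, p ≠ .out j) : ∃ j, p = .out j := by
    push Not at hp; exact hp
  by_cases hp : ∀ j, p ≠ .out j <;> by_cases hq : ∀ j, q ≠ .out j
  · rw [Port.relabel_of_ne_out hp, Port.relabel_of_ne_out hq, ← Port.map_eq_relabel,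
      ← Port.map_eq_relabel]
    exact .left h hp hq
  · obtain ⟨j, rfl⟩ := hout hq
    rw [Port.relabel_of_ne_out hp, ← Port.map_eq_relabel]
    simpa using CompJoined.up h (WireJoined.up (σ := σ) (hw _ _ (hJ _ _ h))) hp (by simp)
  · obtain ⟨j, rfl⟩ := hout hp
    rw [Port.relabel_of_ne_out hq, ← Port.map_eq_relabel]
    simpa using CompJoined.down (hJ _ _ h) (WireJoined.up (σ := σ) (hw _ _ h)) hq (by simp)
  · obtain ⟨j, rfl⟩ := hout hp
    obtain ⟨k, rfl⟩ := hout hq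
    exact absurd h (ho _ _)

theorem id_comp (hJ : ∀ p q, J p q → J q p) {p q : Port (Empty ⊕ N)}
    (h : CompJoined (WireJoined X id) J p q) :
    J (p.map (Equiv.emptySum Empty N)) (q.map (Equiv.emptySum Empty N)) := by
  rw [Port.map_eq_relabel, Port.map_eq_relabel]
  exact comp hJ h

theorem comp_id (hJ : ∀ p q, J p q → J q p) {m : ℕ}
    (hw : ∀ p q, J p q → p.Within m Y.length) (ho : ∀ i j, ¬ J (.out i) (.out j)) {p q : Port N}
    (h : J p q) : CompJoined J (WireJoined Y id) (p.map (Equiv.sumEmpty N Empty).symm)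
      (q.map (Equiv.sumEmpty N Empty).symm) := by
  rw [Port.map_eq_relabel, Port.map_eq_relabel]
  exact comp_right hJ hw ho h

end WireJoined

namespace TensorJoined

variable {N₁ N₂ N₃ N₄ : Type} {J₁ : Port N₁ → Port N₁ → Prop} {J₂ : Port N₂ → Port N₂ → Prop}
  {J₃ : Port N₃ → Port N₃ → Prop} {J₄ : Port N₄ → Port N₄ → Prop} {m n l m' n' : ℕ}

/-- The tensor product is associative. -/
theorem assoc {p q : Port ((N₁ ⊕ N₂) ⊕ N₃)}
    (h : TensorJoined (m + m') (n + n') (TensorJoined m n J₁ J₂) J₃ p q) :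
    TensorJoined m n J₁ (TensorJoined m' n' J₂ J₃) (p.map (Equiv.sumAssoc N₁ N₂ N₃))
      (q.map (Equiv.sumAssoc N₁ N₂ N₃)) := by
  cases h with
  | left h =>
    cases h with
    | left h => simpa [Port.map_map, Function.comp_def] using TensorJoined.left h
    | right h =>
      simpa [Port.map_map, Function.comp_def] using TensorJoined.right (TensorJoined.left h)
  | right h =>
    simpa [Port.map_map, Function.comp_def] using TensorJoined.right (TensorJoined.right h)

/-- The empty word is a unit for the tensor product. -/
theorem left_unit {p q : Port (Empty ⊕ N₂)}
    (h : TensorJoined 0 0 (WireJoined (S := S) [] id) J₂ p q) :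
    J₂ (p.map (Equiv.emptySum Empty N₂)) (q.map (Equiv.emptySum Empty N₂)) := by
  cases h with
  | left h => cases h with
    | up hi => simp at hi
    | down hi => simp at hi
  | right h =>
    have e (p : Port N₂) : (p.map Sum.inr 0 0).map (Equiv.emptySum Empty N₂) = p := by
      cases p <;> simp
    rwa [e, e]

theorem right_unit {p q : Port (N₁ ⊕ Empty)}
    (h : TensorJoined m n J₁ (WireJoined (S := S) [] id) p q) :
    J₁ (p.map (Equiv.sumEmpty N₁ Empty)) (q.map (Equiv.sumEmpty N₁ Empty)) := by
  cases h with
  | left h =>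
    have e (p : Port N₁) : (p.map Sum.inl 0 0).map (Equiv.sumEmpty N₁ Empty) = p := by
      cases p <;> simp
    rwa [e, e]
  | right h => cases h with
    | up hi => simp at hi
    | down hi => simp at hi

theorem of_out {p : Port (N₁ ⊕ N₂)} {j : ℕ} (h : TensorJoined m n J₁ J₂ p (.out j)) :
    (∃ q, J₁ q (.out j) ∧ p = q.map Sum.inl) ∨
      ∃ q k, J₂ q (.out k) ∧ j = n + k ∧ p = q.map Sum.inr m n := by
  generalize hP : Port.out j = P at h
  cases h with
  | @left p q h =>
    cases q <;> simp at hP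
    subst hP
    exact .inl ⟨_, h, rfl⟩
  | @right p q h =>
    cases q <;> simp at hP
    exact .inr ⟨_, _, h, hP, rfl⟩

/-- The interchange law. -/
theorem comp {p q : Port ((N₁ ⊕ N₂) ⊕ (N₃ ⊕ N₄))}
    (h : TensorJoined m n (CompJoined J₁ J₂) (CompJoined J₃ J₄) p q) :
    CompJoined (TensorJoined m l J₁ J₃) (TensorJoined l n J₂ J₄)
      (p.map (Equiv.sumSumSumComm N₁ N₂ N₃ N₄)) (q.map (Equiv.sumSumSumComm N₁ N₂ N₃ N₄)) := by
  have e₁ (p : Port N₁) : ((p.map Sum.inl).map Sum.inl).map (Equiv.sumSumSumComm N₁ N₂ N₃ N₄) =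
      (p.map Sum.inl).map Sum.inl := by cases p <;> simp
  have e₂ (p : Port N₂) : ((p.map Sum.inr).map Sum.inl).map (Equiv.sumSumSumComm N₁ N₂ N₃ N₄) =
      (p.map Sum.inl).map Sum.inr := by cases p <;> simp
  have e₃ {p : Port N₃} (hp : ∀ j, p ≠ .out j) : ((p.map Sum.inl).map Sum.inr m n).map
      (Equiv.sumSumSumComm N₁ N₂ N₃ N₄) = (p.map Sum.inr m l).map Sum.inl := by
    cases p <;> simp_all
  have e₄ {p : Port N₄} (hp : ∀ j, p ≠ .inp j) : ((p.map Sum.inr).map Sum.inr m n).map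
      (Equiv.sumSumSumComm N₁ N₂ N₃ N₄) = (p.map Sum.inr l n).map Sum.inr := by
    cases p <;> simp_all
  cases h with
  | left h =>
    cases h with
    | left h hp hq =>
      rw [e₁, e₁]
      exact .left (.left h) (Port.map_ne_out hp) (Port.map_ne_out hq)
    | @up p j q h h' hp hq =>
      rw [e₁, e₂]
      exact .up (.left h) (.left h') (Port.map_ne_out hp) (Port.map_ne_inp hq)
    | down h h' hp hq =>
      rw [e₁, e₂]
      exact .down (.left h) (.left h') (Port.map_ne_out hp) (Port.map_ne_inp hq)
    | cap h h' h'' hp hq =>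
      rw [e₁, e₁]
      exact .cap (.left h) (.left h') (.left h'') (Port.map_ne_out hp) (Port.map_ne_out hq)
    | right h hp hq =>
      rw [e₂, e₂]
      exact .right (.left h) (Port.map_ne_inp hp) (Port.map_ne_inp hq)
  | right h =>
    cases h with
    | left h hp hq =>
      rw [e₃ hp, e₃ hq]
      exact .left (.right h) (Port.map_ne_out hp) (Port.map_ne_out hq)
    | @up p j q h h' hp hq =>
      rw [e₃ hp, e₄ hq]
      exact .up (.right h) (.right h') (Port.map_ne_out hp) (Port.map_ne_inp hq)
    | down h h' hp hq =>
      rw [e₃ hp, e₄ hq]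
      exact .down (.right h) (.right h') (Port.map_ne_out hp) (Port.map_ne_inp hq)
    | cap h h' h'' hp hq =>
      rw [e₃ hp, e₃ hq]
      exact .cap (.right h) (.right h') (.right h'') (Port.map_ne_out hp) (Port.map_ne_out hq)
    | right h hp hq =>
      rw [e₄ hp, e₄ hq]
      exact .right (.right h) (Port.map_ne_inp hp) (Port.map_ne_inp hq)

/-- The tensor product is commutative up to an exchange of the blocks of inputs and outputs. -/
theorem swap (h₁ : ∀ p q, J₁ p q → p.Within m n ∧ q.Within m n)
    (h₂ : ∀ p q, J₂ p q → p.Within m' n' ∧ q.Within m' n') {p q : Port (N₁ ⊕ N₂)}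
    (h : TensorJoined m n J₁ J₂ p q) : TensorJoined m' n' J₂ J₁
      (p.relabel (Equiv.sumComm N₁ N₂) (blockSwap m m') (blockSwap n n'))
      (q.relabel (Equiv.sumComm N₁ N₂) (blockSwap m m') (blockSwap n n')) := by
  have e₁ {p : Port N₁} (hp : p.Within m n) : (p.map Sum.inl).relabel (Equiv.sumComm N₁ N₂)
      (blockSwap m m') (blockSwap n n') = p.map Sum.inr m' n' := by
    cases p <;> simp
    exacts [blockSwap_of_lt _ hp, blockSwap_of_lt _ hp]
  have e₂ {p : Port N₂} (hp : p.Within m' n') : (p.map Sum.inr m n).relabel (Equiv.sumComm N₁ N₂)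
      (blockSwap m m') (blockSwap n n') = p.map Sum.inl := by
    cases p <;> simp
    exacts [blockSwap_add _ hp, blockSwap_add _ hp]
  cases h with
  | left h =>
    rw [e₁ (h₁ _ _ h).1, e₁ (h₁ _ _ h).2]
    exact .right h
  | right h =>
    rw [e₂ (h₂ _ _ h).1, e₂ (h₂ _ _ h).2]
    exact .left h

end TensorJoined

/-! ### Reflections and caps -/

/-- The edges of the mirror image in the time direction. -/
def ReflectJoined {N : Type} (J : Port N → Port N → Prop) (p q : Port N) : Prop :=
  J (p.reflect id) (q.reflect id)

namespace ReflectJoined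

variable {N N' : Type} {J : Port N → Port N → Prop} {K : Port N' → Port N' → Prop}

theorem of_joined {p q : Port N} (h : J p q) :
    ReflectJoined J (p.reflect id) (q.reflect id) := by
  rwa [ReflectJoined, Port.reflect_reflect, Port.reflect_reflect]

theorem comp (hJ : ∀ p q, J p q → J q p) (hK : ∀ p q, K p q → K q p)
    (hi : ∀ i j, ¬ K (.inp i) (.inp j)) {p q : Port (N ⊕ N')}
    (h : ReflectJoined (CompJoined J K) p q) :
    CompJoined (ReflectJoined K) (ReflectJoined J)
      (p.map (Equiv.sumComm N N')) (q.map (Equiv.sumComm N N')) := by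
  have ei {p : Port N} : ((p.map Sum.inl : Port (N ⊕ N')).reflect id).map (Equiv.sumComm N N') =
      (p.reflect id).map Sum.inr := by cases p <;> simp
  have er {p : Port N'} : ((p.map Sum.inr : Port (N ⊕ N')).reflect id).map (Equiv.sumComm N N') =
      (p.reflect id).map Sum.inl := by cases p <;> simp
  have ho {p : Port N} (hp : ∀ j, p ≠ .out j) (j : ℕ) : p.reflect id ≠ .inp j := by
    cases p <;> simp_all
  have hk {p : Port N'} (hp : ∀ j, p ≠ .inp j) (j : ℕ) : p.reflect id ≠ .out j := by
    cases p <;> simp_all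
  rw [← p.reflect_reflect, ← q.reflect_reflect]
  rw [ReflectJoined] at h
  generalize p.reflect id = P at h ⊢
  generalize q.reflect id = Q at h ⊢
  cases h with
  | left h hp hq =>
    rw [ei, ei]
    exact .right (of_joined h) (ho hp) (ho hq)
  | up h h' hp hq =>
    rw [ei, er]
    exact .down (of_joined (q := .inp _) (hK _ _ h')) (of_joined (p := .out _) (hJ _ _ h))
      (hk hq) (ho hp)
  | down h h' hp hq =>
    rw [ei, er]
    exact .up (of_joined (q := .inp _) (hK _ _ h')) (of_joined (p := .out _) (hJ _ _ h))
      (hk hq) (ho hp)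
  | cap h h' h'' hp hq => exact absurd h' (hi _ _)
  | right h hp hq =>
    rw [er, er]
    exact .left (of_joined h) (hk hp) (hk hq)

theorem tensor {m n : ℕ} {p q : Port (N ⊕ N')}
    (h : ReflectJoined (TensorJoined m n J K) p q) :
    TensorJoined n m (ReflectJoined J) (ReflectJoined K) p q := by
  rw [← p.reflect_reflect, ← q.reflect_reflect]
  rw [ReflectJoined] at h
  generalize p.reflect id = P at h ⊢
  generalize q.reflect id = Q at h ⊢
  have ei {p : Port N} : (p.map Sum.inl : Port (N ⊕ N')).reflect id =
      (p.reflect id).map Sum.inl := by cases p <;> simp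
  have er {p : Port N'} : (p.map Sum.inr m n : Port (N ⊕ N')).reflect id =
      (p.reflect id).map Sum.inr n m := by cases p <;> simp
  cases h with
  | left h => rw [ei, ei]; exact .left (of_joined h)
  | right h => rw [er, er]; exact .right (of_joined h)

end ReflectJoined

/-- Bending the outputs of a graph down, either by caps after it or by caps before its mirror image,
gives the same graph. -/
theorem CapsJoined.extranatural {X Y : Word S} {N : Type} {J : Port N → Port N → Prop}
    (hJ : ∀ p q, J p q → J q p) (hw : ∀ p q, J p q → p.Within X.length Y.length)
    (hi : ∀ i j, ¬ J (.inp i) (.inp j)) (ho : ∀ i j, ¬ J (.out i) (.out j))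
    {p q : Port ((N ⊕ Empty) ⊕ Empty)}
    (h : CompJoined (TensorJoined X.length Y.length J (WireJoined (Word.dual Y) id))
      (CapsJoined Y) p q) :
    CompJoined (TensorJoined X.length X.length (WireJoined X id) (ReflectJoined J)) (CapsJoined X)
      (p.map (Equiv.sumCongr (Equiv.sumComm N Empty) (Equiv.refl Empty)))
      (q.map (Equiv.sumCongr (Equiv.sumComm N Empty) (Equiv.refl Empty))) := by
  set φ := Equiv.sumCongr (Equiv.sumComm N Empty) (Equiv.refl Empty)
  set R := CompJoined (TensorJoined X.length X.length (WireJoined X id) (ReflectJoined J))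
    (CapsJoined X) with hR
  have hRsymm (p q) (h : R p q) : R q p :=
    h.symm (fun _ _ h => h.symm (fun _ _ h => h.symm) fun _ _ h => hJ _ _ h) fun _ _ h => h.symm
  -- The ports of either side are those of the given graph.
  let θ : Port N → Port ((Empty ⊕ N) ⊕ Empty)
    | .inp i => .inp i
    | .out j => .inp (X.length + j)
    | .dom α i => .dom (.inl (.inr α)) i
    | .cod α i => .cod (.inl (.inr α)) i
  have hθ {p : Port N} (hp : ∀ i, p ≠ .inp i) :
      θ p = ((p.reflect id).map Sum.inr X.length X.length).map Sum.inl := by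
    cases p <;> simp_all [θ]
  have hθo {p : Port N} (hp : ∀ i, p ≠ .inp i) (j) :
      (p.reflect id).map (Sum.inr : N → Empty ⊕ N) X.length X.length ≠ .out j := by
    cases p <;> simp_all
  have key₁ (i : ℕ) (q : Port N) (h : J (.inp i) q) : R (θ (.inp i)) (θ q) := by
    have hq (j) : q ≠ .inp j := by rintro rfl; exact hi _ _ h
    have hl : i < X.length := hw _ _ h
    rw [hθ hq]
    have h1 : TensorJoined X.length X.length (WireJoined X id) (ReflectJoined J)
        (.inp i) (.out i) := by
      simpa using TensorJoined.left (m := X.length) (n := X.length) (J := WireJoined X id)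
        (K := ReflectJoined J) (.up hl)
    have h2 := TensorJoined.right (m := X.length) (n := X.length) (J := WireJoined X id)
      (ReflectJoined.of_joined (hJ _ _ h))
    simpa [θ] using CompJoined.cap h1 (CapsJoined.left hl) h2 (by simp) (hθo hq)
  have key (p q : Port N) (h : J p q) : R (θ p) (θ q) := by
    by_cases hp : ∀ i, p ≠ .inp i
    · by_cases hq : ∀ i, q ≠ .inp i
      · rw [hθ hp, hθ hq]
        exact .left (.right (ReflectJoined.of_joined h)) (hθo hp) (hθo hq)
      · push Not at hq
        obtain ⟨i, rfl⟩ := hq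
        exact hRsymm _ _ (key₁ _ _ (hJ _ _ h))
    · push Not at hp
      obtain ⟨i, rfl⟩ := hp
      exact key₁ _ _ h
  have hmap {p : Port N} (hp : ∀ j, p ≠ .out j) : ((p.map Sum.inl).map Sum.inl).map φ = θ p := by
    cases p <;> simp_all [θ, φ]
  have hcap {p q : Port (N ⊕ Empty)} {j : ℕ} (hj : j < Y.length)
      (h : TensorJoined X.length Y.length J (WireJoined (Word.dual Y) id) p (.out j))
      (h' : TensorJoined X.length Y.length J (WireJoined (Word.dual Y) id) q
        (.out (Y.length + j))) : R ((p.map Sum.inl).map φ) ((q.map Sum.inl).map φ) := by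
    obtain ⟨p, h1, rfl⟩ | ⟨p, k, h1, rfl, rfl⟩ := h.of_out
    · obtain ⟨q, h2, rfl⟩ | ⟨q, k, h2, hk, rfl⟩ := h'.of_out
      · have := hw _ _ (hJ _ _ h2)
        simp [Port.Within] at this
      · obtain rfl := Nat.add_left_cancel hk
        obtain ⟨i, -, rfl, rfl⟩ := h2.of_out
        rw [hmap fun i hp => ho i j (hp ▸ h1)]
        simpa [θ] using key _ _ h1
    · omega
  cases h with
  | left h hp hq =>
    cases h with
    | left h =>
      rw [hmap fun j hj => hp j (by simp [hj]), hmap fun j hj => hq j (by simp [hj])]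
      exact key _ _ h
    | right h =>
      cases h with
      | up => exact absurd rfl (hq _)
      | down => exact absurd rfl (hp _)
  | up _ h _ hq =>
    cases h with
    | left => exact absurd rfl (hq _)
    | right => exact absurd rfl (hq _)
  | down _ h _ hq =>
    cases h with
    | left => exact absurd rfl (hq _)
    | right => exact absurd rfl (hq _)
  | cap h h' h'' =>
    generalize hk : Port.inp _ = P at h'
    cases h' with
    | left hi =>
      cases hk
      exact hcap hi h h''
    | right hi =>
      cases hk
      exact hRsymm _ _ (hcap hi h'' h)
  | right h hp hq =>
    cases h with
    | left => exact absurd rfl (hq _)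
    | right => exact absurd rfl (hq _)

/-! ### The symmetric monoidal category of nets -/

/-- Composites are functorial in both factors. -/
theorem CompJoined.map {M M' N N' : Type} {J : Port M → Port M → Prop}
    {K : Port M' → Port M' → Prop} {J' : Port N → Port N → Prop} {K' : Port N' → Port N' → Prop}
    {f : M → N} {g : M' → N'} (hJ : ∀ p q, J p q → J' (p.map f) (q.map f))
    (hK : ∀ p q, K p q → K' (p.map g) (q.map g)) {p q : Port (M ⊕ M')}
    (h : CompJoined J K p q) : CompJoined J' K' (p.map (Sum.map f g)) (q.map (Sum.map f g)) := by
  have el (p : Port M) : (p.map Sum.inl).map (Sum.map f g) = (p.map f).map Sum.inl := by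
    cases p <;> simp
  have er (p : Port M') : (p.map Sum.inr).map (Sum.map f g) = (p.map g).map Sum.inr := by
    cases p <;> simp
  have ho {p j} (h : J p (.out j)) : J' (p.map f) (.out j) := by simpa using hJ _ _ h
  have hi {q j} (h : K (.inp j) q) : K' (.inp j) (q.map g) := by simpa using hK _ _ h
  cases h with
  | left h hp hq =>
    rw [el, el]
    exact .left (hJ _ _ h) (Port.map_ne_out hp) (Port.map_ne_out hq)
  | up h h' hp hq =>
    rw [el, er]
    exact .up (ho h) (hi h') (Port.map_ne_out hp) (Port.map_ne_inp hq)
  | down h h' hp hq =>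
    rw [el, er]
    exact .down (ho h) (hi h') (Port.map_ne_out hp) (Port.map_ne_inp hq)
  | cap h h' h'' hp hq =>
    rw [el, el]
    exact .cap (ho h) (by simpa using hi h') (ho h'') (Port.map_ne_out hp) (Port.map_ne_out hq)
  | right h hp hq =>
    rw [er, er]
    exact .right (hK _ _ h) (Port.map_ne_inp hp) (Port.map_ne_inp hq)

theorem CompJoined.through {N N' : Type} {J : Port N → Port N → Prop}
    {K : Port N' → Port N' → Prop} {i j k : ℕ} (h : J (.inp i) (.out j))
    (h' : K (.inp j) (.out k)) : CompJoined J K (.inp i) (.out k) := by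
  simpa using CompJoined.up h h' (by simp) (by simp)

theorem TensorJoined.left_through {N N' : Type} {m n : ℕ} {J : Port N → Port N → Prop}
    {K : Port N' → Port N' → Prop} {i j : ℕ} (h : J (.inp i) (.out j)) :
    TensorJoined m n J K (.inp i) (.out j) := by
  simpa using TensorJoined.left (m := m) (n := n) (K := K) h

theorem TensorJoined.right_through {N N' : Type} {m n : ℕ} {J : Port N → Port N → Prop}
    {K : Port N' → Port N' → Prop} {i j : ℕ} (h : K (.inp i) (.out j)) :
    TensorJoined m n J K (.inp (m + i)) (.out (n + j)) :=
  .right h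

theorem TensorJoined.map {M M' N N' : Type} {m n : ℕ} {J : Port M → Port M → Prop}
    {K : Port M' → Port M' → Prop} {J' : Port N → Port N → Prop} {K' : Port N' → Port N' → Prop}
    {f : M → N} {g : M' → N'} (hJ : ∀ p q, J p q → J' (p.map f) (q.map f))
    (hK : ∀ p q, K p q → K' (p.map g) (q.map g)) {p q : Port (M ⊕ M')}
    (h : TensorJoined m n J K p q) :
    TensorJoined m n J' K' (p.map (Sum.map f g)) (q.map (Sum.map f g)) := by
  have el (p : Port M) : (p.map Sum.inl).map (Sum.map f g) = (p.map f).map Sum.inl := by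
    cases p <;> simp
  have er (p : Port M') : (p.map Sum.inr m n).map (Sum.map f g) = (p.map g).map Sum.inr m n := by
    cases p <;> simp
  cases h with
  | left h => rw [el, el]; exact .left (hJ _ _ h)
  | right h => rw [er, er]; exact .right (hK _ _ h)

namespace Net

variable {X Y Z X' Y' Z' : Word S}

theorem comp_congr {A A' : Net S X Y} {B B' : Net S Y Z} (i : Iso A.toGraph A'.toGraph)
    (j : Iso B.toGraph B'.toGraph) : Nonempty (Iso (A.comp B).toGraph (A'.comp B').toGraph) :=
  Iso.of_joined (Equiv.sumCongr i.node j.node)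
    (by rintro (α | α); exacts [i.label_node α, j.label_node α])
    fun _ _ h => comp_joined.2 <| (comp_joined.1 h).map (fun _ _ => i.joined) fun _ _ => j.joined

theorem tensor_congr {A A' : Net S X Y} {B B' : Net S X' Y'} (i : Iso A.toGraph A'.toGraph)
    (j : Iso B.toGraph B'.toGraph) : Nonempty (Iso (A.tensor B).toGraph (A'.tensor B').toGraph) :=
  Iso.of_joined (Equiv.sumCongr i.node j.node)
    (by rintro (α | α); exacts [i.label_node α, j.label_node α])
    fun _ _ h => tensor_joined.2 <|
      (tensor_joined.1 h).map (fun _ _ => i.joined) fun _ _ => j.joined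

/-- Isomorphism of the underlying graphs. -/
instance setoid (X Y : Word S) : Setoid (Net S X Y) where
  r A B := Nonempty (Iso A.toGraph B.toGraph)
  iseqv := ⟨fun A => Iso.nonempty_refl A.toGraph, fun ⟨i⟩ => i.nonempty_symm,
    fun ⟨i⟩ ⟨j⟩ => i.nonempty_trans j⟩

/-- Composition of isomorphism classes. -/
noncomputable def quotComp : Quotient (setoid X Y) → Quotient (setoid Y Z) →
    Quotient (setoid X Z) :=
  Quotient.map₂ comp fun _ _ hA _ _ hB => hA.elim fun i => hB.elim fun j => comp_congr i j

/-- The tensor product of isomorphism classes. -/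
noncomputable def quotTensor : Quotient (setoid X Y) → Quotient (setoid X' Y') →
    Quotient (setoid (X ++ X') (Y ++ Y')) :=
  Quotient.map₂ tensor fun _ _ hA _ _ hB => hA.elim fun i => hB.elim fun j => tensor_congr i j

/-- The graph of parallel edges. -/
noncomputable def id (X : Word S) : Net S X X := wire (Equiv.refl ℕ) fun _ => rfl

theorem wire_joined {σ : Equiv.Perm ℕ} {h : ∀ i, Y[σ i]? = X[i]?} {p q : Port Empty} :
    (wire σ h).Joined p q ↔ WireJoined X σ p q :=
  Graph.wire_joined (h := h)

theorem id_joined {p q : Port Empty} : (id X).Joined p q ↔ WireJoined X _root_.id p q :=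
  wire_joined (h := fun _ => rfl)

theorem not_joined_out_out (A : Net S X Y) (i j : ℕ) : ¬ A.Joined (.out i) (.out j) :=
  fun h => A.ne_out_of_joined h i rfl

theorem iso_id_comp (A : Net S X Y) : Nonempty (Iso ((id X).comp A).toGraph A.toGraph) :=
  Iso.of_joined (Equiv.emptySum Empty A.Node) (by rintro (⟨⟨⟩⟩ | α); rfl) fun _ _ h =>
    WireJoined.id_comp (X := X) (fun _ _ h => h.symm)
      ((comp_joined.1 h).mono (fun _ _ h => id_joined.1 h) fun _ _ h => h)

theorem iso_comp_id (A : Net S X Y) : Nonempty (Iso A.toGraph (A.comp (id Y)).toGraph) :=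
  Iso.of_joined (Equiv.sumEmpty A.Node Empty).symm (fun _ => rfl) fun _ _ h =>
    comp_joined.2 <| (WireJoined.comp_id (fun _ _ h => h.symm) (fun _ _ h => h.within)
      A.not_joined_out_out h).mono (fun _ _ h => h) fun _ _ h => id_joined.2 h

theorem iso_assoc {W : Word S} (A : Net S W X) (B : Net S X Y) (C : Net S Y Z) :
    Nonempty (Iso ((A.comp B).comp C).toGraph (A.comp (B.comp C)).toGraph) :=
  Iso.of_joined (Equiv.sumAssoc A.Node B.Node C.Node) (by rintro ((α | α) | α) <;> rfl)
    fun _ _ h => comp_joined.2 <|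
      (CompJoined.assoc (fun _ _ h => h.symm) ((comp_joined.1 h).mono
        (fun _ _ h => comp_joined.1 h) fun _ _ h => h)).mono (fun _ _ h => h)
        fun _ _ h => comp_joined.2 h

end Net

/-- Words and isomorphism classes of realisable graphs. -/
noncomputable instance : Category.{max 1 u v, u} (Word S) where
  Hom X Y := Quotient (Net.setoid X Y)
  id X := Quotient.mk _ (Net.id X)
  comp f g := Net.quotComp f g
  id_comp := by
    rintro X Y ⟨A⟩
    exact Quotient.sound A.iso_id_comp
  comp_id := by
    rintro X Y ⟨A⟩
    exact (Quotient.sound A.iso_comp_id).symm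
  assoc := by
    rintro W X Y Z ⟨A⟩ ⟨B⟩ ⟨C⟩
    exact Quotient.sound (A.iso_assoc B C)

namespace Net

variable {X Y Z X' Y' Z' : Word S}

/-- The isomorphism class of a realisable graph, as a morphism. -/
noncomputable def hom (A : Net S X Y) : X ⟶ Y := Quotient.mk (setoid X Y) A

theorem hom_surjective : Function.Surjective (hom (X := X) (Y := Y)) := Quotient.mk_surjective

theorem hom_eq_iff {A B : Net S X Y} :
    A.hom = B.hom ↔ Nonempty (Iso A.toGraph B.toGraph) := Quotient.eq

theorem hom_eq {A B : Net S X Y} (φ : A.Node ≃ B.Node) (hl : ∀ α, B.label (φ α) = A.label α)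
    (hJ : ∀ p q, A.Joined p q → B.Joined (p.map φ) (q.map φ)) : A.hom = B.hom :=
  hom_eq_iff.2 (Iso.of_joined φ hl hJ)

/-- The identifications of equal words are straight edges. -/
theorem hom_comp_eqToHom {A : Net S X Y} {B : Net S X' Y'} (hX : X = X') (hY : Y = Y')
    (φ : A.Node ≃ B.Node) (hl : ∀ α, B.label (φ α) = A.label α)
    (hJ : ∀ p q, A.Joined p q → B.Joined (p.map φ) (q.map φ)) :
    A.hom ≫ eqToHom hY = eqToHom hX ≫ B.hom := by
  subst hX hY
  simpa using hom_eq φ hl hJ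

end Net

/-- The morphism `f` has no internal nodes, and joins the `i`-th input to the `σ i`-th output. -/
def IsWire {X Y : Word S} (σ : ℕ → ℕ) (f : X ⟶ Y) : Prop :=
  ∃ A : Net S X Y, A.hom = f ∧ IsEmpty A.Node ∧ ∀ i < X.length, A.Joined (.inp i) (.out (σ i))

namespace IsWire

variable {X Y Z X' Y' : Word S} {σ τ : ℕ → ℕ} {f g : X ⟶ Y}

theorem congr (hf : IsWire σ f) (h : ∀ i < X.length, σ i = τ i) : IsWire τ f := by
  obtain ⟨A, hA, h1, h2⟩ := hf
  exact ⟨A, hA, h1, fun i hi => h i hi ▸ h2 i hi⟩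

/-- Each output is joined to an input, as there are no cups. -/
theorem joined_of_joined {A : Net S X Y} (hA : IsEmpty A.Node)
    (h : ∀ i < X.length, A.Joined (.inp i) (.out (σ i))) {p q : Port A.Node} (hJ : A.Joined p q) :
    ∃ i < X.length, (p = .inp i ∧ q = .out (σ i)) ∨ p = .out (σ i) ∧ q = .inp i := by
  rcases p with i | j | ⟨α, i⟩ | ⟨α, i⟩
  · have hi : i < X.length := hJ.within
    exact ⟨i, hi, .inl ⟨rfl, hJ.unique (h i hi)⟩⟩
  · rcases q with i | k | ⟨α, i⟩ | ⟨α, i⟩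
    · have hi : i < X.length := hJ.symm.within
      exact ⟨i, hi, .inr ⟨hJ.symm.unique (h i hi), rfl⟩⟩
    · exact absurd hJ (A.not_joined_out_out _ _)
    · exact hA.elim α
    · exact hA.elim α
  · exact hA.elim α
  · exact hA.elim α

/-- A morphism without internal nodes is determined by its permutation. Coherence laws between
structural morphisms thereby become identities between permutations. -/
theorem ext (hf : IsWire σ f) (hg : IsWire τ g) (h : ∀ i < X.length, σ i = τ i) : f = g := by
  obtain ⟨A, rfl, hA, hA'⟩ := hf
  obtain ⟨B, rfl, hB, hB'⟩ := hg
  refine Net.hom_eq (Equiv.equivOfIsEmpty _ _) (fun α => hA.elim α) fun p q hJ => ?_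
  obtain ⟨i, hi, ⟨rfl, rfl⟩ | ⟨rfl, rfl⟩⟩ := joined_of_joined hA hA' hJ
  · simpa [h i hi] using hB' i hi
  · simpa [h i hi] using (hB' i hi).symm

theorem of_wire (σ : Equiv.Perm ℕ) (h : ∀ i, Y[σ i]? = X[i]?) : IsWire σ (Net.wire σ h).hom :=
  ⟨_, rfl, inferInstanceAs (IsEmpty Empty), fun _ hi => Net.wire_joined.2 (.up hi)⟩

theorem id (X : Word S) : IsWire id (𝟙 X) :=
  ⟨Net.id X, rfl, inferInstanceAs (IsEmpty Empty), fun _ hi => Net.id_joined.2 (.up hi)⟩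

theorem eqToHom (h : X = Y) : IsWire _root_.id (eqToHom h) := by
  subst h
  exact id X

theorem comp {g : Y ⟶ Z} (hf : IsWire σ f) (hg : IsWire τ g) : IsWire (τ ∘ σ) (f ≫ g) := by
  obtain ⟨A, rfl, hA, hA'⟩ := hf
  obtain ⟨B, rfl, hB, hB'⟩ := hg
  refine ⟨A.comp B, rfl, inferInstanceAs (IsEmpty (A.Node ⊕ B.Node)), fun i hi => ?_⟩
  exact Net.comp_joined.2 (.through (hA' i hi) (hB' _ (hA' i hi).symm.within))

end IsWire

namespace Net

variable {X Y X' Y' X'' Y'' : Word S}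

theorem hom_id_tensor_id : ((id X).tensor (id Y)).hom = 𝟙 (X ++ Y : Word S) := by
  refine IsWire.ext (σ := _root_.id) (τ := _root_.id)
    ⟨_, rfl, inferInstanceAs (IsEmpty (Empty ⊕ Empty)), fun i hi => tensor_joined.2 ?_⟩
    (IsWire.id _) fun _ _ => rfl
  by_cases h : i < X.length
  · exact .left_through (id_joined.2 (.up h))
  · obtain ⟨k, rfl⟩ := Nat.exists_eq_add_of_le (not_lt.1 h)
    rw [List.length_append] at hi
    exact .right_through (id_joined.2 (.up (by omega)))

end Net

/-- Concatenation of words and graphs side by side. The associator and the unitors identify equal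
words. -/
noncomputable instance : MonoidalCategoryStruct (Word S) where
  tensorObj X Y := X ++ Y
  tensorHom f g := Net.quotTensor f g
  whiskerLeft X _ _ f := Net.quotTensor (𝟙 X) f
  whiskerRight f Y := Net.quotTensor f (𝟙 Y)
  tensorUnit := []
  associator X Y Z := eqToIso (List.append_assoc X Y Z)
  leftUnitor X := eqToIso (List.nil_append X)
  rightUnitor X := eqToIso (List.append_nil X)

theorem length_tensor (X Y : Word S) : (X ⊗ Y).length = X.length + Y.length := List.length_append

namespace IsWire

variable {X Y Z X' Y' : Word S} {σ τ : ℕ → ℕ} {f : X ⟶ Y}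

theorem tensor {g : X' ⟶ Y'} (hf : IsWire σ f) (hg : IsWire τ g) :
    IsWire (fun i => if i < X.length then σ i else Y.length + τ (i - X.length)) (f ⊗ₘ g) := by
  obtain ⟨A, rfl, hA, hA'⟩ := hf
  obtain ⟨B, rfl, hB, hB'⟩ := hg
  refine ⟨A.tensor B, rfl, inferInstanceAs (IsEmpty (A.Node ⊕ B.Node)), fun i hi => ?_⟩
  refine Net.tensor_joined.2 ?_
  by_cases h : i < X.length
  · simp only [if_pos h]
    exact .left_through (hA' i h)
  · obtain ⟨k, rfl⟩ := Nat.exists_eq_add_of_le (not_lt.1 h)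
    rw [length_tensor] at hi
    simp only [if_neg h, Nat.add_sub_cancel_left]
    exact .right_through (hB' k (by omega))

theorem associator_hom (X Y Z : Word S) : IsWire _root_.id (α_ X Y Z).hom :=
  eqToHom (List.append_assoc X Y Z)

theorem associator_inv (X Y Z : Word S) : IsWire _root_.id (α_ X Y Z).inv :=
  eqToHom (List.append_assoc X Y Z).symm

theorem leftUnitor_hom (X : Word S) : IsWire _root_.id (λ_ X).hom :=
  eqToHom (List.nil_append X)

theorem leftUnitor_inv (X : Word S) : IsWire _root_.id (λ_ X).inv :=
  eqToHom (List.nil_append X).symm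

theorem rightUnitor_hom (X : Word S) : IsWire _root_.id (ρ_ X).hom :=
  eqToHom (List.append_nil X)

theorem rightUnitor_inv (X : Word S) : IsWire _root_.id (ρ_ X).inv :=
  eqToHom (List.append_nil X).symm

theorem whiskerRight (hf : IsWire σ f) (Z : Word S) :
    IsWire (fun i => if i < X.length then σ i else Y.length + (i - X.length)) (f ▷ Z) :=
  hf.tensor (id Z)

theorem whiskerLeft (hf : IsWire σ f) (Z : Word S) :
    IsWire (fun i => if i < Z.length then i else Z.length + σ (i - Z.length)) (Z ◁ f) :=
  (id Z).tensor hf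

end IsWire

/-- The block crossing. -/
noncomputable def Net.symmetry (X Y : Word S) : Net S (X ++ Y) (Y ++ X) :=
  wire (blockSwap X.length Y.length) (getElem?_blockSwap X Y)

noncomputable instance : MonoidalCategory (Word S) := .ofTensorHom
  (id_tensorHom_id := fun _ _ => Net.hom_id_tensor_id)
  (tensorHom_comp_tensorHom := by
    intro X₁ Y₁ Z₁ X₂ Y₂ Z₂ f₁ f₂ g₁ g₂
    obtain ⟨A, rfl⟩ := Net.hom_surjective f₁
    obtain ⟨B, rfl⟩ := Net.hom_surjective f₂
    obtain ⟨C, rfl⟩ := Net.hom_surjective g₁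
    obtain ⟨D, rfl⟩ := Net.hom_surjective g₂
    symm
    refine Net.hom_eq (A := (A.comp C).tensor (B.comp D)) (B := (A.tensor B).comp (C.tensor D))
      (Equiv.sumSumSumComm A.Node C.Node B.Node D.Node) (by rintro ((α | α) | (α | α)) <;> rfl)
      fun p q h => Net.comp_joined.2 ?_
    exact (TensorJoined.comp (l := Y₁.length) ((Net.tensor_joined.1 h).mono
      (fun _ _ h => Net.comp_joined.1 h)
      fun _ _ h => Net.comp_joined.1 h)).mono (fun _ _ h => Net.tensor_joined.2 h)
      fun _ _ h => Net.tensor_joined.2 h)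
  (associator_naturality := by
    intro X₁ X₂ X₃ Y₁ Y₂ Y₃ f g h
    obtain ⟨A, rfl⟩ := Net.hom_surjective f
    obtain ⟨B, rfl⟩ := Net.hom_surjective g
    obtain ⟨C, rfl⟩ := Net.hom_surjective h
    refine Net.hom_comp_eqToHom (A := (A.tensor B).tensor C) (B := A.tensor (B.tensor C))
      (List.append_assoc _ _ _) (List.append_assoc _ _ _)
      (Equiv.sumAssoc A.Node B.Node C.Node) (by rintro ((α | α) | α) <;> rfl)
      fun p q h => Net.tensor_joined.2 ?_
    have h' := Net.tensor_joined.1 h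
    rw [List.length_append, List.length_append] at h'
    exact (TensorJoined.assoc (h'.mono (fun _ _ h => Net.tensor_joined.1 h) fun _ _ h => h)).mono
      (fun _ _ h => h) fun _ _ h => Net.tensor_joined.2 h)
  (leftUnitor_naturality := by
    intro X Y f
    obtain ⟨A, rfl⟩ := Net.hom_surjective f
    refine Net.hom_comp_eqToHom (A := (Net.id []).tensor A) (B := A) (List.nil_append _)
      (List.nil_append _)
      (Equiv.emptySum Empty A.Node) (by rintro (⟨⟨⟩⟩ | α); rfl) fun p q h => ?_
    exact TensorJoined.left_unit (S := S)
      ((Net.tensor_joined.1 h).mono (fun _ _ h => Net.id_joined.1 h) fun _ _ h => h))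
  (rightUnitor_naturality := by
    intro X Y f
    obtain ⟨A, rfl⟩ := Net.hom_surjective f
    refine Net.hom_comp_eqToHom (A := A.tensor (Net.id [])) (B := A) (List.append_nil _)
      (List.append_nil _)
      (Equiv.sumEmpty A.Node Empty) (by rintro (α | ⟨⟨⟩⟩); rfl) fun p q h => ?_
    exact TensorJoined.right_unit (S := S)
      ((Net.tensor_joined.1 h).mono (fun _ _ h => h) fun _ _ h => Net.id_joined.1 h))
  (pentagon := by
    intro W X Y Z
    refine IsWire.ext (((IsWire.associator_hom _ _ _).tensor (.id _)).comp
      ((IsWire.associator_hom _ _ _).comp ((IsWire.id _).tensor (.associator_hom _ _ _))))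
      ((IsWire.associator_hom _ _ _).comp (.associator_hom _ _ _)) fun i hi => ?_
    simp only [length_tensor, Function.comp_apply, id_eq] at hi ⊢
    split_ifs <;> omega)
  (triangle := by
    intro X Y
    refine IsWire.ext
      ((IsWire.associator_hom _ _ _).comp ((IsWire.id _).tensor (.leftUnitor_hom _)))
      ((IsWire.rightUnitor_hom _).tensor (.id _)) fun i hi => ?_
    have : (𝟙_ (Word S)).length = 0 := rfl
    simp only [length_tensor, Function.comp_apply, id_eq] at hi ⊢
    split_ifs <;> omega)

theorem IsWire.symmetry (X Y : Word S) :
    IsWire (blockSwap X.length Y.length) ((Net.symmetry X Y).hom : X ⊗ Y ⟶ Y ⊗ X) :=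
  of_wire _ _

theorem Net.symmetry_symmetry (X Y : Word S) :
    ((symmetry X Y).hom : X ⊗ Y ⟶ Y ⊗ X) ≫ (symmetry Y X).hom = 𝟙 (X ⊗ Y) :=
  ((IsWire.symmetry X Y).comp (.symmetry Y X)).ext (.id _) fun i _ => blockSwap_blockSwap _ _ i

/-- Block crossings can be moved past a pair of graphs side by side, which exchanges the graphs:
before the pair they relabel the inputs, after it they relabel the outputs. -/
theorem TensorJoined.symmetry_naturality {N₁ N₂ : Type} {J₁ : Port N₁ → Port N₁ → Prop}
    {J₂ : Port N₂ → Port N₂ → Prop} {m n m' n' : ℕ} {V W : Word S} (hW : W.length = n + n')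
    (s₁ : ∀ p q, J₁ p q → J₁ q p) (s₂ : ∀ p q, J₂ p q → J₂ q p)
    (w₁ : ∀ p q, J₁ p q → p.Within m n) (w₂ : ∀ p q, J₂ p q → p.Within m' n')
    (o₁ : ∀ i j, ¬ J₁ (.out i) (.out j)) (o₂ : ∀ i j, ¬ J₂ (.out i) (.out j))
    {p q : Port (Empty ⊕ (N₂ ⊕ N₁))}
    (h : CompJoined (WireJoined V (blockSwap m m')) (TensorJoined m' n' J₂ J₁) p q) :
    CompJoined (TensorJoined m n J₁ J₂) (WireJoined W (blockSwap n n'))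
      (p.map (((Equiv.emptySum Empty (N₂ ⊕ N₁)).trans (Equiv.sumComm N₂ N₁)).trans
        (Equiv.sumEmpty (N₁ ⊕ N₂) Empty).symm))
      (q.map (((Equiv.emptySum Empty (N₂ ⊕ N₁)).trans (Equiv.sumComm N₂ N₁)).trans
        (Equiv.sumEmpty (N₁ ⊕ N₂) Empty).symm)) := by
  have h₁ := TensorJoined.swap (fun _ _ h => ⟨w₂ _ _ h, w₂ _ _ (s₂ _ _ h)⟩)
    (fun _ _ h => ⟨w₁ _ _ h, w₁ _ _ (s₁ _ _ h)⟩)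
    (WireJoined.comp (fun _ _ h => h.symm s₂ s₁) h)
  have h₂ := WireJoined.comp_right (J := TensorJoined m n J₁ J₂) (Y := W) (m := m + m')
    (σ := blockSwap n n') (fun _ _ h => h.symm s₁ s₂)
    (by
      rw [hW]
      rintro _ _ (@⟨p, q, h⟩ | @⟨p, q, h⟩)
      · have := w₁ _ _ h
        cases p <;> simp_all [Port.Within] <;> omega
      · have := w₂ _ _ h
        cases p <;> simp_all [Port.Within])
    (by
      intro i j h
      obtain ⟨p, h, hp⟩ | ⟨p, k, h, -, hp⟩ := h.of_out
      · cases p <;> simp at hp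
        exact o₁ _ _ h
      · cases p <;> simp at hp
        exact o₂ _ _ h) h₁
  have e (p : Port (Empty ⊕ (N₂ ⊕ N₁))) : (((p.relabel (Equiv.emptySum Empty _)
      (blockSwap m m') id).relabel (Equiv.sumComm N₂ N₁) (blockSwap m' m)
      (blockSwap n' n)).relabel (Sum.inl : _ → _ ⊕ Empty) id (blockSwap n n')) =
      p.map (((Equiv.emptySum Empty (N₂ ⊕ N₁)).trans (Equiv.sumComm N₂ N₁)).trans
        (Equiv.sumEmpty (N₁ ⊕ N₂) Empty).symm) := by
    cases p <;> simp
  rwa [e, e] at h₂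

theorem Net.hom_tensor_symmetry {X Y X' Y' : Word S} (A : Net S X Y) (B : Net S X' Y') :
    (A.hom ⊗ₘ B.hom) ≫ (symmetry Y Y').hom = (symmetry X X').hom ≫ (B.hom ⊗ₘ A.hom) := by
  symm
  refine Net.hom_eq (A := (symmetry X X').comp (B.tensor A))
    (B := (A.tensor B).comp (symmetry Y Y'))
    (((Equiv.emptySum Empty (B.Node ⊕ A.Node)).trans (Equiv.sumComm B.Node A.Node)).trans
      (Equiv.sumEmpty (A.Node ⊕ B.Node) Empty).symm) (by rintro (⟨⟨⟩⟩ | (α | α)) <;> rfl)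
    fun p q h => comp_joined.2 ?_
  exact (TensorJoined.symmetry_naturality (W := Y ++ Y') List.length_append (fun _ _ h => h.symm)
    (fun _ _ h => h.symm) (fun _ _ h => h.within) (fun _ _ h => h.within) A.not_joined_out_out
    B.not_joined_out_out ((comp_joined.1 h).mono (fun _ _ h => wire_joined.1 h)
      fun _ _ h => tensor_joined.1 h)).mono (fun _ _ h => tensor_joined.2 h)
    fun _ _ h => wire_joined.2 h

noncomputable instance : SymmetricCategory (Word S) where
  braiding X Y := ⟨(Net.symmetry X Y).hom, (Net.symmetry Y X).hom, Net.symmetry_symmetry X Y,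
    Net.symmetry_symmetry Y X⟩
  braiding_naturality_right X Y Z f := by
    obtain ⟨A, rfl⟩ := Net.hom_surjective f
    exact Net.hom_tensor_symmetry (Net.id X) A
  braiding_naturality_left f Z := by
    obtain ⟨A, rfl⟩ := Net.hom_surjective f
    exact Net.hom_tensor_symmetry A (Net.id Z)
  hexagon_forward X Y Z := by
    refine IsWire.ext ((IsWire.associator_hom _ _ _).comp ((IsWire.symmetry _ _).comp
      (.associator_hom _ _ _))) (((IsWire.symmetry _ _).whiskerRight _).comp
      ((IsWire.associator_hom _ _ _).comp ((IsWire.symmetry _ _).whiskerLeft _))) fun i hi => ?_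
    simp only [length_tensor, Function.comp_apply, id_eq, blockSwap_apply,
      List.length_append] at hi ⊢
    split_ifs <;> omega
  hexagon_reverse X Y Z := by
    refine IsWire.ext ((IsWire.associator_inv _ _ _).comp ((IsWire.symmetry _ _).comp
      (.associator_inv _ _ _))) (((IsWire.symmetry _ _).whiskerLeft _).comp
      ((IsWire.associator_inv _ _ _).comp ((IsWire.symmetry _ _).whiskerRight _))) fun i hi => ?_
    simp only [length_tensor, Function.comp_apply, id_eq, blockSwap_apply,
      List.length_append] at hi ⊢
    split_ifs <;> omega
  symmetry := Net.symmetry_symmetry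

theorem IsWire.braiding (X Y : Word S) : IsWire (blockSwap X.length Y.length) (β_ X Y).hom :=
  symmetry X Y

/-! ### Dualisable morphisms and counits -/

theorem Graph.IsDualisable.not_joined_inp_inp {X Y : Word S} {A : Graph S X Y}
    (hA : A.IsDualisable) (i j : ℕ) : ¬ A.Joined (.inp i) (.inp j) :=
  fun h => hA.2 _ _ h rfl

namespace Net

variable {X Y Z X' Y' Z' : Word S}

theorem reflect_joined {A : Net S X Y} {hA : A.IsDualisable} {p q : Port A.Node} :
    (A.reflect hA).Joined p q ↔ ReflectJoined A.Joined p q :=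
  Graph.reflect_joined (hA := hA)

theorem isDualisable_reflect {A : Net S X Y} (hA : A.IsDualisable) :
    (A.reflect hA).IsDualisable :=
  Graph.isDualisable_reflect hA

theorem hom_eq_eqToHom {A : Net S X Y} {B : Net S X' Y'} (hX : X = X') (hY : Y' = Y)
    (φ : A.Node ≃ B.Node) (hl : ∀ α, B.label (φ α) = A.label α)
    (hJ : ∀ p q, A.Joined p q → B.Joined (p.map φ) (q.map φ)) :
    A.hom = eqToHom hX ≫ B.hom ≫ eqToHom hY := by
  subst hX hY
  simpa using hom_eq φ hl hJ

/-- The mirror image depends only on the isomorphism class; an isomorphism may change parities, and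
then it also changes them after reflection. -/
theorem reflect_congr {A B : Net S X Y} (hA : A.IsDualisable) (hB : B.IsDualisable)
    (h : A.hom = B.hom) : (A.reflect hA).hom = (B.reflect hB).hom := by
  obtain ⟨i⟩ := hom_eq_iff.1 h
  refine hom_eq (A := A.reflect hA) (B := B.reflect hB) i.node i.label_node fun p q h =>
    reflect_joined.2 ?_
  have e (p : Port A.Node) : (p.reflect _root_.id).map i.node =
      (p.map i.node).reflect _root_.id := by
    cases p <;> simp
  exact (congrArg₂ B.Joined (e p) (e q)).mp (i.joined (reflect_joined.1 h))

end Net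

/-- The morphism `f` is the class of a graph with dualisable labels and without caps. -/
def IsDualisable {X Y : Word S} (f : X ⟶ Y) : Prop := ∃ A : Net S X Y, A.hom = f ∧ A.IsDualisable

/-- The class of the mirror image of a dualisable graph. -/
noncomputable def dualHom {X Y : Word S} (f : X ⟶ Y) (hf : IsDualisable f) :
    Word.dual Y ⟶ Word.dual X :=
  (hf.choose.reflect hf.choose_spec.2).hom

theorem Net.dualHom_hom {X Y : Word S} (A : Net S X Y) (hA : A.IsDualisable)
    (h : IsDualisable A.hom) : dualHom A.hom h = (A.reflect hA).hom :=
  Net.reflect_congr _ _ h.choose_spec.1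

section Dual

variable {X Y Z X' Y' : Word S}

theorem IsDualisable.comp {f : X ⟶ Y} {g : Y ⟶ Z} (hf : IsDualisable f) (hg : IsDualisable g) :
    IsDualisable (f ≫ g) := by
  obtain ⟨A, rfl, hA⟩ := hf
  obtain ⟨B, rfl, hB⟩ := hg
  exact ⟨A.comp B, rfl, Net.isDualisable_comp hA hB⟩

theorem IsDualisable.tensor {f : X ⟶ Y} {g : X' ⟶ Y'} (hf : IsDualisable f)
    (hg : IsDualisable g) : IsDualisable (f ⊗ₘ g) := by
  obtain ⟨A, rfl, hA⟩ := hf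
  obtain ⟨B, rfl, hB⟩ := hg
  exact ⟨A.tensor B, rfl, Net.isDualisable_tensor hA hB⟩

theorem isDualisable_dualHom (f : X ⟶ Y) (hf : IsDualisable f) : IsDualisable (dualHom f hf) :=
  ⟨_, rfl, Net.isDualisable_reflect hf.choose_spec.2⟩

theorem dualHom_comp (f : X ⟶ Y) (g : Y ⟶ Z) (hf : IsDualisable f) (hg : IsDualisable g) :
    dualHom (f ≫ g) (hf.comp hg) = dualHom g hg ≫ dualHom f hf := by
  obtain ⟨A, rfl, hA⟩ := id hf
  obtain ⟨B, rfl, hB⟩ := id hg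
  rw [A.dualHom_hom hA, B.dualHom_hom hB]
  refine ((A.comp B).dualHom_hom (Net.isDualisable_comp hA hB) _).trans
    (Net.hom_eq (B := (B.reflect hB).comp (A.reflect hA)) (Equiv.sumComm A.Node B.Node)
      (by rintro (α | α) <;> rfl) fun p q h => Net.comp_joined.2 ?_)
  exact (ReflectJoined.comp (p := p) (q := q) (fun _ _ h => h.symm) (fun _ _ h => h.symm)
    hB.not_joined_inp_inp (Net.comp_joined.1 (Net.reflect_joined.1 h))).mono
    (fun _ _ h => Net.reflect_joined.2 h) fun _ _ h => Net.reflect_joined.2 h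

theorem dualHom_dualHom (f : X ⟶ Y) (hf : IsDualisable f) :
    dualHom (dualHom f hf) (isDualisable_dualHom f hf) =
      eqToHom (Word.dual_dual X) ≫ f ≫ eqToHom (Word.dual_dual Y).symm := by
  obtain ⟨A, rfl, hA⟩ := id hf
  have h := (A.reflect hA).dualHom_hom (Net.isDualisable_reflect hA)
    ⟨_, rfl, Net.isDualisable_reflect hA⟩
  simp only [A.dualHom_hom hA, h]
  refine Net.hom_eq_eqToHom _ _ (Equiv.refl A.Node) (fun _ => rfl) fun p q h => ?_
  have h' := Net.reflect_joined.1 (Net.reflect_joined.1 h)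
  have e (p : Port A.Node) : (p.reflect id).reflect id = p.map (Equiv.refl A.Node) := by
    cases p <;> simp
  exact e p ▸ e q ▸ h'

theorem dualHom_tensor (f : X ⟶ Y) (g : X' ⟶ Y') (hf : IsDualisable f) (hg : IsDualisable g) :
    dualHom (f ⊗ₘ g) (hf.tensor hg) = eqToHom (Word.dual_append Y Y') ≫
      (dualHom f hf ⊗ₘ dualHom g hg) ≫ eqToHom (Word.dual_append X X').symm := by
  obtain ⟨A, rfl, hA⟩ := id hf
  obtain ⟨B, rfl, hB⟩ := id hg
  rw [A.dualHom_hom hA, B.dualHom_hom hB]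
  refine ((A.tensor B).dualHom_hom (Net.isDualisable_tensor hA hB) _).trans
    (Net.hom_eq_eqToHom (B := (A.reflect hA).tensor (B.reflect hB)) _ _
      (Equiv.refl (A.Node ⊕ B.Node)) (by rintro (α | α) <;> rfl) fun p q h =>
        Net.tensor_joined.2 ?_)
  have h' := (ReflectJoined.tensor (p := p) (q := q) (Net.tensor_joined.1 (Net.reflect_joined.1 h)))
  have e (p : Port (A.Node ⊕ B.Node)) : p = p.map (Equiv.refl (A.Node ⊕ B.Node)) :=
    (Port.map_id p).symm
  rw [e p, e q] at h'
  rw [Word.length_dual, Word.length_dual]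
  exact h'.mono (fun _ _ h => Net.reflect_joined.2 h) fun _ _ h => Net.reflect_joined.2 h

end Dual

namespace IsWire

variable {X Y Z X' Y' : Word S} {σ : ℕ → ℕ} {f : X ⟶ Y}

theorem exists_isDualisable (hf : IsWire σ f) : ∃ A : Net S X Y, A.hom = f ∧ A.IsDualisable ∧
    IsEmpty A.Node ∧ ∀ i < X.length, A.Joined (.inp i) (.out (σ i)) := by
  obtain ⟨A, rfl, hA, hA'⟩ := hf
  refine ⟨A, rfl, ⟨fun α => hA.elim α, fun p q h => ?_⟩, hA, hA'⟩
  obtain ⟨i, -, ⟨rfl, rfl⟩ | ⟨rfl, rfl⟩⟩ := joined_of_joined hA hA' h <;> simp [Port.late]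

theorem isDualisable (hf : IsWire σ f) : IsDualisable f := by
  obtain ⟨A, h, hA, -⟩ := hf.exists_isDualisable
  exact ⟨A, h, hA⟩

/-- The mirror image of a permutation is the inverse permutation. -/
theorem dualHom {τ : ℕ → ℕ} (hf : IsWire σ f) (hτ : ∀ j < Y.length, τ j < X.length ∧ σ (τ j) = j)
    (h : IsDualisable f) : IsWire τ (dualHom f h) := by
  obtain ⟨A, rfl, hA, hA', hJ⟩ := hf.exists_isDualisable
  rw [A.dualHom_hom hA]
  refine ⟨_, rfl, hA', fun j hj => Net.reflect_joined.2 ?_⟩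
  rw [Word.length_dual] at hj
  have := (hJ _ (hτ j hj).1).symm
  rw [(hτ j hj).2] at this
  exact this

/-- The interchange of the two middle factors. -/
theorem tensorμ (X₁ X₂ Y₁ Y₂ : Word S) : IsWire (fun i => if i < X₁.length then i else
    X₁.length + if i - X₁.length < X₂.length + Y₁.length then
      blockSwap X₂.length Y₁.length (i - X₁.length) else i - X₁.length)
      (tensorμ X₁ X₂ Y₁ Y₂) := by
  refine congr ((associator_hom _ _ _).comp (((associator_inv _ _ _).whiskerLeft _).comp
    ((((braiding _ _).whiskerRight _).whiskerLeft _).comp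
    (((associator_hom _ _ _).whiskerLeft _).comp (associator_inv _ _ _))))) fun i hi => ?_
  simp only [length_tensor, Function.comp_apply, id_eq, blockSwap_apply] at hi ⊢
  split_ifs <;> omega

end IsWire

/-- The morphism `f` has no internal nodes, and joins the `i`-th input to the `κ i`-th input. -/
def IsCap {X Y : Word S} (κ : ℕ → ℕ) (f : X ⟶ Y) : Prop :=
  ∃ A : Net S X Y, A.hom = f ∧ IsEmpty A.Node ∧ ∀ i < X.length, A.Joined (.inp i) (.inp (κ i))

namespace IsCap

variable {X Y Z X' Y' : Word S} {σ κ κ' : ℕ → ℕ} {f g : X ⟶ Y}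

theorem ext (hf : IsCap κ f) (hg : IsCap κ' g) (h : ∀ i < X.length, κ i = κ' i) : f = g := by
  obtain ⟨A, rfl, hA, hA'⟩ := hf
  obtain ⟨B, rfl, hB, hB'⟩ := hg
  refine Net.hom_eq (Equiv.equivOfIsEmpty _ _) (fun α => hA.elim α) fun p q hJ => ?_
  rcases p with i | j | ⟨α, i⟩ | ⟨α, i⟩
  · have hi : i < X.length := hJ.within
    obtain rfl := hJ.unique (hA' i hi)
    simpa [h i hi] using hB' i hi
  · rcases q with i | k | ⟨α, i⟩ | ⟨α, i⟩
    · have hi : i < X.length := hJ.symm.within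
      simpa using hJ.symm.unique (hA' i hi)
    · exact absurd hJ (A.not_joined_out_out _ _)
    · exact hA.elim α
    · exact hA.elim α
  · exact hA.elim α
  · exact hA.elim α

/-- Caps preceded by a permutation join inputs that are permuted to inputs joined by caps. -/
theorem wire_comp {g : Y ⟶ Z} (hf : IsWire σ f) (hg : IsCap κ g)
    (h : ∀ i < X.length, κ' i < X.length ∧ σ (κ' i) = κ (σ i)) : IsCap κ' (f ≫ g) := by
  obtain ⟨A, rfl, hA, hA'⟩ := hf
  obtain ⟨B, rfl, hB, hB'⟩ := hg
  refine ⟨A.comp B, rfl, inferInstanceAs (IsEmpty (A.Node ⊕ B.Node)), fun i hi => ?_⟩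
  have h1 := hA' _ (h i hi).1
  rw [(h i hi).2] at h1
  have h2 := CompJoined.cap (hA' i hi) (hB' _ (hA' i hi).symm.within) h1 (by simp) (by simp)
  rw [Port.map_inp, Port.map_inp, zero_add, zero_add] at h2
  exact Net.comp_joined.2 h2

theorem comp_wire {g : Y ⟶ Z} (hf : IsCap κ f) (hg : IsWire σ g) : IsCap κ (f ≫ g) := by
  obtain ⟨A, rfl, hA, hA'⟩ := hf
  obtain ⟨B, rfl, hB, hB'⟩ := hg
  refine ⟨A.comp B, rfl, inferInstanceAs (IsEmpty (A.Node ⊕ B.Node)), fun i hi => ?_⟩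
  have h2 := CompJoined.left (K := B.Joined) (hA' i hi) (by simp) (by simp)
  rw [Port.map_inp, Port.map_inp, zero_add, zero_add] at h2
  exact Net.comp_joined.2 h2

theorem tensor {g : X' ⟶ Y'} (hf : IsCap κ f) (hg : IsCap κ' g) :
    IsCap (fun i => if i < X.length then κ i else X.length + κ' (i - X.length)) (f ⊗ₘ g) := by
  obtain ⟨A, rfl, hA, hA'⟩ := hf
  obtain ⟨B, rfl, hB, hB'⟩ := hg
  refine ⟨A.tensor B, rfl, inferInstanceAs (IsEmpty (A.Node ⊕ B.Node)), fun i hi => ?_⟩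
  refine Net.tensor_joined.2 ?_
  by_cases h : i < X.length
  · have h2 := TensorJoined.left (m := X.length) (n := Y.length) (K := B.Joined) (hA' i h)
    rw [Port.map_inp, Port.map_inp, zero_add, zero_add] at h2
    simp only [if_pos h]
    exact h2
  · obtain ⟨k, rfl⟩ := Nat.exists_eq_add_of_le (not_lt.1 h)
    rw [length_tensor] at hi
    have h2 := TensorJoined.right (m := X.length) (n := Y.length) (J := A.Joined)
      (hB' k (by omega))
    simp only [if_neg h, Nat.add_sub_cancel_left]
    exact h2

theorem caps (X : Word S) : IsCap (fun i => if i < X.length then X.length + i else i - X.length)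
    ((Net.caps X).hom : X ⊗ Word.dual X ⟶ 𝟙_ (Word S)) := by
  refine ⟨_, rfl, inferInstanceAs (IsEmpty Empty), fun i hi => Graph.caps_joined.2 ?_⟩
  by_cases h : i < X.length
  · simp only [if_pos h]
    exact .left h
  · obtain ⟨k, rfl⟩ := Nat.exists_eq_add_of_le (not_lt.1 h)
    rw [List.length_append, Word.length_dual] at hi
    simp only [if_neg h, Nat.add_sub_cancel_left]
    exact .right (by omega)

end IsCap

/-- The nodes of `f` on the left of the caps become their mirror images on the right. -/
theorem extranatural_caps {X Y : Word S} (f : X ⟶ Y) (hf : IsDualisable f) :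
    (f ▷ Word.dual Y) ≫ ((Net.caps Y).hom : Y ⊗ Word.dual Y ⟶ 𝟙_ (Word S)) =
      (X ◁ dualHom f hf) ≫ (Net.caps X).hom := by
  obtain ⟨A, rfl, hA⟩ := id hf
  rw [A.dualHom_hom hA]
  refine Net.hom_eq (A := (A.tensor (Net.id (Word.dual Y))).comp (Net.caps Y))
    (B := ((Net.id X).tensor (A.reflect hA)).comp (Net.caps X))
    (Equiv.sumCongr (Equiv.sumComm A.Node Empty) (Equiv.refl Empty))
    (by rintro ((α | ⟨⟨⟩⟩) | ⟨⟨⟩⟩); rfl) fun p q h => Net.comp_joined.2 ?_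
  exact (CapsJoined.extranatural (p := p) (q := q) (fun _ _ h => h.symm) (fun _ _ h => h.within)
    hA.not_joined_inp_inp A.not_joined_out_out
    ((Net.comp_joined.1 h).mono (fun _ _ h => (Net.tensor_joined.1 h).mono (fun _ _ h => h)
      fun _ _ h => Net.id_joined.1 h) fun _ _ h => Graph.caps_joined.1 h)).mono
    (fun _ _ h => Net.tensor_joined.2 (h.mono (fun _ _ h => Net.id_joined.2 h)
      fun _ _ h => Net.reflect_joined.2 h)) fun _ _ h => Graph.caps_joined.2 h

/-- Duality is reflection, and counits are interleaved caps. -/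
noncomputable instance : TeleologicalCategory (Word S) where
  dualisable _ _ f := IsDualisable f
  id_mem X := (IsWire.id X).isDualisable
  comp_mem _ _ := .comp
  tensor_mem _ _ := .tensor
  associator_hom_mem X Y Z := (IsWire.associator_hom X Y Z).isDualisable
  associator_inv_mem X Y Z := (IsWire.associator_inv X Y Z).isDualisable
  leftUnitor_hom_mem X := (IsWire.leftUnitor_hom X).isDualisable
  leftUnitor_inv_mem X := (IsWire.leftUnitor_inv X).isDualisable
  rightUnitor_hom_mem X := (IsWire.rightUnitor_hom X).isDualisable
  rightUnitor_inv_mem X := (IsWire.rightUnitor_inv X).isDualisable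
  braiding_mem X Y := (IsWire.braiding X Y).isDualisable
  dual := Word.dual
  dualMap := dualHom
  dualMap_mem := isDualisable_dualHom
  dualMap_id X := ((IsWire.id X).dualHom (τ := id) (fun j hj => ⟨hj, rfl⟩) _).ext (.id _)
    fun _ _ => rfl
  dualMap_comp := dualHom_comp
  dual_dual := Word.dual_dual
  dualMap_dualMap := dualHom_dualHom
  dual_unit := rfl
  dual_tensor := Word.dual_append
  dualMap_tensor := dualHom_tensor
  dualMap_associator X Y Z := ((IsWire.associator_hom X Y Z).dualHom (τ := id)
    (fun j hj => ⟨by simpa only [length_tensor, add_assoc, id_eq] using hj, rfl⟩) _).ext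
    ((IsWire.eqToHom _).comp ((IsWire.associator_inv _ _ _).comp (IsWire.eqToHom _)))
    fun _ _ => rfl
  dualMap_leftUnitor X := ((IsWire.leftUnitor_hom X).dualHom (τ := id)
    (fun j hj => ⟨hj, rfl⟩) _).ext ((IsWire.leftUnitor_inv _).comp (IsWire.eqToHom _))
    fun _ _ => rfl
  dualMap_rightUnitor X := ((IsWire.rightUnitor_hom X).dualHom (τ := id)
    (fun j hj => ⟨by rw [length_tensor]; exact hj, rfl⟩) _).ext
    ((IsWire.rightUnitor_inv _).comp (IsWire.eqToHom _)) fun _ _ => rfl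
  dualMap_braiding X Y := by
    refine ((IsWire.braiding X Y).dualHom (τ := blockSwap Y.length X.length) (fun j hj => ?_) _).ext
      ((IsWire.eqToHom _).comp ((IsWire.braiding _ _).comp (IsWire.eqToHom _))) fun j hj => ?_
    · rw [length_tensor] at hj ⊢
      refine ⟨?_, blockSwap_blockSwap _ _ _⟩
      rw [blockSwap_apply]
      split_ifs <;> omega
    · simp
  counit X := (Net.caps X).hom
  extranatural := extranatural_caps
  counit_dual X := by
    refine (IsCap.caps (Word.dual X)).ext (IsCap.wire_comp (IsWire.eqToHom _)
      (IsCap.wire_comp (IsWire.braiding _ _) (IsCap.caps X)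
        (κ' := fun i => if i < X.length then X.length + i else i - X.length) fun i hi => ?_)
      (κ' := fun i => if i < X.length then X.length + i else i - X.length) fun i hi => ?_)
      fun i hi => ?_
    all_goals
      simp only [length_tensor, List.length_append, Word.length_dual, id_eq, blockSwap_apply,
        and_true] at hi ⊢
    · constructor <;> split_ifs <;> omega
    · split_ifs <;> omega
  counit_tensor X Y := by
    refine (IsCap.caps (X ⊗ Y)).ext (IsCap.wire_comp (IsWire.eqToHom _)
      (IsCap.wire_comp (IsWire.tensorμ _ _ _ _)
        (((IsCap.caps X).tensor (IsCap.caps Y)).comp_wire (.leftUnitor_hom _))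
        (κ' := fun i => if i < X.length + Y.length then X.length + Y.length + i
          else i - (X.length + Y.length)) fun i hi => ?_)
      (κ' := fun i => if i < X.length + Y.length then X.length + Y.length + i
        else i - (X.length + Y.length)) fun i hi => ?_)
      fun i hi => ?_
    all_goals
      simp only [length_tensor, List.length_append, Word.length_dual, id_eq, blockSwap_apply,
        and_true] at hi ⊢
    · constructor <;> split_ifs <;> omega
    · split_ifs <;> omega

/-! ### Ends of edges -/

/-- The edge `e` has an end at the port `p`. -/
def Graph.Ends {X Y : Word S} (A : Graph S X Y) (e : A.Edge) (p : Port A.Node) : Prop :=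
  A.source e = p ∨ A.target e = p

namespace Graph.Ends

variable {X Y : Word S} {A : Graph S X Y} {e e' : A.Edge} {p q : Port A.Node}

theorem unique (h : A.Ends e p) (h' : A.Ends e' p) : e = e' := by
  obtain rfl | rfl := h <;> obtain h' | h' := h'
  · exact source_injective h'.symm
  · exact absurd h'.symm (source_ne_target _ _)
  · exact absurd h' (source_ne_target _ _)
  · exact target_injective h'.symm

theorem exists_joined (h : A.Ends e p) : ∃ q, A.Joined p q ∧ A.Ends e q := by
  obtain rfl | rfl := h
  exacts [⟨_, joined_source_target e, .inr rfl⟩, ⟨_, (joined_source_target e).symm, .inl rfl⟩]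

theorem eq_or_joined (h : A.Ends e p) (h' : A.Ends e q) : p = q ∨ A.Joined p q := by
  obtain rfl | rfl := h <;> obtain rfl | rfl := h'
  exacts [.inl rfl, .inr (joined_source_target e), .inr (joined_source_target e).symm, .inl rfl]

theorem symbol (h : A.Ends e p) :
    (p.letter X Y A.label).map Letter.symbol = some (A.edgeLabel e) := by
  obtain rfl | rfl := h
  · rw [A.source_letter]; rfl
  · rw [A.target_letter]; rfl

theorem source_eq (h : A.Ends e p) {x : S.Obj} (hp : p.letter X Y A.label = some ⟨x, false⟩) :
    A.source e = p := by
  obtain h | rfl := h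
  · exact h
  · simp [A.target_letter] at hp

theorem target_eq (h : A.Ends e p) {x : S.Obj} (hp : p.letter X Y A.label = some ⟨x, true⟩) :
    A.target e = p := by
  obtain rfl | h := h
  · simp [A.source_letter] at hp
  · exact h

end Graph.Ends

theorem Graph.Joined.exists_ends {X Y : Word S} {A : Graph S X Y} {p q : Port A.Node}
    (h : A.Joined p q) : ∃ e, A.Ends e p ∧ A.Ends e q := by
  obtain ⟨e, ⟨h, h'⟩ | ⟨h, h'⟩⟩ := h
  exacts [⟨e, .inl h, .inr h'⟩, ⟨e, .inr h', .inl h⟩]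

/-! ### Composites -/

section Composite

variable {X Y Z : Word S} {A : Graph S X Y} {B : Graph S Y Z} {C : Graph S X Z}

/-- A composite of graphs without cups has the expected edges: the pieces that make up an edge are
linked in turn, so they become the same edge. -/
theorem Composite.joined (c : Composite A B C) {p q : Port (A.Node ⊕ B.Node)}
    (h : CompJoined A.Joined B.Joined p q) : C.Joined (p.map c.node) (q.map c.node) := by
  have hA {e : A.Edge} {p : Port A.Node} (h : A.Ends e p) (hp : ∀ j, p ≠ .out j) :
      C.Ends (c.edge (.inl e)) ((p.map Sum.inl).map c.node) := by
    rw [Port.map_map]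
    obtain rfl | rfl := h
    exacts [.inl (c.source_inl e hp), .inr (c.target_inl e hp)]
  have hB {e : B.Edge} {p : Port B.Node} (h : B.Ends e p) (hp : ∀ j, p ≠ .inp j) :
      C.Ends (c.edge (.inr e)) ((p.map Sum.inr).map c.node) := by
    rw [Port.map_map]
    obtain rfl | rfl := h
    exacts [.inl (c.source_inr e hp), .inr (c.target_inr e hp)]
  have hAB {e : A.Edge} {e' : B.Edge} {j : ℕ} (h : A.Ends e (.out j)) (h' : B.Ends e' (.inp j)) :
      c.edge (.inl e) = c.edge (.inr e') :=
    (c.edge_eq_iff _ _).2 (.rel _ _ ⟨j, e, e', rfl, rfl, h, h'⟩)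
  have hne : p.map c.node ≠ q.map c.node := by
    intro hpq
    obtain rfl := Port.map_injective c.node.injective 0 0 hpq
    obtain ⟨l, h1, h2⟩ := h.letter
    rw [h1] at h2
    exact l.dual_ne (Option.some.inj h2).symm
  have key : ∃ e, C.Ends e (p.map c.node) ∧ C.Ends e (q.map c.node) := by
    clear hne
    cases h with
    | left h hp hq =>
      obtain ⟨e, h1, h2⟩ := h.exists_ends
      exact ⟨_, hA h1 hp, hA h2 hq⟩
    | up h h' hp hq =>
      obtain ⟨e, h1, h2⟩ := h.exists_ends
      obtain ⟨e', h3, h4⟩ := h'.exists_ends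
      exact ⟨_, hA h1 hp, hAB h2 h3 ▸ hB h4 hq⟩
    | down h h' hp hq =>
      obtain ⟨e, h1, h2⟩ := h.exists_ends
      obtain ⟨e', h3, h4⟩ := h'.exists_ends
      exact ⟨_, hAB h2 h3 ▸ hB h4 hq, hA h1 hp⟩
    | cap h h' h'' hp hq =>
      obtain ⟨e, h1, h2⟩ := h.exists_ends
      obtain ⟨e', h3, h4⟩ := h'.exists_ends
      obtain ⟨e'', h5, h6⟩ := h''.exists_ends
      exact ⟨_, hA h1 hp, (hAB h2 h3).trans (hAB h6 h4).symm ▸ hA h5 hq⟩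
    | right h hp hq =>
      obtain ⟨e, h1, h2⟩ := h.exists_ends
      exact ⟨_, hB h1 hp, hB h2 hq⟩
  obtain ⟨e, h1, h2⟩ := key
  exact (h1.eq_or_joined h2).resolve_left hne

/-- The edge `u` has an end at the port `P`, off the common boundary. -/
inductive OuterEnd (A : Graph S X Y) (B : Graph S Y Z) :
    A.Edge ⊕ B.Edge → Port (A.Node ⊕ B.Node) → Prop
  | inl {e : A.Edge} {p : Port A.Node} (h : A.Ends e p) (hp : ∀ j, p ≠ .out j) :
      OuterEnd A B (.inl e) (p.map Sum.inl)
  | inr {e : B.Edge} {p : Port B.Node} (h : B.Ends e p) (hp : ∀ j, p ≠ .inp j) :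
      OuterEnd A B (.inr e) (p.map Sum.inr)

theorem OuterEnd.unique {w w' : A.Edge ⊕ B.Edge} {P : Port (A.Node ⊕ B.Node)}
    (h : OuterEnd A B w P) (h' : OuterEnd A B w' P) : w = w' := by
  cases h with
  | @inl e p h hp =>
    generalize hP : p.map Sum.inl = P at h'
    cases h' with
    | inl h' hp' =>
      obtain rfl := Port.map_injective Sum.inl_injective _ _ hP
      rw [h.unique h']
    | inr h' hp' => exact absurd hP (Port.map_inl_ne_map_inr hp hp')
  | @inr e p h hp =>
    generalize hP : p.map Sum.inr = P at h'
    cases h' with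
    | inl h' hp' => exact absurd hP.symm (Port.map_inl_ne_map_inr hp' hp)
    | inr h' hp' =>
      obtain rfl := Port.map_injective Sum.inr_injective _ _ hP
      rw [h.unique h']

/-- The pieces at the two ends of an edge of the composite are connected by links. -/
theorem CompJoined.exists_outerEnd {P Q : Port (A.Node ⊕ B.Node)}
    (h : CompJoined A.Joined B.Joined P Q) : ∃ w w', OuterEnd A B w P ∧ OuterEnd A B w' Q ∧
      Relation.EqvGen (Linked A B) w w' := by
  have hAB {e : A.Edge} {e' : B.Edge} {j : ℕ} (h : A.Ends e (.out j)) (h' : B.Ends e' (.inp j)) :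
      Relation.EqvGen (Linked A B) (.inl e) (.inr e') :=
    .rel _ _ ⟨j, e, e', rfl, rfl, h, h'⟩
  cases h with
  | left h hp hq =>
    obtain ⟨e, h1, h2⟩ := h.exists_ends
    exact ⟨_, _, .inl h1 hp, .inl h2 hq, .refl _⟩
  | up h h' hp hq =>
    obtain ⟨e, h1, h2⟩ := h.exists_ends
    obtain ⟨e', h3, h4⟩ := h'.exists_ends
    exact ⟨_, _, .inl h1 hp, .inr h4 hq, hAB h2 h3⟩
  | down h h' hp hq =>
    obtain ⟨e, h1, h2⟩ := h.exists_ends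
    obtain ⟨e', h3, h4⟩ := h'.exists_ends
    exact ⟨_, _, .inr h4 hq, .inl h1 hp, (hAB h2 h3).symm⟩
  | cap h h' h'' hp hq =>
    obtain ⟨e, h1, h2⟩ := h.exists_ends
    obtain ⟨e', h3, h4⟩ := h'.exists_ends
    obtain ⟨e'', h5, h6⟩ := h''.exists_ends
    exact ⟨_, _, .inl h1 hp, .inl h5 hq, (hAB h2 h3).trans _ _ _ (hAB h6 h4).symm⟩
  | right h hp hq =>
    obtain ⟨e, h1, h2⟩ := h.exists_ends
    exact ⟨_, _, .inr h1 hp, .inr h2 hq, .refl _⟩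

/-- Graphs with the edges of the composite of `A` and `B` are composites in the sense of gluing
linked edges. -/
theorem Composite.of_joined (hA : ∀ i j, ¬ A.Joined (.out i) (.out j))
    (φ : A.Node ⊕ B.Node ≃ C.Node) (hl : ∀ α, C.label (φ α) = Sum.elim A.label B.label α)
    (hp : ∀ α, C.parity (φ α) = Sum.elim A.parity B.parity α)
    (hC : ∀ p q, C.Joined (p.map φ) (q.map φ) ↔ CompJoined A.Joined B.Joined p q) :
    Nonempty (Composite A B C) := by
  have hout {p : Port A.Node} {i : ℕ} (h : A.Joined p (.out i)) (j : ℕ) : p ≠ .out j := by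
    rintro rfl
    exact hA _ _ h
  -- An edge of the first factor has an end off the common boundary, and lies on the edge of `C`
  -- that ends there.
  have exA (e : A.Edge) : ∃ p, A.Ends e p ∧ ∀ j, p ≠ .out j := by
    by_cases h : ∀ j, A.source e ≠ .out j
    · exact ⟨_, .inl rfl, h⟩
    · push Not at h
      obtain ⟨j, hj⟩ := h
      refine ⟨_, .inr rfl, fun k hk => hA j k ⟨e, .inl ⟨hj, hk⟩⟩⟩
  have endA {d : C.Edge} {e : A.Edge} {p q : Port A.Node} (hp : A.Ends e p)
      (hp' : ∀ j, p ≠ .out j) (hd : C.Ends d ((p.map Sum.inl).map φ)) (hq : A.Ends e q)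
      (hq' : ∀ j, q ≠ .out j) : C.Ends d ((q.map Sum.inl).map φ) := by
    obtain rfl | h := hp.eq_or_joined hq
    · exact hd
    · obtain ⟨d', h1, h2⟩ := ((hC _ _).2 (.left h hp' hq')).exists_ends
      rwa [hd.unique h1]
  have endB {d : C.Edge} {e : B.Edge} {p q : Port B.Node} (hp : B.Ends e p)
      (hp' : ∀ j, p ≠ .inp j) (hd : C.Ends d ((p.map Sum.inr).map φ)) (hq : B.Ends e q)
      (hq' : ∀ j, q ≠ .inp j) : C.Ends d ((q.map Sum.inr).map φ) := by
    obtain rfl | h := hp.eq_or_joined hq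
    · exact hd
    · obtain ⟨d', h1, h2⟩ := ((hC _ _).2 (.right h hp' hq')).exists_ends
      rwa [hd.unique h1]
  have keyA (e : A.Edge) : ∃ d, ∀ p, A.Ends e p → (∀ j, p ≠ .out j) →
      C.Ends d ((p.map Sum.inl).map φ) := by
    obtain ⟨p, hp, hp'⟩ := exA e
    obtain ⟨q, hq, hq'⟩ := hp.exists_joined
    have : ∃ Q, CompJoined A.Joined B.Joined (p.map Sum.inl) Q := by
      by_cases h : ∀ j, q ≠ .out j
      · exact ⟨_, .left hq hp' h⟩
      · push Not at h
        obtain ⟨j, rfl⟩ := h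
        obtain ⟨r, hr⟩ := Graph.exists_joined_inp B hq
        by_cases h : ∀ j, r ≠ .inp j
        · exact ⟨_, .up hq hr hp' h⟩
        · push Not at h
          obtain ⟨k, rfl⟩ := h
          obtain ⟨s, hs⟩ := Graph.exists_joined_out A hr
          exact ⟨_, .cap hq hr hs hp' (hout hs)⟩
    obtain ⟨Q, hQ⟩ := this
    obtain ⟨d, hd, -⟩ := ((hC _ _).2 hQ).exists_ends
    exact ⟨d, fun p' h h' => endA hp hp' hd h h'⟩
  choose f hf using keyA
  -- Two edges of the first factor that are linked to the same edge of the second lie on the same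
  -- edge of `C`, namely the cap that they form together.
  have linkA {e e' : A.Edge} {j k : ℕ} (h : B.Joined (.inp j) (.inp k)) (he : A.Ends e (.out j))
      (he' : A.Ends e' (.out k)) : f e = f e' := by
    obtain ⟨p, hp, hp'⟩ := he.exists_joined
    obtain ⟨q, hq, hq'⟩ := he'.exists_joined
    obtain ⟨d, h1, h2⟩ :=
      ((hC _ _).2 (.cap hp.symm h hq.symm (hout hp.symm) (hout hq.symm))).exists_ends
    exact ((hf e _ hp' (hout hp.symm)).unique h1).trans
      ((hf e' _ hq' (hout hq.symm)).unique h2).symm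
  -- An edge of the second factor lies on the edge of `C` at its outer end, if it has one, and on
  -- that of the linked edges of the first factor otherwise.
  have keyB (e' : B.Edge) : ∃ d, (∀ q, B.Ends e' q → (∀ j, q ≠ .inp j) →
      C.Ends d ((q.map Sum.inr).map φ)) ∧
      ∀ j e, B.Ends e' (.inp j) → A.Ends e (.out j) → f e = d := by
    by_cases h : ∃ q, B.Ends e' q ∧ ∀ j, q ≠ .inp j
    · obtain ⟨q, hq, hq'⟩ := h
      obtain ⟨r, hr, hr'⟩ := hq.exists_joined
      by_cases h : ∀ j, r ≠ .inp j
      · obtain ⟨d, hd, -⟩ := ((hC _ _).2 (.right hr hq' h)).exists_ends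
        refine ⟨d, fun q' h1 h2 => endB hq hq' hd h1 h2, fun j e h1 _ => ?_⟩
        obtain rfl | h2 := hr'.eq_or_joined h1
        · exact absurd rfl (h j)
        · exact absurd (hr.symm.unique h2) (hq' j)
      · push Not at h
        obtain ⟨j, rfl⟩ := h
        obtain ⟨s, hs⟩ := Graph.exists_joined_out A hr
        obtain ⟨d, hd1, hd2⟩ := ((hC _ _).2 (.up hs hr.symm (hout hs) hq')).exists_ends
        refine ⟨d, fun q' h1 h2 => endB hq hq' hd2 h1 h2, fun k e h1 h2 => ?_⟩
        obtain h3 | h3 := h1.eq_or_joined hr'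
        · obtain rfl := Port.inp.inj h3
          obtain ⟨e₀, h4, h5⟩ := hs.exists_ends
          rw [h2.unique h5]
          exact (hf e₀ _ h4 (hout hs)).unique hd1
        · exact absurd (hr.symm.unique h3.symm) (hq' k)
    · push Not at h
      obtain ⟨j, hj⟩ := h _ (.inl rfl)
      have hj' : B.Ends e' (.inp j) := .inl hj
      obtain ⟨q, hq, hq'⟩ := hj'.exists_joined
      obtain ⟨k, rfl⟩ := h _ hq'
      obtain ⟨s, hs⟩ := Graph.exists_joined_out A hq.symm
      obtain ⟨e₀, -, h0⟩ := hs.exists_ends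
      refine ⟨f e₀, fun q h1 h2 => ?_, fun i e h1 h2 => ?_⟩
      · obtain ⟨j, hj⟩ := h _ h1
        exact absurd hj (h2 j)
      · obtain h3 | h3 := h1.eq_or_joined hj'
        · obtain rfl := Port.inp.inj h3
          rw [h2.unique h0]
        · exact linkA h3 h2 h0
  choose g hg hfg using keyB
  have hends {w : A.Edge ⊕ B.Edge} {P} (h : OuterEnd A B w P) :
      C.Ends (Sum.elim f g w) (P.map φ) := by
    cases h with
    | inl h hp => exact hf _ _ h hp
    | inr h hp => exact hg _ _ h hp
  have hlink {u v} (h : Relation.EqvGen (Linked A B) u v) : Sum.elim f g u = Sum.elim f g v := by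
    induction h with
    | rel _ _ h =>
      obtain ⟨j, e, e', rfl, rfl, h, h'⟩ := h
      exact hfg e' j e h' h
    | refl => rfl
    | symm _ _ _ ih => exact ih.symm
    | trans _ _ _ _ _ ih ih' => exact ih.trans ih'
  -- Every edge is connected by links to one with an end off the common boundary. As that end
  -- determines the edge of `C`, edges of `C` correspond to classes of linked edges.
  have hexists (u : A.Edge ⊕ B.Edge) : ∃ w P, Relation.EqvGen (Linked A B) u w ∧
      OuterEnd A B w P := by
    rcases u with e | e'
    · obtain ⟨p, h, hp⟩ := exA e
      exact ⟨_, _, .refl _, .inl h hp⟩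
    · by_cases h : ∀ j, B.source e' ≠ .inp j
      · exact ⟨_, _, .refl _, .inr (.inl rfl) h⟩
      · push Not at h
        obtain ⟨j, hj⟩ := h
        have hj' : B.Ends e' (.inp j) := .inl hj
        obtain ⟨q, hq, -⟩ := hj'.exists_joined
        obtain ⟨s, hs⟩ := Graph.exists_joined_out A hq.symm
        obtain ⟨e, h1, h2⟩ := hs.exists_ends
        exact ⟨_, _, .symm _ _ (.rel _ _ ⟨j, e, e', rfl, rfl, h2, hj'⟩), .inl h1 (hout hs)⟩
  have hli (α) : C.label (φ (.inl α)) = A.label α := hl _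
  have hlr (β) : C.label (φ (.inr β)) = B.label β := hl _
  have letl {p : Port A.Node} (hp : ∀ j, p ≠ .out j) :
      ((p.map Sum.inl).map φ).letter X Z C.label = p.letter X Y A.label := by
    rw [Port.letter_map (l := Sum.elim A.label B.label) hl, Port.letter_map_inl hp]
  have letr {p : Port B.Node} (hp : ∀ j, p ≠ .inp j) :
      ((p.map Sum.inr).map φ).letter X Z C.label = p.letter Y Z B.label := by
    rw [Port.letter_map (l := Sum.elim A.label B.label) hl, Port.letter_map_inr hp]
  have labA (e : A.Edge) : C.edgeLabel (f e) = A.edgeLabel e := by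
    obtain ⟨p, h, hp⟩ := exA e
    have h1 := (hf e p h hp).symbol
    rw [letl hp, h.symbol] at h1
    exact (Option.some.inj h1).symm
  have labB (e : B.Edge) : C.edgeLabel (g e) = B.edgeLabel e := by
    by_cases h : ∀ j, B.source e ≠ .inp j
    · have h1 := (hg e _ (.inl rfl) h).symbol
      rw [letr h, B.source_letter] at h1
      exact (Option.some.inj h1).symm
    · push Not at h
      obtain ⟨j, hj⟩ := h
      have hj' : B.Ends e (.inp j) := .inl hj
      obtain ⟨q, hq, -⟩ := hj'.exists_joined
      obtain ⟨s, hs⟩ := Graph.exists_joined_out A hq.symm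
      obtain ⟨e', h1, h2⟩ := hs.exists_ends
      rw [← hfg e j e' hj' h2, labA]
      have h3 := h2.symbol
      have h4 := hj'.symbol
      rw [Port.letter_out, Word.getElem?_dual, Option.map_map] at h3
      rw [Port.letter_inp] at h4
      have e : Letter.symbol ∘ Letter.dual = (Letter.symbol : Letter S.Obj → S.Obj) := rfl
      rw [e, h4] at h3
      exact (Option.some.inj h3).symm
  refine ⟨⟨φ, Sum.elim f g, hli, hlr, fun _ => hp _, fun _ => hp _, fun d => ?_, fun u v =>
    ⟨fun h => ?_, hlink⟩, labA, labB, fun e h => ?_, fun e h => ?_, fun e h => ?_, fun e h => ?_⟩⟩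
  · have e (p : Port C.Node) : (p.map φ.symm).map φ = p := by
      rw [Port.map_map, Equiv.self_comp_symm, Port.map_id]
    have h := Graph.joined_source_target d
    rw [← e (C.source d), ← e (C.target d), hC] at h
    obtain ⟨w, w', hw, -⟩ := h.exists_outerEnd
    refine ⟨w, (hends hw).unique (.inl ?_)⟩
    rw [e]
  · obtain ⟨w, P, hw, hP⟩ := hexists u
    obtain ⟨w', P', hw', hP'⟩ := hexists v
    have h1 := hends hP
    rw [← hlink hw, h, hlink hw'] at h1
    refine hw.trans _ _ _ (.trans _ _ _ ?_ hw'.symm)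
    obtain h2 | h2 := h1.eq_or_joined (hends hP')
    · obtain rfl := Port.map_injective φ.injective 0 0 h2
      rw [hP.unique hP']
      exact .refl _
    · obtain ⟨w₁, w₂, hw₁, hw₂, h3⟩ := ((hC _ _).1 h2).exists_outerEnd
      rwa [hP.unique hw₁, hP'.unique hw₂]
  · have h1 := (hf e _ (.inl rfl) h).source_eq ((letl h).trans (A.source_letter e))
    rwa [Port.map_map] at h1
  · have h1 := (hg e _ (.inl rfl) h).source_eq ((letr h).trans (B.source_letter e))
    rwa [Port.map_map] at h1
  · have h1 := (hf e _ (.inr rfl) h).target_eq ((letl h).trans (A.target_letter e))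
    rwa [Port.map_map] at h1
  · have h1 := (hg e _ (.inr rfl) h).target_eq ((letr h).trans (B.target_letter e))
    rwa [Port.map_map] at h1

end Composite

theorem Net.nonempty_composite {X Y Z : Word S} (A : Net S X Y) (B : Net S Y Z) :
    Nonempty (Composite A.toGraph B.toGraph (A.comp B).toGraph) :=
  Composite.of_joined A.not_joined_out_out (Equiv.refl (A.Node ⊕ B.Node)) (fun _ => rfl)
    (fun _ => rfl) fun p q => by
      have e (p : Port (A.Node ⊕ B.Node)) : p.map (Equiv.refl (A.Node ⊕ B.Node)) = p :=
        Port.map_id p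
      exact (congrArg₂ (A.comp B).Joined (e p) (e q)).to_iff.trans Net.comp_joined

/-! ### Graphs side by side and reflections -/

section SideBySide

variable {X Y X' Y' : Word S} {A : Graph S X Y} {B : Graph S X' Y'}

theorem SideBySide.joined {C : Graph S (X ++ X') (Y ++ Y')} (c : SideBySide A B C)
    {p q : Port (A.Node ⊕ B.Node)}
    (h : TensorJoined X.length Y.length A.Joined B.Joined p q) :
    C.Joined (p.map c.node) (q.map c.node) := by
  cases h with
  | left h =>
    rw [Port.map_map, Port.map_map]
    obtain ⟨e, ⟨rfl, rfl⟩ | ⟨rfl, rfl⟩⟩ := h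
    exacts [⟨_, .inl ⟨c.source_inl e, c.target_inl e⟩⟩, ⟨_, .inr ⟨c.source_inl e, c.target_inl e⟩⟩]
  | right h =>
    rw [Port.map_map, Port.map_map, zero_add, zero_add]
    obtain ⟨e, ⟨rfl, rfl⟩ | ⟨rfl, rfl⟩⟩ := h
    exacts [⟨_, .inl ⟨c.source_inr e, c.target_inr e⟩⟩, ⟨_, .inr ⟨c.source_inr e, c.target_inr e⟩⟩]

/-- Each edge of `A` or of `B` determines an edge of `C` by its source. -/
theorem SideBySide.of_joined {C : Graph S (X ++ X') (Y ++ Y')} (φ : A.Node ⊕ B.Node ≃ C.Node)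
    (hl : ∀ α, C.label (φ α) = Sum.elim A.label B.label α)
    (hp : ∀ α, C.parity (φ α) = Sum.elim A.parity B.parity α)
    (hC : ∀ p q, C.Joined (p.map φ) (q.map φ) ↔
      TensorJoined X.length Y.length A.Joined B.Joined p q) : Nonempty (SideBySide A B C) := by
  have letl {p : Port A.Node} {a} (h : p.letter X Y A.label = some a) :
      ((p.map Sum.inl).map φ).letter (X ++ X') (Y ++ Y') C.label = some a := by
    rw [Port.letter_map (l := Sum.elim A.label B.label) hl, Port.letter_map_inl_append h]
  have letr {p : Port B.Node} {a} (h : p.letter X' Y' B.label = some a) :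
      ((p.map Sum.inr X.length Y.length).map φ).letter (X ++ X') (Y ++ Y') C.label = some a := by
    rw [Port.letter_map (l := Sum.elim A.label B.label) hl, Port.letter_map_inr_append, h]
  have keyA (e : A.Edge) := ((hC _ _).2 (.left (Graph.joined_source_target e))).exists_edge
    (letl (A.source_letter e))
  have keyB (e : B.Edge) := ((hC _ _).2 (.right (Graph.joined_source_target e))).exists_edge
    (letr (B.source_letter e))
  choose f hf hf' using keyA
  choose g hg hg' using keyB
  have hfun : Function.Injective (Sum.elim f g) := by
    have hne (e e') : f e ≠ g e' := by
      intro h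
      have h1 := hf e
      rw [h, hg] at h1
      exact Port.map_inl_ne_map_inr_of_letter (A.source_letter e)
        (Port.map_injective φ.injective 0 0 h1.symm)
    rintro (e | e) (e' | e') h
    · have h1 := hf e
      rw [show f e = f e' from h, hf] at h1
      rw [Graph.source_injective (Port.map_injective Sum.inl_injective 0 0
        (Port.map_injective φ.injective 0 0 h1.symm))]
    · exact absurd h (hne _ _)
    · exact absurd h.symm (hne _ _)
    · have h1 := hg e
      rw [show g e = g e' from h, hg] at h1
      rw [Graph.source_injective (Port.map_injective Sum.inr_injective X.length Y.length
        (Port.map_injective φ.injective 0 0 h1.symm))]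
  have hsurj : Function.Surjective (Sum.elim f g) := by
    intro d
    have e (p : Port C.Node) : (p.map φ.symm).map φ = p := by
      rw [Port.map_map, Equiv.self_comp_symm, Port.map_id]
    have h := Graph.joined_source_target d
    rw [← e (C.source d), ← e (C.target d), hC] at h
    have hd : C.Ends d (((C.source d).map φ.symm).map φ) := .inl (e _).symm
    revert h hd
    generalize (C.source d).map φ.symm = P
    generalize (C.target d).map φ.symm = Q
    rintro (h | h) hd
    · obtain ⟨e, rfl | rfl, -⟩ := h.exists_ends
      exacts [⟨.inl e, Graph.Ends.unique (.inl (hf e)) hd⟩,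
        ⟨.inl e, Graph.Ends.unique (.inr (hf' e)) hd⟩]
    · obtain ⟨e, rfl | rfl, -⟩ := h.exists_ends
      exacts [⟨.inr e, Graph.Ends.unique (.inl (hg e)) hd⟩,
        ⟨.inr e, Graph.Ends.unique (.inr (hg' e)) hd⟩]
  refine ⟨⟨φ, Equiv.ofBijective _ ⟨hfun, hsurj⟩, fun _ => hl _, fun _ => hl _, fun _ => hp _,
    fun _ => hp _, fun e => ?_, fun e => ?_, fun e => (hf e).trans (Port.map_map _ _ _ _ _ _ _),
    fun e => (hg e).trans ((Port.map_map _ _ _ _ _ _ _).trans (by rw [zero_add, zero_add]; rfl)),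
    fun e => (hf' e).trans (Port.map_map _ _ _ _ _ _ _),
    fun e => (hg' e).trans ((Port.map_map _ _ _ _ _ _ _).trans (by rw [zero_add, zero_add]; rfl))⟩⟩
  · have h := Graph.Ends.symbol (.inl (hf e))
    rw [letl (A.source_letter e)] at h
    exact (Option.some.inj h).symm
  · have h := Graph.Ends.symbol (.inl (hg e))
    rw [letr (B.source_letter e)] at h
    exact (Option.some.inj h).symm

theorem Net.nonempty_sideBySide (A : Net S X Y) (B : Net S X' Y') :
    Nonempty (SideBySide A.toGraph B.toGraph (A.tensor B).toGraph) :=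
  SideBySide.of_joined (Equiv.refl (A.Node ⊕ B.Node)) (fun _ => rfl)
    (fun _ => rfl) fun p q => by
      have e (p : Port (A.Node ⊕ B.Node)) : p.map (Equiv.refl (A.Node ⊕ B.Node)) = p :=
        Port.map_id p
      exact (congrArg₂ (A.tensor B).Joined (e p) (e q)).to_iff.trans Net.tensor_joined

end SideBySide

theorem Reflection.joined {X Y : Word S} {A : Graph S X Y}
    {B : Graph S (Word.dual Y) (Word.dual X)} (r : Reflection A B) {p q : Port A.Node}
    (h : ReflectJoined A.Joined p q) : B.Joined (p.map r.node) (q.map r.node) := by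
  have e (p : Port A.Node) : (p.reflect id).reflect r.node = p.map r.node := by
    cases p <;> simp
  rw [← e, ← e]
  obtain ⟨d, ⟨h, h'⟩ | ⟨h, h'⟩⟩ := h
  · rw [← h, ← h']
    exact ⟨r.edge d, .inl ⟨r.source_edge d, r.target_edge d⟩⟩
  · rw [← h, ← h']
    exact ⟨r.edge d, .inr ⟨r.source_edge d, r.target_edge d⟩⟩

theorem Graph.nonempty_reflection {X Y : Word S} {A : Graph S X Y} (hA : A.IsDualisable) :
    Nonempty (Reflection A (A.reflect hA)) :=
  ⟨⟨Equiv.refl A.Node, Equiv.refl A.Edge, fun _ => rfl, fun _ => rfl, fun _ => rfl, fun _ => rfl,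
    fun _ => rfl⟩⟩

/-! ### The category of diagrams -/

namespace Diagram

variable {X Y : Word S}

/-- The graph of a diagram. -/
def net (A : Diagram S X Y) : Net S X Y := ⟨A.toGraph, A.isRealisable⟩

/-- The isomorphism class of a diagram. -/
noncomputable def cls (A : Diagram S X Y) : X ⟶ Y := A.net.hom

end Diagram

theorem Net.exists_diagram {X Y : Word S} (A : Net S X Y) :
    ∃ D : Diagram S X Y, D.toGraph = A.toGraph := by
  obtain ⟨D, hD, -⟩ := A.isRealisable.exists_diagram
  exact ⟨D, hD⟩

theorem Diagram.cls_eq {X Y : Word S} {D : Diagram S X Y} {A : Net S X Y}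
    (h : D.toGraph = A.toGraph) : D.cls = A.hom :=
  Net.hom_eq_iff.2 (h ▸ Iso.nonempty_refl D.toGraph)

theorem eqToHom_comp_comp_eqToHom {C : Type u} [Category.{v} C] {X Y : C} (f : X ⟶ Y) :
    eqToHom rfl ≫ f ≫ eqToHom rfl = f := by
  simp

/-- Since a graph is the graph of a diagram exactly if it is realisable, the operations on nets are
the operations on diagrams. -/
theorem isDiagramCategory (S : TeleologicalSignature.{v, u}) :
    IsDiagramCategory S fun {_ _} A => Diagram.cls A where
  cls_surjective f := by
    obtain ⟨A, rfl⟩ := Net.hom_surjective f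
    obtain ⟨D, hD⟩ := A.exists_diagram
    exact ⟨D, Diagram.cls_eq hD⟩
  cls_eq_iff A B := Net.hom_eq_iff
  exists_identity X := by
    obtain ⟨D, hD⟩ := (Net.id X).exists_diagram
    exact ⟨D, hD ▸ ⟨inferInstanceAs (IsEmpty Empty), fun i hi => Net.id_joined.2 (.up hi)⟩⟩
  cls_identity {X} A hA := by
    have h : IsWire id A.cls := ⟨A.net, rfl, hA.isEmpty_node, hA.joins⟩
    exact h.ext (.id X) fun _ _ => rfl
  exists_composite A B := by
    obtain ⟨D, hD⟩ := (A.net.comp B.net).exists_diagram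
    exact ⟨D, hD ▸ A.net.nonempty_composite B.net⟩
  cls_composite A B C c := by
    refine (Net.hom_eq (A := A.net.comp B.net) (B := C.net) c.node ?_ fun p q h =>
      c.joined (p := p) (q := q) (Net.comp_joined.1 h)).symm
    rintro (α | α)
    exacts [c.label_inl α, c.label_inr α]
  unit_eq := rfl
  tensor_eq _ _ := rfl
  exists_tensor A B := by
    obtain ⟨D, hD⟩ := (A.net.tensor B.net).exists_diagram
    exact ⟨D, hD ▸ A.net.nonempty_sideBySide B.net⟩
  cls_tensor A B C c := by
    refine (Net.hom_eq (A := A.net.tensor B.net) (B := C.net) c.node ?_ fun p q h =>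
      c.joined (p := p) (q := q) (Net.tensor_joined.1 h)).trans
      (eqToHom_comp_comp_eqToHom C.cls).symm
    rintro (α | α)
    exacts [c.label_inl α, c.label_inr α]
  associator_eq _ _ _ := rfl
  leftUnitor_eq _ := rfl
  rightUnitor_eq _ := rfl
  exists_symmetry X Y := by
    obtain ⟨D, hD⟩ := (Net.symmetry X Y).exists_diagram
    refine ⟨D, hD ▸ ⟨inferInstanceAs (IsEmpty Empty), fun i hi => Net.wire_joined.2 ?_,
      fun j hj => Net.wire_joined.2 ?_⟩⟩
    · rw [← blockSwap_of_lt Y.length hi]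
      exact .up (by rw [List.length_append]; omega)
    · have h := WireJoined.up (X := X ++ Y) (σ := blockSwap X.length Y.length)
        (i := X.length + j) (by rw [List.length_append]; omega)
      rwa [blockSwap_add _ hj] at h
  cls_symmetry {X Y} A hA := by
    have h : IsWire (blockSwap X.length Y.length) A.cls := by
      refine ⟨A.net, rfl, hA.isEmpty_node, fun i hi => ?_⟩
      by_cases h : i < X.length
      · rw [blockSwap_of_lt _ h]
        exact hA.joins_left i h
      · obtain ⟨k, rfl⟩ := Nat.exists_eq_add_of_le (not_lt.1 h)
        rw [List.length_append] at hi
        rw [blockSwap_add _ (by omega)]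
        exact hA.joins_right k (by omega)
    exact ((IsWire.braiding X Y).ext h fun _ _ => rfl).trans (eqToHom_comp_comp_eqToHom A.cls).symm
  dualisable_iff f := by
    constructor
    · rintro ⟨A, rfl, hA⟩
      obtain ⟨D, hD, hD'⟩ := Graph.IsDualisable.exists_diagram A.isRealisable hA
      exact ⟨D, hD', Diagram.cls_eq hD⟩
    · rintro ⟨D, hD, rfl⟩
      exact ⟨D.net, rfl, hD.isDualisable_toGraph⟩
  dual_eq _ := rfl
  exists_reflection A hA := by
    have hA' := hA.isDualisable_toGraph
    obtain ⟨D, hD, hD'⟩ := Graph.IsDualisable.exists_diagram (A.net.reflect hA').isRealisable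
      (Net.isDualisable_reflect hA')
    exact ⟨D, hD', hD ▸ Graph.nonempty_reflection hA'⟩
  cls_reflection A B hA r h := by
    refine ((A.net.dualHom_hom hA.isDualisable_toGraph h).trans
      (Net.hom_eq (A := A.net.reflect hA.isDualisable_toGraph) (B := B.net) r.node r.label_node
      fun p q h => r.joined (p := p) (q := q) (Net.reflect_joined.1 h))).trans
      (eqToHom_comp_comp_eqToHom B.cls).symm
  exists_caps X := by
    obtain ⟨D, hD⟩ := (Net.caps X).exists_diagram
    exact ⟨D, hD ▸ ⟨inferInstanceAs (IsEmpty Empty), fun i hi => Graph.caps_joined.2 (.left hi)⟩⟩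
  cls_caps {X} A hA := by
    have h : IsCap (fun i => if i < X.length then X.length + i else i - X.length) A.cls := by
      refine ⟨A.net, rfl, hA.isEmpty_node, fun i hi => ?_⟩
      by_cases h : i < X.length
      · simp only [if_pos h]
        exact hA.joins i h
      · obtain ⟨k, rfl⟩ := Nat.exists_eq_add_of_le (not_lt.1 h)
        rw [List.length_append, Word.length_dual] at hi
        simp only [if_neg h, Nat.add_sub_cancel_left]
        exact Graph.Joined.symm (hA.joins k (by omega))
    exact ((IsCap.caps X).ext h fun _ _ => rfl).trans (eqToHom_comp_comp_eqToHom A.cls).symm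

end Teleological


theorem mainTheorem2 (S : Teleological.TeleologicalSignature.{v, u}) :
    ∃ (_ : Category.{max 1 u v, u} (Teleological.Word S))
      (_ : MonoidalCategory (Teleological.Word S))
      (_ : SymmetricCategory (Teleological.Word S))
      (_ : Teleological.TeleologicalCategory (Teleological.Word S))
      (cls : ∀ {X Y : Teleological.Word S}, Teleological.Diagram S X Y → (X ⟶ Y)),
      Teleological.IsDiagramCategory S cls :=
  ⟨_, _, _, _, _, Teleological.isDiagramCategory S⟩
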